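/- **Setting.** Let $n\ge 0$ and $m,r\ge 1$ be integers and let $M$ be a smooth (Hausdorff, second countable) $n$-manifold. In local coordinates a linear PDO $\mathcal L$ of order $r$ from $C^r(M,\mathbb R^{m+1})$ to $C^0(M,\mathbb R^m)$ with smooth coefficients is written $$\mathcal L(h)_a=\sum_{j=0}^{r}\Lambda_a^{\alpha\beta_1\dots\beta_j}\,\partial_{\beta_1\dots\beta_j}h_\alpha ,\qquad 1\le a\le m,\ 1\le\alpha\le m+1,\ 1\le\beta_i\le n,$$ where repeated indices are summed and $\Lambda_a^{\alpha\beta_1\dots\beta_j}$ is symmetric in $\beta_1,\dots,\beta_j$; equivalently, it is a smooth section $\Lambda$ of $Hom(J^r(M,\mathbb R^{m+1}),J^0(M,\mathbb R^m))$. It is *upper totally symmetric* (UTS) if its components of highest order $\Lambda_a^{\alpha\beta_1\dots\beta_r}$ are invariant under all permutations of the indices $\alpha\beta_1\dots\beta_r$ that keep the first one not larger than $m+1$. As this refers to coordinates, $M$ is given with a smooth atlas $\mathcal A$ of coordinate systems such that, at each point, the UTS condition does not depend on the chart of $\mathcal A$ in which it is tested (for instance one global chart); coordinates are those of $\mathcal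 A$. Let $\mathcal U^r_m(M)\subset Hom(J^r(M,\mathbb R^{m+1}),J^0(M,\mathbb R^m))$ be the subbundle of UTS coefficients and $J^{k}\mathcal U^r_m(M)$ the bundle of $k$-jets of its sections, with the fibre coordinates $\partial_\gamma\Lambda_a^{\alpha\beta_1\dots\beta_j}$, $|\gamma|\le k$. An *algebraic subbundle* of $J^{k}\mathcal U^r_m(M)$ is an open subset $\mathcal H$ that in the fibre coordinates of every chart of $\mathcal A$ is given, over every point, by one and the same Zariski open subset $S$ of the fibre (the complement of a set of common zeros of polynomials). The codimension of its complement is the codimension of the complement of $S$ in the fibre as a real algebraic set (difference of Krull dimensions of the rings of polynomial functions). For an algebraic subbundle $\mathcal H\subset J^{r+s}\mathcal U^r_m(M)$, an *$\mathcal H$-universal right inverse* is an operator $(\Lambda,g)\mapsto\mathcal M(\Lambda,g)\in C^\infty(M,\mathbb R^{m+1})$, defined for all $g\in C^\infty(M,\mathbb R^m)$ and all UTS PDOs $\Lambda$ of order $r$ with $j^{r+s}\Lambda(M)\subset\mathcal H$, which is a PDO of order $r+s$ in $\Lambda$ and linear of order $s$ in $g$ (in coordinates, a linear combination of the partial derivatives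 of order at most $s$ of $g$ whose coefficients are smooth functions of the point and of the $(r+s)$-jet of $\Lambda$ in $\mathcal H$), and which satisfies $\mathcal L_\Lambda(\mathcal M(\Lambda,g))=g$ for all such $\Lambda$ and $g$. **Theorem.** For all integers $n\ge0$ and $m,r\ge1$ there is an integer $\bar s=s(n,m,r)$, depending only on $n,m,r$, with $$\bar s\ \ge\ \frac{n}{(1+1/m)^{1/r}-1},$$ such that for every integer $s\ge\bar s$ and every $M$ and $\mathcal A$ as above there is an algebraic subbundle $\mathcal H^{r,s}_m(M)\subset J^{r+s}\mathcal U^r_m(M)$ such that 1. there is an $\mathcal H^{r,s}_m(M)$-universal right inverse; thus every UTS PDO $\Lambda$ with $j^{r+s}\Lambda(M)\subset\mathcal H^{r,s}_m(M)$ admits an $\mathcal H^{r,s}_m(M)$-universal right inverse; 2. $\mathcal H^{r,s}_m(M)$ is maximal, with respect to inclusion, among the algebraic subbundles $\mathcal H$ of $J^{r+s}\mathcal U^r_m(M)$ for which there is an $\mathcal H$-universal right inverse; 3. the complement of $\mathcal H^{r,s}_m(M)$ in $J^{r+s}\mathcal U^r_m(M)$ has codimension larger than $n$. -/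

import Mathlib

open scoped Manifold ContDiff

namespace UTS

/-- The model space `ℝⁿ`. -/
abbrev E (n : ℕ) : Type := EuclideanSpace ℝ (Fin n)

/-- Tuples `(β₁, …, βⱼ)` of coordinate indices, `0 ≤ j ≤ k`. -/
abbrev Tup (n k : ℕ) : Type := Σ j : Fin (k + 1), (Fin (j : ℕ) → Fin n)

/-- The iterated partial derivative `∂_{β₁ … βⱼ} f (y)`. -/
noncomputable def pd {n j : ℕ} (β : Fin j → Fin n) (f : E n → ℝ) (y : E n) : ℝ :=
  iteratedFDeriv ℝ j f y (fun i => EuclideanSpace.single (β i) (1 : ℝ))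

/-- The components `Λ^{α β₁ … βⱼ}_a`, `j ≤ r`, of a linear map from the `r`-jets of `ℝ^q`-valued
functions to `ℝ^q'` (here `a < q'` and `α < q`), in given coordinates. -/
abbrev Coef (n q q' r : ℕ) : Type := Fin q' → Fin q → Tup n r → ℝ

/-- The components are symmetric in the derivative indices `β₁, …, βⱼ`. -/
def IsSymm {n q q' r : ℕ} (l : Coef n q q' r) : Prop :=
  ∀ (a : Fin q') (α : Fin q) (j : Fin (r + 1)) (β : Fin (j : ℕ) → Fin n)
    (π : Equiv.Perm (Fin (j : ℕ))), l a α ⟨j, β ∘ π⟩ = l a α ⟨j, β⟩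

/-- Upper total symmetry: the components of highest order `Λ^{α β₁ … β_r}_a` are invariant under all
permutations of the `r + 1` indices `α β₁ … β_r` after which the first index still is one of the
`m + 1` values allowed for it. -/
def IsUTS {n m r : ℕ} (l : Coef n (m + 1) m r) : Prop :=
  ∀ (a : Fin m) (α α' : Fin (m + 1)) (β β' : Fin r → Fin n) (π : Equiv.Perm (Fin (r + 1))),
    (Fin.cons (α' : ℕ) (fun i => (β' i : ℕ)) : Fin (r + 1) → ℕ)
        = (Fin.cons (α : ℕ) (fun i => (β i : ℕ)) : Fin (r + 1) → ℕ) ∘ π →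
      l a α' ⟨Fin.last r, β'⟩ = l a α ⟨Fin.last r, β⟩

/-- `∑_{j ≤ r} Λ^{α β₁ … βⱼ}_a ∂_{β₁ … βⱼ} h_α (y)`, all repeated indices being summed. -/
noncomputable def applyCoef {n q q' r : ℕ} (l : Coef n q q' r) (h : E n → Fin q → ℝ) (y : E n)
    (a : Fin q') : ℝ :=
  ∑ α : Fin q, ∑ β : Tup n r, l a α β * pd β.2 (fun z => h z α) y

/-- Fibre coordinates `∂_γ Λ^{α β}_a` on the bundle of `k`-jets of sections `Λ`. -/
abbrev JetIdx (n q q' r k : ℕ) : Type := Fin q' × Fin q × Tup n r × Tup n k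

/-- The fibre coordinates of the `k`-jet at `y` of a section with components `l`. -/
noncomputable def jet {n q q' r : ℕ} (k : ℕ) (l : E n → Coef n q q' r) (y : E n) :
    JetIdx n q q' r k → ℝ :=
  fun p => pd p.2.2.2.2 (fun z => l z p.1 p.2.1 p.2.2.1) y

/-- The fibre, in coordinates, of the bundle of `k`-jets of sections of the bundle of upper totally
symmetric coefficients: all `∂_γ Λ` are symmetric in `γ`, and for each `γ` the array `∂_γ Λ`
satisfies the linear conditions that define these coefficients. -/
def utsJets (n m r k : ℕ) : Set (JetIdx n (m + 1) m r k → ℝ) :=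
  {p | (∀ (a : Fin m) (α : Fin (m + 1)) (β : Tup n r) (j : Fin (k + 1))
          (γ : Fin (j : ℕ) → Fin n) (π : Equiv.Perm (Fin (j : ℕ))),
          p (a, α, β, ⟨j, γ ∘ π⟩) = p (a, α, β, ⟨j, γ⟩)) ∧
       ∀ γ : Tup n k, IsSymm (fun a α β => p (a, α, β, γ)) ∧ IsUTS (fun a α β => p (a, α, β, γ))}

/-- `S` is Zariski open in `X`: the complement in `X` of a set of common zeros of polynomials. -/
def IsZariskiOpenIn {ι : Type} (S X : Set (ι → ℝ)) : Prop :=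
  ∃ I : Set (MvPolynomial ι ℝ), S = {p ∈ X | ∃ P ∈ I, MvPolynomial.eval p P ≠ 0}

/-- The dimension of a real algebraic set `Z`: the Krull dimension of its ring of polynomial
functions (`⊥` if `Z` is empty). -/
noncomputable def algDim {ι : Type} (Z : Set (ι → ℝ)) : WithBot ℕ∞ :=
  ringKrullDim (MvPolynomial ι ℝ ⧸ MvPolynomial.vanishingIdeal ℝ Z)

section Manifold

variable {n : ℕ} {M : Type*} [TopologicalSpace M] [ChartedSpace (E n) M]

/-- A linear PDO of order `r` with smooth coefficients from `ℝ^q`-valued to `ℝ^q'`-valued functions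
on `M`, given by its components in the charts of an atlas `𝒜`. Equivalently, a smooth section of
`Hom(J^r(M, ℝ^q), J^0(M, ℝ^q'))`. -/
structure LinPDO (𝒜 : Set (OpenPartialHomeomorph M (E n))) (q q' r : ℕ) where
  /-- the components in each chart, as functions of the coordinates -/
  coef : 𝒜 → E n → Coef n q q' r
  symm : ∀ (c : 𝒜), ∀ y ∈ c.1.target, IsSymm (coef c y)
  smooth : ∀ (c : 𝒜) (a : Fin q') (α : Fin q) (β : Tup n r),
    ContDiffOn ℝ ∞ (fun y => coef c y a α β) c.1.target
  /-- on overlaps of charts the components define the same operator -/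
  compat : ∀ (c c' : 𝒜) (h : M → Fin q → ℝ), ContMDiff (𝓡 n) 𝓘(ℝ, Fin q → ℝ) ∞ h →
    ∀ x ∈ c.1.source ∩ c'.1.source,
      applyCoef (coef c (c.1 x)) (h ∘ c.1.symm) (c.1 x)
        = applyCoef (coef c' (c'.1 x)) (h ∘ c'.1.symm) (c'.1 x)

/-- `L h = g` on `M`. -/
def LinPDO.Sends {𝒜 : Set (OpenPartialHomeomorph M (E n))} {q q' r : ℕ} (L : LinPDO 𝒜 q q' r)
    (h : M → Fin q → ℝ) (g : M → Fin q' → ℝ) : Prop :=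
  ∀ (c : 𝒜), ∀ x ∈ c.1.source, applyCoef (L.coef c (c.1 x)) (h ∘ c.1.symm) (c.1 x) = g x

/-- `L` is upper totally symmetric. -/
def LinPDO.IsUTS {𝒜 : Set (OpenPartialHomeomorph M (E n))} {m r : ℕ}
    (L : LinPDO 𝒜 (m + 1) m r) : Prop :=
  ∀ (c : 𝒜), ∀ y ∈ c.1.target, UTS.IsUTS (L.coef c y)

/-- `𝒜` is a smooth atlas of coordinate systems between which upper total symmetry at a point does
not depend on the choice of the coordinates, so that it defines a subbundle of
`Hom(J^r(M, ℝ^(m+1)), J^0(M, ℝ^m))`. -/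
structure IsUTSAtlas (m r : ℕ) (𝒜 : Set (OpenPartialHomeomorph M (E n))) : Prop where
  subset_maximalAtlas : 𝒜 ⊆ IsManifold.maximalAtlas (𝓡 n) ∞ M
  cover : ∀ x : M, ∃ c ∈ 𝒜, x ∈ c.source
  uts_iff : ∀ (L : LinPDO 𝒜 (m + 1) m r) (c c' : 𝒜), ∀ x ∈ c.1.source ∩ c'.1.source,
    (UTS.IsUTS (L.coef c (c.1 x)) ↔ UTS.IsUTS (L.coef c' (c'.1 x)))

/-- `j^k Λ(M) ⊂ H`, where the subbundle `H` has, in coordinates, the fibre `S`. -/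
def LinPDO.JetsIn {𝒜 : Set (OpenPartialHomeomorph M (E n))} {q q' r : ℕ} (L : LinPDO 𝒜 q q' r)
    (k : ℕ) (S : Set (JetIdx n q q' r k → ℝ)) : Prop :=
  ∀ (c : 𝒜), ∀ x ∈ c.1.source, jet k (L.coef c) (c.1 x) ∈ S

/-- `S` is the fibre, in the coordinates of each chart of `𝒜`, of an open algebraic subbundle of the
bundle of `k`-jets of upper totally symmetric coefficients over `M`: it is Zariski open in the fibre
of that bundle, and membership of a jet does not depend on the chart. -/
def IsAlgebraicSubbundle (𝒜 : Set (OpenPartialHomeomorph M (E n))) (m r k : ℕ)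
    (S : Set (JetIdx n (m + 1) m r k → ℝ)) : Prop :=
  IsZariskiOpenIn S (utsJets n m r k) ∧
  ∀ L : LinPDO 𝒜 (m + 1) m r, L.IsUTS → ∀ c c' : 𝒜, ∀ x ∈ c.1.source ∩ c'.1.source,
    (jet k (L.coef c) (c.1 x) ∈ S ↔ jet k (L.coef c') (c'.1 x) ∈ S)

/-- Let `H` be the subbundle with fibre `S` of the bundle of `(r+s)`-jets of upper totally symmetric
coefficients. `R` is an `H`-universal right inverse: `R (Λ, g)` is a PDO of order `r + s` in `Λ` and
linear of order `s` in `g` (in each chart it is a linear combination of derivatives of order `≤ s` of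
`g`, whose coefficients `N` are smooth functions of the point and of the `(r+s)`-jet of `Λ`,
defined on `H`), and `L_Λ (R (Λ, g)) = g` for all smooth `g` and all `Λ` with `(r+s)`-jet in `H`. -/
def IsUniversalRightInverse (𝒜 : Set (OpenPartialHomeomorph M (E n))) (m r s : ℕ)
    (S : Set (JetIdx n (m + 1) m r (r + s) → ℝ))
    (R : LinPDO 𝒜 (m + 1) m r → (M → Fin m → ℝ) → (M → Fin (m + 1) → ℝ)) : Prop :=
  (∀ c : 𝒜, ∃ N : E n × (JetIdx n (m + 1) m r (r + s) → ℝ) → Coef n m (m + 1) s,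
    ContDiffOn ℝ ∞ N (c.1.target ×ˢ S) ∧
    ∀ L : LinPDO 𝒜 (m + 1) m r, L.IsUTS → L.JetsIn (r + s) S →
      ∀ g : M → Fin m → ℝ, ContMDiff (𝓡 n) 𝓘(ℝ, Fin m → ℝ) ∞ g → ∀ x ∈ c.1.source,
        R L g x = applyCoef (N (c.1 x, jet (r + s) (L.coef c) (c.1 x))) (g ∘ c.1.symm) (c.1 x)) ∧
  ∀ L : LinPDO 𝒜 (m + 1) m r, L.IsUTS → L.JetsIn (r + s) S →
    ∀ g : M → Fin m → ℝ, ContMDiff (𝓡 n) 𝓘(ℝ, Fin m → ℝ) ∞ g →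
      ContMDiff (𝓡 n) 𝓘(ℝ, Fin (m + 1) → ℝ) ∞ (R L g) ∧ L.Sends (R L g) g

end Manifold

end UTS

namespace UTS

open MvPolynomial

/-! A right inverse of `L` is the formal adjoint of a left inverse of the adjoint `L*`, an
overdetermined operator from `m` functions `φ` to `m + 1`. In the ring of differential polynomials
in the independent coefficients, let `multIdeal` consist of the `d` such that every `d φ_a` is a
combination of total derivatives of the components of `L*φ`. Its elements are left inverses of `L*`
up to a factor; where one of them is nonzero, integration by parts and division give a local right
inverse. The bad jets are thus common zeros of the multipliers of bounded order, and their
codimension must be shown to exceed `n`.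

The ideal is nonzero (`multIdeal_ne_bot`). Otherwise, for generic coefficients, `L*φ = 0` would have
a formal solution with some `φ_a = 1`. The equations could then be solved for derivatives of the
zeroth order coefficients `Λ_a^α`, and too few quantities would generate algebraically independent
ones, since `m + 1` times the number of derivatives of order at most `s` eventually is at least `m`
times the number of order at most `r + s`.

New multipliers come from old ones (`symbMinor_mul_mem_multIdeal`). If `c f^(k+1)` is a multiplier,
multiply `L*φ` by a high power of `f`: all terms are consequences except those where all `r`
derivatives fall on `f`. What is left is the principal symbol at the covector `df`, times `f^k`. By
Cramer's rule, the maximal minors of the symbol at `df` times `f^k` times a power of `c` are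
multipliers. Let a prime minimal over the low order multipliers omit some minor at a real covector.
By `exists_symbMinor_jd_notMem` it contains an `f` with a minor at `df` outside the prime, because
`df` contains derivatives of one order more, on which the prime imposes nothing. Descending in `k`
gives a multiplier outside the prime. Hence each increase of the order raises the height, except for
primes containing all minors at real covectors (`exists_level_of_height`).

The latter have codimension at least `n + 1` by `ringKrullDim_add_le_of_hankel`: already the symbols
at the `n` basis covectors have antidiagonals of constant index sum, which is invariant under upper
total symmetry, and their vanishing minors make the quotient integral over a subalgebra with `n + 1`
generators fewer.

The good jets are the ones where some left inverse up to a factor has nonzero factor. They are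
invariant under changes of coordinates, and a partition of unity applied to `g` glues the local
right inverses. A maximal algebraic subbundle containing the good jets exists because polynomial
rings in finitely many variables are Noetherian, and its complement is only smaller. -/

/-- Polynomials in the formal partial derivatives (of all orders) of a family of functions of `n`
variables indexed by `A`. -/
abbrev JetRing (A : Type) (n : ℕ) : Type := MvPolynomial (A × Multiset (Fin n)) ℝ

/-! ### Differential polynomials -/

section JetRing

variable {A : Type} {n : ℕ}

/-- The total derivative with respect to the `i`-th variable. -/
noncomputable def jd (i : Fin n) : Derivation ℝ (JetRing A n) (JetRing A n) :=
  mkDerivation ℝ fun v => X (v.1, i ::ₘ v.2)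

@[simp] lemma jd_X (i : Fin n) (v : A × Multiset (Fin n)) :
    jd i (X v : JetRing A n) = X (v.1, i ::ₘ v.2) := mkDerivation_X _ _ _

/-- Iterated total derivatives. -/
noncomputable def jdl (w : List (Fin n)) (x : JetRing A n) : JetRing A n :=
  w.foldr (fun i y => jd i y) x

@[simp] lemma jdl_nil (x : JetRing A n) : jdl [] x = x := rfl

@[simp] lemma jdl_cons (i : Fin n) (w : List (Fin n)) (x : JetRing A n) :
    jdl (i :: w) x = jd i (jdl w x) := rfl

@[simp] lemma jdl_smul (w : List (Fin n)) (t : ℝ) (x : JetRing A n) :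
    jdl w (t • x) = t • jdl w x := by
  induction w with
  | nil => rfl
  | cons i w ih => simp [ih]

lemma jdl_sum {ι : Type*} (w : List (Fin n)) (s : Finset ι) (f : ι → JetRing A n) :
    jdl w (∑ i ∈ s, f i) = ∑ i ∈ s, jdl w (f i) := by
  induction w with
  | nil => rfl
  | cons i w ih => simp [ih]

end JetRing

/-! ### Multipliers of the universal adjoint operator -/

section Adjoint

variable {n m r : ℕ} {C : Type}

/-- The inclusion of the jets of the coefficients into the jets of coefficients and functions. -/
noncomputable def inc : JetRing C n →ₐ[ℝ] JetRing (C ⊕ Fin m) n :=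
  rename (Prod.map Sum.inl id)

@[simp] lemma inc_X (v : C × Multiset (Fin n)) :
    (inc (X v) : JetRing (C ⊕ Fin m) n) = X (Sum.inl v.1, v.2) := by
  simp [inc, rename_X, Prod.map]

@[simp] lemma jd_inc (i : Fin n) (p : JetRing C n) :
    jd i (inc p : JetRing (C ⊕ Fin m) n) = inc (jd i p) := by
  induction p using MvPolynomial.induction_on with
  | C a => simp [← algebraMap_eq]
  | add p q hp hq => simp [hp, hq]
  | mul_X p v hp => simp [Derivation.leibniz, hp]

variable (cls : Fin m → Fin (m + 1) → Tup n r → C)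

/-- The universal formal adjoint operator, applied to the universal function. -/
noncomputable def adjE (α : Fin (m + 1)) : JetRing (C ⊕ Fin m) n :=
  ∑ b : Fin m, ∑ β : Tup n r, ((-1 : ℝ) ^ (β.1 : ℕ)) •
    jdl (List.ofFn β.2) (X (Sum.inl (cls b α β), 0) * X (Sum.inr b, 0))

/-- The left module of differential consequences of the adjoint operator. -/
noncomputable def conseq : AddSubgroup (JetRing (C ⊕ Fin m) n) :=
  AddSubgroup.closure {x | ∃ (p : JetRing C n) (w : List (Fin n)) (α : Fin (m + 1)),
    x = inc p * jdl w (adjE cls α)}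

variable {cls}

lemma inc_mul_mem_conseq (p : JetRing C n) {x : JetRing (C ⊕ Fin m) n} (hx : x ∈ conseq cls) :
    inc p * x ∈ conseq cls := by
  induction hx using AddSubgroup.closure_induction with
  | mem x hx =>
    obtain ⟨q, w, α, rfl⟩ := hx
    exact AddSubgroup.subset_closure ⟨p * q, w, α, by rw [map_mul, mul_assoc]⟩
  | zero => simp [zero_mem]
  | add x y _ _ hx hy => rw [mul_add]; exact add_mem hx hy
  | neg x _ hx => rw [mul_neg]; exact neg_mem hx

lemma jd_mem_conseq (i : Fin n) {x : JetRing (C ⊕ Fin m) n} (hx : x ∈ conseq cls) :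
    jd i x ∈ conseq cls := by
  induction hx using AddSubgroup.closure_induction with
  | mem x hx =>
    obtain ⟨q, w, α, rfl⟩ := hx
    have : jd i (inc q * jdl w (adjE cls α))
        = inc q * jdl (i :: w) (adjE cls α) + inc (jd i q) * jdl w (adjE cls α) := by
      simp [Derivation.leibniz]; ring
    rw [this]
    exact add_mem (AddSubgroup.subset_closure ⟨_, _, _, rfl⟩)
      (AddSubgroup.subset_closure ⟨_, _, _, rfl⟩)
  | zero => simp [zero_mem]
  | add x y _ _ hx hy => rw [map_add]; exact add_mem hx hy
  | neg x _ hx => rw [map_neg]; exact neg_mem hx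

lemma adjE_mem_conseq (α : Fin (m + 1)) : adjE cls α ∈ conseq cls :=
  AddSubgroup.subset_closure ⟨1, [], α, by simp⟩

lemma exists_sum_of_mem_conseq {x : JetRing (C ⊕ Fin m) n} (hx : x ∈ conseq cls) :
    ∃ c : (Fin (m + 1) × List (Fin n)) →₀ JetRing C n,
      x = c.sum fun k p => inc p * jdl k.2 (adjE cls k.1) := by
  classical
  induction hx using AddSubgroup.closure_induction with
  | mem x hx =>
    obtain ⟨q, w, α, rfl⟩ := hx
    exact ⟨Finsupp.single (α, w) q, by simp⟩
  | zero => exact ⟨0, by simp⟩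
  | add x y _ _ hx hy =>
    obtain ⟨c, rfl⟩ := hx
    obtain ⟨d, rfl⟩ := hy
    exact ⟨c + d, by rw [Finsupp.sum_add_index] <;> simp [add_mul]⟩
  | neg x _ hx =>
    obtain ⟨c, rfl⟩ := hx
    exact ⟨-c, by rw [Finsupp.sum_neg_index] <;> simp [Finsupp.sum]⟩

variable (cls) in
/-- The multipliers `d` such that `d` times the identity factors through the adjoint operator. -/
noncomputable def multIdeal : Ideal (JetRing C n) where
  carrier := {d | ∀ a : Fin m, inc d * X (Sum.inr a, 0) ∈ conseq cls}
  add_mem' hx hy a := by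
    rw [map_add, add_mul]; exact add_mem (hx a) (hy a)
  zero_mem' a := by simp [zero_mem]
  smul_mem' p x hx a := by
    rw [smul_eq_mul, map_mul, mul_assoc]; exact inc_mul_mem_conseq _ (hx a)

/-- Modulo consequences, each derivative of `h` is moved onto the power of `f` by the product rule.
When it falls on the power of `c` instead, the term keeps enough factors `f` to be a consequence
itself; this uses up one factor `c` per derivative, whence the bound on `N`. -/
lemma pow_mul_jdl_sub_mem_conseq {c f : JetRing C n} {k : ℕ} {h : JetRing (C ⊕ Fin m) n}
    (hh : inc (c * f ^ (k + 1)) * h ∈ conseq cls) (w : List (Fin n)) :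
    ∀ N j : ℕ, w.length + 1 ≤ N → k + w.length ≤ j →
      inc (c ^ N * f ^ j) * jdl w h
        - inc ((-1) ^ w.length * (j.descFactorial w.length : JetRing C n)
          * (f ^ (j - w.length) * (w.map fun i => jd i f).prod * c ^ N)) * h ∈ conseq cls := by
  induction w with
  | nil => intro N j _ _; simp [mul_comm (c ^ N), zero_mem]
  | cons i w ih =>
    intro N j hN hj
    simp only [List.length_cons] at hN hj
    obtain ⟨N, rfl⟩ : ∃ N', N = N' + 1 := ⟨N - 1, by omega⟩
    obtain ⟨j, rfl⟩ : ∃ j', j = j' + 1 := ⟨j - 1, by omega⟩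
    -- With one more factor `f` than the induction hypothesis needs, the remainder in it contains `c
    -- f^(k+1) h` and is a consequence.
    have key : ∀ N' j' : ℕ, w.length + 1 ≤ N' → k + w.length + 1 ≤ j' →
        inc (c ^ N' * f ^ j') * jdl w h ∈ conseq cls := by
      intro N' j' h1 h2
      have h3 := ih N' j' h1 (by omega)
      obtain ⟨e, he⟩ : ∃ e, j' - w.length = e + (k + 1) := ⟨j' - w.length - (k + 1), by omega⟩
      obtain ⟨N'', rfl⟩ : ∃ N'', N' = N'' + 1 := ⟨N' - 1, by omega⟩
      have h4 := inc_mul_mem_conseq ((-1) ^ w.length * (j'.descFactorial w.length : JetRing C n)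
          * (f ^ e * (w.map fun i => jd i f).prod * c ^ N'')) hh
      rw [← mul_assoc, ← map_mul] at h4
      have h5 := add_mem h3 h4
      rw [he] at h5
      convert h5 using 1
      have : (-1) ^ w.length * (j'.descFactorial w.length : JetRing C n)
          * (f ^ e * (w.map fun i => jd i f).prod * c ^ N'') * (c * f ^ (k + 1))
          = (-1) ^ w.length * (j'.descFactorial w.length : JetRing C n)
          * (f ^ (e + (k + 1)) * (w.map fun i => jd i f).prod * c ^ (N'' + 1)) := by ring
      rw [this]; ring
    have h1 := jd_mem_conseq i (key (N + 1) (j + 1) (by omega) (by omega))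
    have h2 := inc_mul_mem_conseq (((N + 1 : ℕ) : JetRing C n) * jd i c)
      (key N (j + 1) (by omega) (by omega))
    have h3 := inc_mul_mem_conseq (((j + 1 : ℕ) : JetRing C n) * jd i f)
      (ih (N + 1) j (by omega) (by omega))
    have h4 := sub_mem (sub_mem h1 h2) h3
    convert h4 using 1
    simp only [List.length_cons, Nat.succ_descFactorial_succ, List.map_cons, List.prod_cons,
      jdl_cons, Nat.succ_sub_succ_eq_sub]
    simp only [Derivation.leibniz, jd_inc, map_mul, map_pow, Derivation.leibniz_pow, smul_eq_mul,
      nsmul_eq_mul, map_natCast, map_neg, map_one, Nat.add_sub_cancel, Nat.cast_mul]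
    ring

variable (cls) in
/-- The symbol matrix evaluated on a covector with entries in a commutative algebra. -/
noncomputable def symb {S : Type*} [CommRing S] (u : C → S) (η : Fin n → S)
    (b : Fin m) (α : Fin (m + 1)) : S :=
  ∑ β : Fin r → Fin n, u (cls b α ⟨Fin.last r, β⟩) * ∏ i, η (β i)

variable (cls) in
/-- The maximal minors of the symbol matrix, for a choice `e` of columns. -/
noncomputable def symbMinor {S : Type*} [CommRing S] (u : C → S) (η : Fin n → S)
    (e : Fin m → Fin (m + 1)) : S :=
  (Matrix.of fun b j => symb cls u η b (e j)).det

lemma map_symb {S S' : Type*} [CommRing S] [CommRing S'] (f : S →+* S') (u : C → S)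
    (η : Fin n → S) (b : Fin m) (α : Fin (m + 1)) :
    f (symb cls u η b α) = symb cls (f ∘ u) (f ∘ η) b α := by
  simp [symb, map_sum, map_mul, map_prod]

lemma map_symbMinor {S S' : Type*} [CommRing S] [CommRing S'] (f : S →+* S') (u : C → S)
    (η : Fin n → S) (e : Fin m → Fin (m + 1)) :
    f (symbMinor cls u η e) = symbMinor cls (f ∘ u) (f ∘ η) e := by
  simp only [symbMinor, RingHom.map_det, RingHom.mapMatrix_apply]
  congr 1
  ext b j
  simp [map_symb]

/-- The zeroth order jet coordinate of a coefficient. -/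
noncomputable def u0 (c : C) : JetRing C n := X (c, 0)

/-- Multiply the adjoint equations by `c^(r+1) f^(k+r)`. A term of order below `r` loses fewer than
`r` factors `f` and is a consequence; in the terms of order `r` the signs cancel and, up to a
factorial constant, the symbol at `df` times `c^(r+1) f^k` remains. The adjugate of the chosen
square submatrix then isolates each `φ_a`. -/
theorem symbMinor_mul_mem_multIdeal {c f : JetRing C n} {k : ℕ}
    (h : c * f ^ (k + 1) ∈ multIdeal cls) (e : Fin m → Fin (m + 1)) :
    symbMinor cls u0 (fun i => jd i f) e * c ^ (r + 1) * f ^ k ∈ multIdeal cls := by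
  have h1 : ∀ (b : Fin m) (p : JetRing C n),
      inc (c * f ^ (k + 1)) * (inc p * X (Sum.inr b, 0)) ∈ conseq cls := by
    intro b p
    rw [mul_left_comm]; exact inc_mul_mem_conseq _ (h b)
  have h2 : ∀ α : Fin (m + 1), ∑ b : Fin m,
      inc (symb cls u0 (fun i => jd i f) b α * c ^ (r + 1) * f ^ k) * X (Sum.inr b, 0)
        ∈ conseq cls := by
    intro α
    have h3 := inc_mul_mem_conseq (c ^ (r + 1) * f ^ (k + r)) (adjE_mem_conseq (cls := cls) α)
    have h4 : inc (c ^ (r + 1) * f ^ (k + r)) * adjE cls α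
        - ∑ b : Fin m, ((k + r).descFactorial r : ℝ) •
          (inc (symb cls u0 (fun i => jd i f) b α * c ^ (r + 1) * f ^ k) * X (Sum.inr b, 0))
        ∈ conseq cls := by
      rw [adjE, Finset.mul_sum, ← Finset.sum_sub_distrib]
      refine sum_mem fun b _ => ?_
      have h5 : ((k + r).descFactorial r : ℝ) •
          (inc (symb cls u0 (fun i => jd i f) b α * c ^ (r + 1) * f ^ k)
            * (X (Sum.inr b, 0) : JetRing (C ⊕ Fin m) n))
          = ∑ β : Tup n r, if β.1 = Fin.last r then ((-1 : ℝ) ^ (β.1 : ℕ)) •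
            (inc ((-1) ^ (β.1 : ℕ) * ((k + r).descFactorial β.1 : JetRing C n)
            * (f ^ (k + r - β.1) * ((List.ofFn β.2).map fun i => jd i f).prod * c ^ (r + 1)))
            * (X (Sum.inl (cls b α β), 0) * X (Sum.inr b, 0))) else 0 := by
        rw [Fintype.sum_sigma, Finset.sum_eq_single (Fin.last r)]
        · simp only [Fin.val_last, if_true, symb, Finset.sum_mul, map_sum, Finset.smul_sum]
          refine Finset.sum_congr rfl fun β _ => ?_
          have : ((List.ofFn β).map fun i => jd i f).prod = ∏ i, jd (β i) f := by
            rw [List.map_ofFn, List.prod_ofFn]; rfl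
          rw [this]
          simp only [Algebra.smul_def, map_mul, map_natCast, map_pow, map_neg, map_one,
            Nat.add_sub_cancel, u0, inc_X, ← mul_assoc, ← mul_pow]
          simp only [neg_mul, one_mul, neg_neg, one_pow, mul_neg]
          ring
        · intro j _ hj
          simp [hj]
        · simp
      rw [h5, Finset.mul_sum, ← Finset.sum_sub_distrib]
      refine sum_mem fun β _ => ?_
      have hlen : (List.ofFn β.2).length = β.1 := List.length_ofFn
      have hle : (β.1 : ℕ) ≤ r := Nat.lt_succ_iff.mp β.1.2
      have h6 := pow_mul_jdl_sub_mem_conseq (h1 b (X (cls b α β, 0))) (List.ofFn β.2) (r + 1)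
        (k + r) (by omega) (by omega)
      rw [hlen, inc_X] at h6
      have h7 : ∀ x ∈ conseq cls, ((-1 : ℝ) ^ (β.1 : ℕ)) • x ∈ conseq cls := by
        intro x hx
        rcases neg_one_pow_eq_or ℝ (β.1 : ℕ) with h | h <;> rw [h]
        · simpa using hx
        · simpa using hx
      split_ifs with hβ
      · rw [mul_smul_comm, ← smul_sub]
        exact h7 _ h6
      · rw [sub_zero, mul_smul_comm]
        refine h7 _ ?_
        have hlt : (β.1 : ℕ) < r := lt_of_le_of_ne hle fun h => hβ (Fin.ext h)
        obtain ⟨e', he'⟩ : ∃ e', k + r - β.1 = e' + (k + 1) :=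
          ⟨k + r - β.1 - (k + 1), by omega⟩
        rw [he'] at h6
        have h8 := inc_mul_mem_conseq ((-1) ^ (β.1 : ℕ) *
          ((k + r).descFactorial β.1 : JetRing C n)
            * (f ^ e' * ((List.ofFn β.2).map fun i => jd i f).prod * c ^ r))
            (h1 b (X (cls b α β, 0)))
        rw [← mul_assoc, ← map_mul, inc_X] at h8
        have h9 := add_mem h6 h8
        convert h9 using 1
        rw [sub_add, eq_comm]
        convert sub_zero _
        rw [← sub_mul, ← map_sub]
        convert zero_mul _
        convert map_zero inc
        ring
    have h5 := sub_mem h3 h4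
    rw [sub_sub_cancel, ← Finset.smul_sum] at h5
    have h6 := inc_mul_mem_conseq (cls := cls)
      (algebraMap ℝ _ ((k + r).descFactorial r : ℝ)⁻¹) h5
    have h7 : ((k + r).descFactorial r : ℝ) ≠ 0 := by
      have : (k + r).descFactorial r ≠ 0 := by
        rw [Ne, Nat.descFactorial_eq_zero_iff_lt]; omega
      exact_mod_cast this
    rw [AlgHom.commutes, ← Algebra.smul_def, smul_smul, inv_mul_cancel₀ h7, one_smul] at h6
    exact h6
  intro a
  set M : Matrix (Fin m) (Fin m) (JetRing C n) :=
    Matrix.of fun b j => symb cls u0 (fun i => jd i f) b (e j) with hM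
  have h8 : ∑ j : Fin m, inc (M.adjugate j a) * (∑ b : Fin m,
      inc (symb cls u0 (fun i => jd i f) b (e j) * c ^ (r + 1) * f ^ k) * X (Sum.inr b, 0))
      ∈ conseq cls := sum_mem fun j _ => inc_mul_mem_conseq _ (h2 _)
  have h9 : ∀ b : Fin m, ∑ j, M b j * M.adjugate j a = if b = a then M.det else 0 := by
    intro b
    rw [← Matrix.mul_apply, Matrix.mul_adjugate, Matrix.smul_apply, Matrix.one_apply]
    simp
  convert h8 using 1
  simp only [Finset.mul_sum]
  rw [Finset.sum_comm]
  have : ∀ b : Fin m, ∑ j : Fin m, inc (M.adjugate j a) *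
      (inc (symb cls u0 (fun i => jd i f) b (e j) * c ^ (r + 1) * f ^ k)
        * (X (Sum.inr b, 0) : JetRing (C ⊕ Fin m) n))
      = inc (∑ j, M b j * M.adjugate j a) * (inc (c ^ (r + 1) * f ^ k) * X (Sum.inr b, 0)) := by
    intro b
    simp only [map_sum, Finset.sum_mul]
    refine Finset.sum_congr rfl fun j _ => ?_
    simp only [map_mul, hM, Matrix.of_apply]
    ring
  rw [Finset.sum_congr rfl fun b _ => this b, Finset.sum_eq_single a]
  · rw [h9, if_pos rfl, symbMinor, ← hM]
    simp only [map_mul]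
    ring
  · intro b _ hb
    rw [h9, if_neg hb]; simp
  · simp

end Adjoint


open MvPolynomial

/-! ### Ideals closed under partial derivatives and invariance under substitutions -/

section Translation

variable {V : Type*}

lemma totalDegree_pderiv_lt {v : V} {f : MvPolynomial V ℝ} (h : pderiv v f ≠ 0) :
    (pderiv v f).totalDegree < f.totalDegree := by
  classical
  obtain ⟨s, hs, hd⟩ : ∃ s ∈ (pderiv v f).support,
      (pderiv v f).totalDegree = s.sum fun _ e => e := by
    have := Finset.exists_mem_eq_sup _ (support_nonempty.mpr h) fun s : V →₀ ℕ => s.sum fun _ e => e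
    exact this
  rw [mem_support_iff, coeff_pderiv] at hs
  have h1 : s + Finsupp.single v 1 ∈ f.support := by
    rw [mem_support_iff]
    intro h0
    simp [h0] at hs
  have h2 := le_totalDegree h1
  rw [Finsupp.sum_add_index' (by simp) (by simp), Finsupp.sum_single_index rfl] at h2
  omega

lemma pderiv_pderiv_comm (v w : V) (f : MvPolynomial V ℝ) :
    pderiv v (pderiv w f) = pderiv w (pderiv v f) := by
  classical
  have : ⁅(pderiv v : Derivation ℝ (MvPolynomial V ℝ) (MvPolynomial V ℝ)),
      (pderiv w : Derivation ℝ (MvPolynomial V ℝ) (MvPolynomial V ℝ))⁆ = 0 := by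
    refine derivation_ext fun i => ?_
    rw [Derivation.commutator_apply, pderiv_X, pderiv_X]
    by_cases h1 : i = v <;> by_cases h2 : i = w <;> simp [Pi.single_apply, h1, h2] <;>
      split_ifs <;> simp
  have h := congrArg (fun D => D f) this
  simpa [Derivation.commutator_apply, sub_eq_zero] using h

/-- The Taylor expansion in one of the variables. -/
noncomputable def taylorHom (w : V) : MvPolynomial V ℝ →ₐ[ℝ] Polynomial (MvPolynomial V ℝ) :=
  letI := Classical.decEq V
  aeval fun v => Polynomial.C (X v) + if v = w then Polynomial.X else 0

lemma taylorHom_X [DecidableEq V] (w v : V) : taylorHom w (X v)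
    = Polynomial.C (X v) + if v = w then Polynomial.X else 0 := by
  simp [taylorHom]

lemma eval_taylorHom [DecidableEq V] (w : V) (s g : MvPolynomial V ℝ) :
    (taylorHom w g).eval (s - X w) = aeval (Function.update X w s) g := by
  have : ((Polynomial.aeval (s - X w)).restrictScalars ℝ).comp (taylorHom w)
      = aeval (Function.update X w s) := by
    refine algHom_ext fun v => ?_
    rw [AlgHom.comp_apply, taylorHom_X, aeval_X]
    by_cases h : v = w
    · subst h; simp
    · simp [h]
  rw [← this]
  simp

lemma coeff_zero_taylorHom (w : V) (g : MvPolynomial V ℝ) : (taylorHom w g).coeff 0 = g := by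
  classical
  have h := eval_taylorHom w (X w) g
  rw [sub_self, ← Polynomial.coeff_zero_eq_eval_zero, Function.update_eq_self] at h
  rw [h, aeval_X_left_apply]

lemma derivative_taylorHom (w : V) (g : MvPolynomial V ℝ) :
    Polynomial.derivative (taylorHom w g) = taylorHom w (pderiv w g) := by
  classical
  induction g using MvPolynomial.induction_on with
  | C a =>
    rw [pderiv_C, map_zero, ← algebraMap_eq, AlgHom.commutes, Polynomial.algebraMap_apply,
      Polynomial.derivative_C]
  | add p q hp hq => rw [map_add, map_add, map_add, map_add, hp, hq]
  | mul_X p v hp =>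
    have h1 : Polynomial.derivative (taylorHom w (X v)) = taylorHom w (pderiv w (X v)) := by
      rw [taylorHom_X, pderiv_X, Polynomial.derivative_add, Polynomial.derivative_C, zero_add]
      by_cases h : v = w
      · rw [if_pos h, h, Pi.single_eq_same, map_one, Polynomial.derivative_X]
      · rw [if_neg h, Pi.single_eq_of_ne h, map_zero, map_zero]
    rw [map_mul, Polynomial.derivative_mul, hp, h1, pderiv_mul, map_add, map_mul, map_mul]

variable {I : Ideal (MvPolynomial V ℝ)}

lemma coeff_taylorHom_mem {w : V} (hI : ∀ f ∈ I, pderiv w f ∈ I) (k : ℕ) :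
    ∀ g ∈ I, (taylorHom w g).coeff k ∈ I := by
  induction k with
  | zero => intro g hg; rwa [coeff_zero_taylorHom]
  | succ k ih =>
    intro g hg
    have h1 := ih _ (hI g hg)
    rw [← derivative_taylorHom, Polynomial.coeff_derivative] at h1
    have h2 := I.mul_mem_left (C ((k + 1 : ℝ)⁻¹)) h1
    have h3 : (k + 1 : ℝ) ≠ 0 := by positivity
    convert h2 using 1
    have : ((k : MvPolynomial V ℝ) + 1) = C (k + 1 : ℝ) := by simp
    rw [this, mul_left_comm, ← C_mul, inv_mul_cancel₀ h3]; simp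

/-- The difference is the sum of the Taylor terms of positive order, whose coefficients are, up to
factorials, iterated derivatives of `pderiv w g`, hence in the ideal. Membership of `g` itself is
not needed. -/
lemma aeval_update_sub_mem [DecidableEq V] {w : V} (hI : ∀ f ∈ I, pderiv w f ∈ I)
    {g : MvPolynomial V ℝ} (hg : pderiv w g ∈ I) (s : MvPolynomial V ℝ) :
    aeval (Function.update X w s) g - g ∈ I := by
  rw [← eval_taylorHom, Polynomial.eval_eq_sum_range, Finset.sum_range_succ']
  rw [pow_zero, mul_one, coeff_zero_taylorHom, add_sub_cancel_right]
  refine sum_mem fun k _ => I.mul_mem_right _ ?_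
  have h1 := coeff_taylorHom_mem hI k _ hg
  rw [← derivative_taylorHom, Polynomial.coeff_derivative] at h1
  have h2 := I.mul_mem_left (C ((k + 1 : ℝ)⁻¹)) h1
  have h3 : (k + 1 : ℝ) ≠ 0 := by positivity
  convert h2 using 1
  have : ((k : MvPolynomial V ℝ) + 1) = C (k + 1 : ℝ) := by simp
  rw [this, mul_left_comm, ← C_mul, inv_mul_cancel₀ h3]; simp

lemma aeval_finset_sub_mem [DecidableEq V] (F : Finset V)
    (hI : ∀ w ∈ F, ∀ f ∈ I, pderiv w f ∈ I) (s : V → MvPolynomial V ℝ)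
    (hs : ∀ w ∈ F, ∀ v ∈ F, v ≠ w → aeval (Function.update X w (s w)) (s v) = s v)
    {g : MvPolynomial V ℝ} (hg : ∀ w ∈ F, pderiv w g ∈ I) :
    aeval (fun v => if v ∈ F then s v else X v) g - g ∈ I := by
  induction F using Finset.induction_on with
  | empty => simp
  | insert w F hw ih =>
    have ih := ih (fun w hw => hI w (Finset.mem_insert_of_mem hw))
      (fun w hw v hv => hs w (Finset.mem_insert_of_mem hw) v (Finset.mem_insert_of_mem hv))
      (fun w hw => hg w (Finset.mem_insert_of_mem hw))
    have hIw := hI w (Finset.mem_insert_self _ _)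
    have h1 := aeval_update_sub_mem hIw (hg w (Finset.mem_insert_self _ _)) (s w)
    have h2 := aeval_update_sub_mem hIw (hIw _ ih) (s w)
    have h3 := add_mem (add_mem h2 ih) h1
    convert h3 using 1
    have h4 : (aeval (fun v => if v ∈ insert w F then s v else X v) :
        MvPolynomial V ℝ →ₐ[ℝ] MvPolynomial V ℝ)
        = (aeval (Function.update X w (s w))).comp (aeval fun v => if v ∈ F then s v else X v) := by
      refine algHom_ext fun v => ?_
      rw [AlgHom.comp_apply, aeval_X, aeval_X]
      by_cases hvF : v ∈ F
      · have hvw : v ≠ w := fun h => hw (h ▸ hvF)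
        rw [if_pos (Finset.mem_insert_of_mem hvF), if_pos hvF,
          hs w (Finset.mem_insert_self _ _) v (Finset.mem_insert_of_mem hvF) hvw]
      · rw [if_neg hvF, aeval_X]
        by_cases hvw : v = w
        · subst hvw; simp
        · rw [if_neg (by simp [hvw, hvF]), Function.update_of_ne hvw]
    rw [h4, AlgHom.comp_apply, map_sub]
    ring

/-- An ideal closed under the partial derivatives in the variables in `W` is invariant under
suitable substitutions for these variables. -/
lemma aeval_set_sub_mem (W : Set V) [DecidablePred (· ∈ W)]
    (hI : ∀ w ∈ W, ∀ f ∈ I, pderiv w f ∈ I) (s : V → MvPolynomial V ℝ)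
    (hs : (∃ c : V → ℝ, ∀ v, s v = C (c v)) ∨ ∃ c : V → ℝ, ∀ v, s v = X v + C (c v))
    {g : MvPolynomial V ℝ} (hg : ∀ w ∈ W, pderiv w g ∈ I) :
    aeval (fun v => if v ∈ W then s v else X v) g - g ∈ I := by
  classical
  have h1 := aeval_finset_sub_mem (g.vars.filter (· ∈ W))
    (fun w hw => hI w (Finset.mem_filter.mp hw).2) s (fun w _ v _ hvw => by
      rcases hs with ⟨c, hc⟩ | ⟨c, hc⟩
      · rw [hc v, ← algebraMap_eq, AlgHom.commutes]
      · rw [hc v, map_add, aeval_X, Function.update_of_ne hvw, ← algebraMap_eq, AlgHom.commutes])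
    (fun w hw => hg w (Finset.mem_filter.mp hw).2)
  convert h1 using 2
  refine hom_congr_vars (f₁ := (aeval (fun v => if v ∈ W then s v else X v) :
      MvPolynomial V ℝ →ₐ[ℝ] MvPolynomial V ℝ).toRingHom)
    (f₂ := (aeval (fun v => if v ∈ g.vars.filter (· ∈ W) then s v else X v) :
      MvPolynomial V ℝ →ₐ[ℝ] MvPolynomial V ℝ).toRingHom) ?_ ?_ rfl
  · ext x
    simp
  · intro v hv _
    simp only [AlgHom.toRingHom_eq_coe, RingHom.coe_coe, aeval_X, Finset.mem_filter, hv, true_and]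

lemma aeval_set_mem (W : Set V) [DecidablePred (· ∈ W)]
    (hI : ∀ w ∈ W, ∀ f ∈ I, pderiv w f ∈ I) (s : V → MvPolynomial V ℝ)
    (hs : (∃ c : V → ℝ, ∀ v, s v = C (c v)) ∨ ∃ c : V → ℝ, ∀ v, s v = X v + C (c v))
    {g : MvPolynomial V ℝ} (hg : g ∈ I) :
    aeval (fun v => if v ∈ W then s v else X v) g ∈ I := by
  have := add_mem (aeval_set_sub_mem W hI s hs fun w hw => hI w hw g hg) hg
  rwa [sub_add_cancel] at this

/-- If the ideal were closed under all partial derivatives, substituting a point `a` would keep an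
element `f` in the ideal. The constant `f(a)` would then belong to it, so `f` would vanish
everywhere. -/
lemma exists_pderiv_notMem (hI : I.IsPrime) (h0 : I ≠ ⊥) :
    ∃ f ∈ I, ∃ v, pderiv v f ∉ I := by
  classical
  by_contra! hcon
  refine h0 (eq_bot_iff.mpr fun f hf => ?_)
  rw [Ideal.mem_bot]
  refine MvPolynomial.funext fun a => ?_
  by_contra hne
  have h1 := aeval_set_mem Set.univ (fun w _ f hf => hcon f hf w) (fun v => C (a v))
    (Or.inl ⟨a, fun _ => rfl⟩) hf
  have h2 : aeval (fun v => if v ∈ Set.univ then C (a v) else X v) f = C (eval a f) := by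
    simp only [Set.mem_univ, if_true]
    have : (aeval (fun v => (C (a v) : MvPolynomial V ℝ)) : MvPolynomial V ℝ →ₐ[ℝ] _)
        = (Algebra.ofId ℝ _).comp (aeval a) := by
      refine algHom_ext fun v => ?_
      simp [Algebra.ofId_apply, algebraMap_eq]
    rw [this, AlgHom.comp_apply, Algebra.ofId_apply, algebraMap_eq]
    simp
  rw [h2] at h1
  rw [map_zero] at hne
  have h3 := I.mul_mem_left (C (eval a f)⁻¹) h1
  rw [← C_mul, inv_mul_cancel₀ hne, C_1] at h3
  exact hI.ne_top ((Ideal.eq_top_iff_one _).mpr h3)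

/-- Let `T` be a grading of the variables, bounded on the variables that matter for the ideal `I`.
There is an element of `I` without variables above a certain degree, having a
partial derivative not in `I` with respect to a variable of this degree. -/
lemma exists_top_pderiv_notMem (hI : I.IsPrime) (h0 : I ≠ ⊥) (deg : V → ℕ) (t : ℕ)
    (ht : ∀ w, t < deg w → ∀ f ∈ I, pderiv w f ∈ I) :
    ∃ f ∈ I, ∃ v, pderiv v f ∉ I ∧ (∀ w ∈ f.vars, deg w ≤ deg v) ∧
      ∀ w, deg v < deg w → ∀ g ∈ I, pderiv w g ∈ I := by
  classical
  let p : ℕ → Prop := fun T => ∃ f ∈ I, ∃ v, deg v = T ∧ pderiv v f ∉ I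
  obtain ⟨f₀, hf₀, v₀, hv₀⟩ := exists_pderiv_notMem hI h0
  have hv₀t : deg v₀ ≤ t := not_lt.mp fun h => hv₀ (ht _ h _ hf₀)
  have hp : p (Nat.findGreatest p t) := Nat.findGreatest_spec hv₀t ⟨f₀, hf₀, v₀, rfl, hv₀⟩
  obtain ⟨f₁, hf₁, v, hvT, hv⟩ := hp
  have hhigh : ∀ w, deg v < deg w → ∀ g ∈ I, pderiv w g ∈ I := by
    intro w hw g hg
    by_contra hcon
    have hwt : deg w ≤ t := not_lt.mp fun h => hcon (ht _ h _ hg)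
    have := Nat.le_findGreatest (P := p) hwt ⟨g, hg, w, rfl, hcon⟩
    omega
  -- Minimal total degree ensures that derivatives of `pderiv v f` in higher variables lie in `I`:
  -- otherwise such a derivative of `f` would be a smaller candidate.
  obtain ⟨f, ⟨hf, hfv⟩, hmin⟩ := exists_minimalFor_of_wellFoundedLT
    (fun f : MvPolynomial V ℝ => f ∈ I ∧ pderiv v f ∉ I) (fun f => f.totalDegree)
    ⟨f₁, hf₁, hv⟩
  have hcomm : ∀ w, deg v < deg w → pderiv w (pderiv v f) ∈ I := by
    intro w hw
    by_cases hz : pderiv w f = 0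
    · rw [pderiv_pderiv_comm, hz, map_zero]; exact I.zero_mem
    · by_contra hcon
      rw [pderiv_pderiv_comm] at hcon
      have h1 := hmin ⟨hhigh w hw f hf, hcon⟩ (totalDegree_pderiv_lt hz).le
      exact absurd (totalDegree_pderiv_lt hz) (not_lt.mpr h1)
  let W : Set V := {w | deg v < deg w}
  -- Setting the higher variables to zero changes neither membership of `f` in `I` nor
  -- non-membership of `pderiv v f`, with which it commutes.
  let κ : MvPolynomial V ℝ →ₐ[ℝ] MvPolynomial V ℝ :=
    aeval fun w => if w ∈ W then C 0 else X w
  have hκ : ∀ g, pderiv v (κ g) = κ (pderiv v g) := by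
    intro g
    induction g using MvPolynomial.induction_on with
    | C a => rw [← algebraMap_eq, AlgHom.commutes]; simp
    | add p q hp hq => simp [hp, hq]
    | mul_X p w hp =>
      rw [map_mul, pderiv_mul, pderiv_mul, map_add, map_mul, map_mul, hp]
      congr 2
      simp only [κ, aeval_X]
      split_ifs with h
      · have : w ≠ v := by rintro rfl; exact lt_irrefl (deg w) h
        simp [pderiv_X_of_ne this]
      · by_cases hwv : w = v
        · subst hwv; simp
        · simp [pderiv_X_of_ne hwv]
  refine ⟨κ f, aeval_set_mem W hhigh (fun _ => C 0) (Or.inl ⟨0, fun _ => rfl⟩) hf, v, ?_, ?_, hhigh⟩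
  · intro hcon
    rw [hκ] at hcon
    have h1 := aeval_set_sub_mem W hhigh (fun _ => C 0) (Or.inl ⟨0, fun _ => rfl⟩) hcomm
    have h2 := sub_mem hcon h1
    rw [sub_sub_cancel] at h2
    exact hfv h2
  · have hsup : ∀ g, κ g ∈ supported ℝ Wᶜ := by
      intro g
      induction g using MvPolynomial.induction_on with
      | C a => rw [← algebraMap_eq, AlgHom.commutes]; exact Subalgebra.algebraMap_mem _ _
      | add p q hp hq => rw [map_add]; exact add_mem hp hq
      | mul_X p w hp =>
        rw [map_mul]
        refine mul_mem hp ?_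
        simp only [κ, aeval_X]
        split_ifs with h
        · rw [C_0]; exact zero_mem _
        · exact X_mem_supported.mpr h
    intro w hw
    have := mem_supported.mp (hsup f) hw
    exact not_lt.mp this

lemma mkDerivation_eq_sum (a : V → MvPolynomial V ℝ) (f : MvPolynomial V ℝ) :
    mkDerivation ℝ a f = ∑ w ∈ f.vars, a w * pderiv w f := by
  classical
  have h1 : ∀ g, (∑ w ∈ f.vars, a w • (pderiv w : Derivation ℝ (MvPolynomial V ℝ) _)) g
      = ∑ w ∈ f.vars, a w * pderiv w g := by
    intro g
    rw [← Derivation.coeFnAddMonoidHom_apply, map_sum, Finset.sum_apply]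
    rfl
  rw [← h1]
  refine derivation_eq_of_forall_mem_vars fun v hv => ?_
  rw [h1, mkDerivation_X, Finset.sum_eq_single v]
  · simp
  · intro w _ hwv; rw [pderiv_X_of_ne hwv.symm, mul_zero]
  · exact fun h => absurd hv h

end Translation

/-! ### The symbol at the differential of an element of a prime ideal -/

section Symbol

variable {n m r : ℕ} {C : Type} {cls : Fin m → Fin (m + 1) → Tup n r → C}

lemma symbMinor_mul {S : Type*} [CommRing S] (u : C → S) (η : Fin n → S)
    (e : Fin m → Fin (m + 1)) (z : S) :
    symbMinor cls u (fun i => z * η i) e = (z ^ r) ^ m * symbMinor cls u η e := by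
  have : (Matrix.of fun b j => symb cls u (fun i => z * η i) b (e j))
      = (z ^ r) • Matrix.of fun b j => symb cls u η b (e j) := by
    ext b j
    simp only [Matrix.of_apply, Matrix.smul_apply, smul_eq_mul, symb, Finset.prod_mul_distrib,
      Finset.mul_sum, Finset.prod_const, Finset.card_univ, Fintype.card_fin]
    exact Finset.sum_congr rfl fun β _ => by ring
  rw [symbMinor, this, Matrix.det_smul, Fintype.card_fin, symbMinor]

/-- By homogeneity, a minor vanishing on the affine line `y + z ξ` also vanishes at `w y + ξ` for
all real `w ≠ 0`. As a polynomial in `w` it has infinitely many roots, so it vanishes at `w = 0`. -/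
lemma symbMinor_eq_zero_of_line {S : Type*} [CommRing S] [IsDomain S] [Algebra ℝ S] {u : C → S}
    {y ξ : Fin n → S} {e : Fin m → Fin (m + 1)}
    (h : ∀ z : ℝ, symbMinor cls u (fun i => y i + algebraMap ℝ S z * ξ i) e = 0) :
    symbMinor cls u ξ e = 0 := by
  set p : Polynomial S := symbMinor cls (fun c => Polynomial.C (u c))
    (fun i => Polynomial.X * Polynomial.C (y i) + Polynomial.C (ξ i)) e with hp
  have heval : ∀ w : S, p.eval w = symbMinor cls u (fun i => w * y i + ξ i) e := by
    intro w
    rw [← Polynomial.coe_evalRingHom, hp, map_symbMinor]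
    congr 1
    · funext c; simp
    · funext i
      simp only [Function.comp_apply, Polynomial.coe_evalRingHom]
      rw [Polynomial.eval_add, Polynomial.eval_mul, Polynomial.eval_X, Polynomial.eval_C,
        Polynomial.eval_C]
  have hroot : ∀ z : ℝ, z ≠ 0 → p.IsRoot (algebraMap ℝ S z) := by
    intro z hz
    have h1 : (fun i => algebraMap ℝ S z * y i + ξ i)
        = fun i => algebraMap ℝ S z * (y i + algebraMap ℝ S z⁻¹ * ξ i) := by
      funext i
      rw [mul_add, ← mul_assoc, ← map_mul, mul_inv_cancel₀ hz, map_one, one_mul]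
    rw [Polynomial.IsRoot.def, heval, h1, symbMinor_mul, h, mul_zero]
  have hp0 : p = 0 := by
    refine Polynomial.eq_zero_of_infinite_isRoot p ?_
    refine Set.Infinite.mono (s := algebraMap ℝ S '' {0}ᶜ) ?_ ?_
    · rintro _ ⟨z, hz, rfl⟩
      exact hroot z hz
    · exact Set.Infinite.image (FaithfulSMul.algebraMap_injective ℝ S).injOn
        (Set.finite_singleton _).infinite_compl
  have h2 := heval 0
  rw [hp0] at h2
  simpa using h2.symm

lemma symbMinor_eq_zero_of_mul {S : Type*} [CommRing S] [IsDomain S] [Algebra ℝ S] {u : C → S}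
    {e : Fin m → Fin (m + 1)} {F : MvPolynomial (Fin n) S} (hF : F ≠ 0)
    (h : ∀ y : Fin n → ℝ, eval (fun i => algebraMap ℝ S (y i)) F
      * symbMinor cls u (fun i => algebraMap ℝ S (y i)) e = 0) (x : Fin n → ℝ) :
    symbMinor cls u (fun i => algebraMap ℝ S (x i)) e = 0 := by
  have hM : ∀ y : Fin n → ℝ, eval (fun i => algebraMap ℝ S (y i))
      (symbMinor cls (fun c => MvPolynomial.C (u c)) X e)
      = symbMinor cls u (fun i => algebraMap ℝ S (y i)) e := by
    intro y
    rw [map_symbMinor]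
    congr 1
    · funext c; simp
    · funext i; simp
  have hzero : F * symbMinor cls (fun c => MvPolynomial.C (u c)) X e = 0 := by
    refine funext_set (fun _ => Set.range (algebraMap ℝ S))
      (fun _ => Set.infinite_range_of_injective (FaithfulSMul.algebraMap_injective ℝ S)) ?_
    intro a ha
    choose y hy using fun i => ha i (Set.mem_univ i)
    obtain rfl : (fun i => algebraMap ℝ S (y i)) = a := funext hy
    rw [map_mul, hM, h, map_zero]
  rw [← hM, (mul_eq_zero.mp hzero).resolve_left hF, map_zero]

/-- Take `f` in `I` of highest order `T` on which `I` depends effectively. Each `jd i f` is affine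
in the variables of order `T + 1`, and `I` is invariant under translations of these. Translating the
derivatives of `c₀` of order `T + 1` by the monomials in a real vector `y` moves `df` along the
direction `y`, with speed `δ y f`. If the minor at `df` were in `I`, it would vanish modulo `I` on
that whole line, hence in the direction of the line, and finally at every real covector, since `δ y
f` is a nonzero polynomial in `y` modulo `I`. -/
theorem exists_symbMinor_jd_notMem {I : Ideal (JetRing C n)} (hI : I.IsPrime) (h0 : I ≠ ⊥) (t : ℕ)
    (ht : ∀ w : C × Multiset (Fin n), t < Multiset.card w.2 → ∀ f ∈ I, pderiv w f ∈ I)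
    {e : Fin m → Fin (m + 1)} {x : Fin n → ℝ}
    (hx : symbMinor cls u0 (fun i => MvPolynomial.C (x i)) e ∉ I) :
    ∃ f ∈ I, symbMinor cls u0 (fun i => jd i f) e ∉ I := by
  classical
  obtain ⟨f, hf, ⟨c₀, γ₀⟩, hv, hfv, hhigh⟩ :=
    exists_top_pderiv_notMem hI h0 (fun w : C × Multiset (Fin n) => Multiset.card w.2) t ht
  refine ⟨f, hf, fun hcon => hx ?_⟩
  simp only at hfv hhigh
  set T := Multiset.card γ₀ with hT
  let π : JetRing C n →ₐ[ℝ] (JetRing C n ⧸ I) := Ideal.Quotient.mkₐ ℝ I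
  have hπ : ∀ g, π g = 0 ↔ g ∈ I := fun g => Ideal.Quotient.eq_zero_iff_mem
  let mon : (Fin n → ℝ) → Multiset (Fin n) → ℝ := fun y γ => (γ.map y).prod
  -- The principal part of order `T` of `f` with respect to `c₀`, evaluated at the covector `y`.
  let δ : (Fin n → ℝ) → Derivation ℝ (JetRing C n) (JetRing C n) := fun y =>
    mkDerivation ℝ fun w => if w.1 = c₀ ∧ Multiset.card w.2 = T then
      MvPolynomial.C (mon y w.2) else 0
  have hline : ∀ y : Fin n → ℝ, ∀ z : ℝ, symbMinor cls (fun c => π (u0 c))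
      (fun i => π (jd i f) + algebraMap ℝ _ z * (π (δ y f) * algebraMap ℝ _ (y i))) e = 0 := by
    intro y z
    let W : Set (C × Multiset (Fin n)) := {w | w.1 = c₀ ∧ Multiset.card w.2 = T + 1}
    let s : C × Multiset (Fin n) → JetRing C n := fun w => X w + MvPolynomial.C (z * mon y w.2)
    let τ : JetRing C n →ₐ[ℝ] JetRing C n := aeval fun w => if w ∈ W then s w else X w
    have hW : ∀ w ∈ W, ∀ g ∈ I, pderiv w g ∈ I := fun w hw => hhigh w (by rw [hw.2]; omega)
    have hτ : ∀ g ∈ I, τ g ∈ I := fun g hg =>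
      aeval_set_mem W hW s (Or.inr ⟨_, fun _ => rfl⟩) hg
    have hτX : ∀ w, τ (X w) = if w ∈ W then s w else X w := fun w => aeval_X _ _
    have hfmem : f ∈ supported ℝ {w : C × Multiset (Fin n) | Multiset.card w.2 ≤ T} :=
      mem_supported.mpr hfv
    have hmain : τ f = f ∧ ∀ i, τ (jd i f)
        = jd i f + MvPolynomial.C z * (δ y f * MvPolynomial.C (y i)) := by
      clear hcon hfv hv hf
      induction hfmem using Algebra.adjoin_induction with
      | mem g hg =>
        obtain ⟨w, hw, rfl⟩ := hg
        have hw' : Multiset.card w.2 ≤ T := hw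
        constructor
        · rw [hτX, if_neg]
          rintro ⟨_, h⟩; omega
        · intro i
          rw [jd_X, hτX]
          simp only [δ, mkDerivation_X]
          by_cases h : w.1 = c₀ ∧ Multiset.card w.2 = T
          · rw [if_pos ⟨h.1, by simp [h.2]⟩, if_pos h]
            simp only [s, mon, Multiset.map_cons, Multiset.prod_cons, C_mul]
            ring
          · rw [if_neg fun h' => h ⟨h'.1, by simpa using h'.2⟩, if_neg h]
            simp
      | algebraMap a =>
        refine ⟨AlgHom.commutes _ _, fun i => ?_⟩
        simp
      | add p q _ _ hp hq =>
        refine ⟨by rw [map_add, hp.1, hq.1], fun i => ?_⟩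
        rw [map_add, map_add, hp.2, hq.2, map_add]; ring
      | mul p q _ _ hp hq =>
        refine ⟨by rw [map_mul, hp.1, hq.1], fun i => ?_⟩
        simp only [Derivation.leibniz, smul_eq_mul, map_add, map_mul, hp.1, hq.1, hp.2, hq.2]
        ring
    have h1 := hτ _ hcon
    have h2 : τ (symbMinor cls u0 (fun i => jd i f) e)
        = symbMinor cls (τ ∘ u0) (τ ∘ fun i => jd i f) e :=
      map_symbMinor τ.toRingHom _ _ _
    rw [h2] at h1
    have h3 : π (symbMinor cls (τ ∘ u0) (τ ∘ fun i => jd i f) e)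
        = symbMinor cls (π ∘ τ ∘ u0) (π ∘ τ ∘ fun i => jd i f) e :=
      map_symbMinor (Ideal.Quotient.mk I) _ _ _
    rw [(hπ _).mpr h1] at h3
    rw [h3]
    congr 1
    · funext c
      simp only [Function.comp_apply, u0, hτX]
      rw [if_neg]
      rintro ⟨_, h⟩
      simp at h
    · funext i
      simp only [Function.comp_apply, hmain.2 i, map_add, map_mul]
      simp only [← algebraMap_eq, AlgHom.commutes]
  have hprod : ∀ y : Fin n → ℝ, π (δ y f)
      * symbMinor cls (fun c => π (u0 c)) (fun i => algebraMap ℝ _ (y i)) e = 0 := by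
    intro y
    have h1 := symbMinor_eq_zero_of_line (hline y)
    rw [symbMinor_mul] at h1
    rcases mul_eq_zero.mp h1 with h | h
    · rw [eq_zero_of_pow_eq_zero (eq_zero_of_pow_eq_zero h), zero_mul]
    · rw [h, mul_zero]
  let A := JetRing C n ⧸ I
  -- The same principal part as a polynomial in the covector; it is nonzero because its coefficient
  -- at `γ₀` is the class of `pderiv (c₀, γ₀) f`.
  let Fp : MvPolynomial (Fin n) A := ∑ w ∈ f.vars.filter fun w => w.1 = c₀ ∧ Multiset.card w.2 = T,
    monomial (Multiset.toFinsupp w.2) (π (pderiv w f))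
  have hFp : ∀ y : Fin n → ℝ, eval (fun i => algebraMap ℝ A (y i)) Fp = π (δ y f) := by
    intro y
    have h1 : δ y f = ∑ w ∈ f.vars, (if w.1 = c₀ ∧ Multiset.card w.2 = T then
        MvPolynomial.C (mon y w.2) else 0) * pderiv w f := mkDerivation_eq_sum _ f
    rw [h1, map_sum, map_sum, Finset.sum_filter]
    refine Finset.sum_congr rfl fun w _ => ?_
    split_ifs with h
    · rw [eval_monomial, map_mul, mul_comm, ← algebraMap_eq, AlgHom.commutes]
      congr 1
      simp only [mon]
      rw [Finset.prod_multiset_map_count, map_prod]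
      simp only [Finsupp.prod, Multiset.toFinsupp_support, Multiset.toFinsupp_apply, map_pow]
      rfl
    · simp
  have hFp0 : Fp ≠ 0 := by
    intro h
    have h1 : coeff (Multiset.toFinsupp γ₀) Fp = π (pderiv (c₀, γ₀) f) := by
      rw [coeff_sum]
      rw [Finset.sum_eq_single (c₀, γ₀)]
      · simp
      · rintro ⟨c, γ⟩ hw hne
        rw [coeff_monomial, if_neg]
        intro hγ
        have := Multiset.toFinsupp.injective hγ
        simp only [Finset.mem_filter] at hw
        exact hne (Prod.ext hw.2.1 this)
      · intro hw
        have : (c₀, γ₀) ∉ f.vars := fun h => hw (Finset.mem_filter.mpr ⟨h, rfl, rfl⟩)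
        rw [pderiv_eq_zero_of_notMem_vars this]; simp
    rw [h, coeff_zero] at h1
    exact hv ((hπ _).mp h1.symm)
  rw [← hπ]
  have h1 : symbMinor cls (fun c => π (u0 c)) (fun i => algebraMap ℝ A (x i)) e = 0 :=
    symbMinor_eq_zero_of_mul hFp0 (fun y => by rw [hFp]; exact hprod y) x
  rw [← h1]
  have h2 : π (symbMinor cls u0 (fun i => MvPolynomial.C (x i)) e)
      = symbMinor cls (π ∘ u0) (π ∘ fun i => MvPolynomial.C (x i)) e :=
      map_symbMinor (Ideal.Quotient.mk I) _ _ _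
  rw [h2]
  congr 1

end Symbol


open MvPolynomial

/-! ### Extension of ideals to more variables -/

section Rename

variable {σ τ : Type} {f : σ → τ}

/-- The target is a polynomial ring over `MvPolynomial σ ℝ` in the variables outside the range, and
the quotient by the extended ideal is a polynomial ring over a domain. -/
lemma isPrime_map_rename (hf : Function.Injective f) {p : Ideal (MvPolynomial σ ℝ)}
    (hp : p.IsPrime) : (p.map (rename f : MvPolynomial σ ℝ →ₐ[ℝ] MvPolynomial τ ℝ)).IsPrime := by
  classical
  let e : (↥(Set.range f)ᶜ) ⊕ σ ≃ τ :=
    (Equiv.sumComm _ _).trans (((Equiv.ofInjective f hf).sumCongr (Equiv.refl _)).trans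
      (Equiv.Set.sumCompl (Set.range f)))
  have he : ∀ a : σ, e (Sum.inr a) = f a := fun a => by simp [e]
  let E : MvPolynomial (↥(Set.range f)ᶜ) (MvPolynomial σ ℝ) ≃ₐ[ℝ] MvPolynomial τ ℝ :=
    (sumAlgEquiv ℝ _ _).symm.trans (renameEquiv ℝ e)
  have h1 : (p.map (C : MvPolynomial σ ℝ →+*
      MvPolynomial (↥(Set.range f)ᶜ) (MvPolynomial σ ℝ))).IsPrime := by
    rw [← Ideal.Quotient.isDomain_iff_prime]
    have : IsDomain (MvPolynomial σ ℝ ⧸ p) := (Ideal.Quotient.isDomain_iff_prime p).mpr hp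
    exact (quotientEquivQuotientMvPolynomial (σ := ↥(Set.range f)ᶜ) p).symm.toMulEquiv.isDomain _
  have h2 := Ideal.map_isPrime_of_equiv E (I := p.map (C : MvPolynomial σ ℝ →+*
      MvPolynomial (↥(Set.range f)ᶜ) (MvPolynomial σ ℝ)))
  convert h2 using 1
  have h3 : (rename f : MvPolynomial σ ℝ →ₐ[ℝ] MvPolynomial τ ℝ).toRingHom
      = (E : MvPolynomial (↥(Set.range f)ᶜ) (MvPolynomial σ ℝ) →+* MvPolynomial τ ℝ).comp C := by
    refine ringHom_ext (fun x => ?_) fun a => ?_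
    · have : (C (C x) : MvPolynomial (↥(Set.range f)ᶜ) (MvPolynomial σ ℝ))
          = algebraMap ℝ _ x := rfl
      change rename f (MvPolynomial.C x) = E (MvPolynomial.C (MvPolynomial.C x))
      rw [rename_C, this]
      exact (E.commutes x).symm
    · simp [E, he]
  have h4 := Ideal.map_map (I := p) (C : MvPolynomial σ ℝ →+*
      MvPolynomial (↥(Set.range f)ᶜ) (MvPolynomial σ ℝ))
      (E : MvPolynomial (↥(Set.range f)ᶜ) (MvPolynomial σ ℝ) →+* MvPolynomial τ ℝ)
  rw [← h3] at h4
  exact h4.symm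

lemma rename_mem_map_rename (hf : Function.Injective f) {p : Ideal (MvPolynomial σ ℝ)}
    {g : MvPolynomial σ ℝ} :
    rename f g ∈ p.map (rename f : MvPolynomial σ ℝ →ₐ[ℝ] MvPolynomial τ ℝ) ↔ g ∈ p := by
  refine ⟨fun h => ?_, Ideal.mem_map_of_mem _⟩
  have h1 := Ideal.mem_map_of_mem (killCompl hf) h
  rw [killCompl_rename_app, Ideal.map_mapₐ, killCompl_comp_rename] at h1
  simpa using h1

lemma exists_rename_eq_of_mem_supported {g : MvPolynomial τ ℝ}
    (hg : g ∈ supported ℝ (Set.range f)) : ∃ g' : MvPolynomial σ ℝ, rename f g' = g := by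
  rw [supported_eq_range_rename] at hg
  obtain ⟨g'', hg''⟩ := hg
  have h3 : ∀ v : Set.range f, ∃ w, f w = v := fun v => v.2
  choose l' hl' using h3
  refine ⟨rename l' g'', ?_⟩
  rw [rename_rename, show f ∘ l' = Subtype.val from funext hl']
  exact hg''

lemma pderiv_mem_map_rename {p : Ideal (MvPolynomial σ ℝ)} {w : τ} (hw : w ∉ Set.range f)
    {g : MvPolynomial τ ℝ}
    (hg : g ∈ p.map (rename f : MvPolynomial σ ℝ →ₐ[ℝ] MvPolynomial τ ℝ)) :
    pderiv w g ∈ p.map (rename f : MvPolynomial σ ℝ →ₐ[ℝ] MvPolynomial τ ℝ) := by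
  classical
  refine Submodule.span_induction ?_ ?_ ?_ ?_ hg
  · rintro _ ⟨a, _, rfl⟩
    rw [pderiv_eq_zero_of_notMem_vars]
    · exact zero_mem _
    · intro h
      have := vars_rename f a h
      simp only [Finset.mem_image] at this
      obtain ⟨b, _, rfl⟩ := this
      exact hw ⟨b, rfl⟩
  · simp
  · intro x y _ _ hx hy
    rw [map_add]; exact add_mem hx hy
  · intro a x hx hx'
    rw [smul_eq_mul, pderiv_mul]
    exact add_mem (Ideal.mul_mem_left _ _ hx) (Ideal.mul_mem_left _ _ hx')

end Rename

/-- In the localization at a minimal prime `q`, the radical of the extension of `I` is the extension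
of `q`; the factor `c` clears the denominators. -/
lemma exists_mul_pow_mem_of_mem_minimalPrimes {R : Type*} [CommRing R] {I q : Ideal R}
    (hq : q ∈ I.minimalPrimes) {f : R} (hf : f ∈ q) : ∃ c ∉ q, ∃ k : ℕ, c * f ^ k ∈ I := by
  have : q.IsPrime := hq.1.1
  have h1 := IsLocalization.AtPrime.radical_map_of_mem_minimalPrimes
    (Localization.AtPrime q) q I hq
  have h2 : algebraMap R (Localization.AtPrime q) f
      ∈ (I.map (algebraMap R (Localization.AtPrime q))).radical := by
    rw [h1]; exact Ideal.mem_map_of_mem _ hf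
  obtain ⟨k, hk⟩ := h2
  rw [← map_pow, IsLocalization.algebraMap_mem_map_algebraMap_iff q.primeCompl] at hk
  obtain ⟨c, hc, h3⟩ := hk
  exact ⟨c, hc, k, h3⟩

/-! ### Growth of the height with the order -/

section Height

variable {n m r : ℕ} {C : Type} {cls : Fin m → Fin (m + 1) → Tup n r → C}

/-- Descent on the exponent of `f`: each application of `symbMinor_mul_mem_multIdeal` removes one
factor `f`, while the cofactor stays outside the prime. -/
lemma exists_mem_multIdeal_notMem {q : Ideal (JetRing C n)} (hq : q.IsPrime)
    {f : JetRing C n} {e : Fin m → Fin (m + 1)}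
    (he : symbMinor cls u0 (fun i => jd i f) e ∉ q) :
    ∀ {k : ℕ} {c : JetRing C n}, c ∉ q → c * f ^ k ∈ multIdeal cls → ∃ g ∈ multIdeal cls, g ∉ q
  | 0, c, hc, h => ⟨c, by simpa using h, hc⟩
  | k + 1, c, hc, h => by
    refine exists_mem_multIdeal_notMem hq he (k := k) (c := _) ?_
      (symbMinor_mul_mem_multIdeal h e)
    intro hcon
    rcases hq.mem_or_mem hcon with h | h
    · exact he h
    · exact hc (hq.mem_of_pow_mem _ h)

/-- The jet variables of order at most `t`. -/
def lowVars (C : Type) (n t : ℕ) : Set (C × Multiset (Fin n)) := {v | Multiset.card v.2 ≤ t}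

lemma lowVars_mono {t t' : ℕ} (h : t ≤ t') : lowVars C n t ⊆ lowVars C n t' :=
  fun _ hv => le_trans hv h

instance [Finite C] (t : ℕ) : Finite (lowVars C n t) := by
  have : (lowVars C n t) ⊆ Set.univ ×ˢ (⋃ k ∈ Set.Iic t,
      {γ : Multiset (Fin n) | Multiset.card γ = k}) := by
    rintro ⟨c, γ⟩ h
    exact ⟨trivial, Set.mem_biUnion (Set.mem_Iic.mpr h) rfl⟩
  refine (Set.Finite.subset ?_ this).to_subtype
  refine Set.finite_univ.prod (Set.Finite.biUnion (Set.finite_Iic t) fun k _ => ?_)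
  exact Set.finite_coe_iff.mp (inferInstanceAs (Finite (Sym (Fin n) k)))

lemma exists_mem_supported_lowVars (f : JetRing C n) : ∃ t, f ∈ supported ℝ (lowVars C n t) := by
  classical
  refine ⟨f.vars.sup fun v => Multiset.card v.2, mem_supported.mpr fun v hv => ?_⟩
  exact Finset.le_sup (f := fun v : C × Multiset (Fin n) => Multiset.card v.2) hv

lemma supported_mono' {t t' : ℕ} (h : t ≤ t') {f : JetRing C n}
    (hf : f ∈ supported ℝ (lowVars C n t)) : f ∈ supported ℝ (lowVars C n t') :=
  supported_mono (lowVars_mono h) hf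

lemma symbMinor_mem_supported (x : Fin n → ℝ) (e : Fin m → Fin (m + 1)) :
    symbMinor cls u0 (fun i => MvPolynomial.C (x i)) e ∈ supported ℝ (lowVars C n 0) := by
  have h : ∀ b α, symb cls u0 (fun i => (MvPolynomial.C (x i) : JetRing C n)) b α
      ∈ supported ℝ (lowVars C n 0) := by
    intro b α
    refine sum_mem fun β _ => mul_mem ?_ (prod_mem fun i _ => ?_)
    · exact X_mem_supported.mpr (by simp [lowVars])
    · exact Subalgebra.algebraMap_mem _ _
  rw [symbMinor, Matrix.det_apply]
  refine sum_mem fun σ _ => ?_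
  rw [Units.smul_def]
  exact zsmul_mem (prod_mem fun i _ => h _ _) _

/-- `P` contains the elements of `J` in variables of order at most `t`. -/
def ContainsLow {W : Type} (i : W → C × Multiset (Fin n)) (t : ℕ) (J : Set (JetRing C n))
    (P : Ideal (MvPolynomial W ℝ)) : Prop :=
  ∀ f, rename i f ∈ J → rename i f ∈ supported ℝ (lowVars C n t) → f ∈ P

variable (cls) in
/-- The maximal minors of the symbol at real covectors. -/
def symbMinors : Set (JetRing C n) :=
  {f | ∃ (x : Fin n → ℝ) (e : Fin m → Fin (m + 1)),
    f = symbMinor cls u0 (fun i => MvPolynomial.C (x i)) e}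

/-- Induction on `h`. For each of the finitely many minimal primes `q` of the multipliers of order
at most `t` that omit some symbol minor, there is a multiplier outside the extension of `q`. Once
`t` is raised so far that these multipliers count, a prime containing the multipliers strictly
contains some such extension, and its height has grown. The level works for every set `W` of
variables that contains those of order at most `t`. -/
lemma exists_level_of_height [Finite C] (h0 : multIdeal cls ≠ ⊥) (h : ℕ) :
    ∃ t, ∀ (W : Type) (i : W → C × Multiset (Fin n)), Function.Injective i →
      lowVars C n t ⊆ Set.range i → ∀ P : Ideal (MvPolynomial W ℝ), P.IsPrime →
      ContainsLow i t (multIdeal cls) P →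
        ContainsLow i 0 (symbMinors cls) P ∨ (h : ℕ∞) ≤ P.height := by
  classical
  induction h with
  | zero => exact ⟨0, fun _ _ _ _ _ _ _ => Or.inr (by simp)⟩
  | succ h ih =>
    obtain ⟨t₁, ht₁⟩ := ih
    obtain ⟨d, hd, hd0⟩ := Submodule.exists_mem_ne_zero_of_ne_bot h0
    obtain ⟨t₂, ht₂⟩ := exists_mem_supported_lowVars d
    set t := max t₁ t₂ with ht
    let ι : lowVars C n t → C × Multiset (Fin n) := Subtype.val
    have hι : Function.Injective ι := Subtype.val_injective
    have hlift : ∀ {f : JetRing C n}, f ∈ supported ℝ (lowVars C n t) → ∃ f₀, rename ι f₀ = f := by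
      intro f hf
      rw [supported_eq_range_rename] at hf
      exact hf
    let J : Ideal (MvPolynomial (lowVars C n t) ℝ) :=
      (multIdeal cls).comap (rename ι : _ →ₐ[ℝ] JetRing C n)
    let ext : Ideal (MvPolynomial (lowVars C n t) ℝ) → Ideal (JetRing C n) :=
      fun q => q.map (rename ι : _ →ₐ[ℝ] JetRing C n)
    have hkey : ∀ q ∈ J.minimalPrimes, symbMinors cls ⊆ ext q ∨
        ∃ g ∈ multIdeal cls, g ∉ ext q := by
      intro q hq
      by_contra! hcon
      obtain ⟨hsub, hall⟩ := hcon
      rw [Set.not_subset] at hsub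
      obtain ⟨_, ⟨x, e, rfl⟩, hx⟩ := hsub
      have hqp : (ext q).IsPrime := isPrime_map_rename hι hq.1.1
      obtain ⟨f, hf, hfe⟩ := exists_symbMinor_jd_notMem hqp
        (fun hb => hd0 (by have := hall d hd; rwa [hb] at this)) t (fun w hw f hf =>
          pderiv_mem_map_rename (by rintro ⟨v, rfl⟩; exact absurd v.2 (not_le.mpr hw)) hf) hx
      have hmin : ext q ∈ (J.map (rename ι : _ →ₐ[ℝ] JetRing C n)).minimalPrimes := by
        refine ⟨⟨hqp, Ideal.map_mono hq.1.2⟩, fun q' hq' hle => ?_⟩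
        refine Ideal.map_le_iff_le_comap.mpr ?_
        have := hq'.1
        refine hq.2 ⟨Ideal.IsPrime.comap _, Ideal.map_le_iff_le_comap.mp hq'.2⟩ fun g hg => ?_
        exact (rename_mem_map_rename hι).mp (hle hg)
      obtain ⟨c, hc, k, hk⟩ := exists_mul_pow_mem_of_mem_minimalPrimes hmin hf
      have hJ : J.map (rename ι : MvPolynomial (lowVars C n t) ℝ →ₐ[ℝ] JetRing C n) ≤ multIdeal cls :=
        Ideal.map_le_iff_le_comap.mpr le_rfl
      obtain ⟨g, hg, hg'⟩ := exists_mem_multIdeal_notMem hqp hfe hc (hJ hk)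
      exact hg' (hall g hg)
    choose! g hg using fun q (hq : q ∈ J.minimalPrimes) => or_iff_not_imp_left.mp (hkey q hq)
    choose tg htg using fun q => exists_mem_supported_lowVars (g q)
    have hfin : J.minimalPrimes.Finite := Ideal.finite_minimalPrimes_of_isNoetherianRing _ J
    -- Finiteness of the set of minimal primes bounds the orders of the chosen multipliers.
    obtain ⟨t₃, ht₃⟩ := (hfin.image tg).bddAbove
    refine ⟨max t t₃, fun W i hi hW P hP hPI => ?_⟩
    have hltW : ∀ v : lowVars C n t, ∃ w, i w = v := fun v =>
      hW (lowVars_mono (le_max_left _ _) v.2)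
    choose l hl using hltW
    have hli : Function.Injective l := fun a b hab => Subtype.ext (by rw [← hl a, ← hl b, hab])
    have hcomp : i ∘ l = ι := funext hl
    have hren : ∀ f : MvPolynomial (lowVars C n t) ℝ, rename i (rename l f) = rename ι f := fun f => by rw [rename_rename, hcomp]
    have hJP : J ≤ P.comap (rename l : _ →ₐ[ℝ] MvPolynomial W ℝ) := by
      intro f hf
      refine hPI _ (by rw [hren]; exact hf) ?_
      rw [hren]
      refine supported_mono' (le_max_left _ _) ?_
      rw [supported_eq_range_rename]
      exact ⟨f, rfl⟩
    have : (P.comap (rename l : _ →ₐ[ℝ] MvPolynomial W ℝ)).IsPrime := Ideal.IsPrime.comap _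
    obtain ⟨q, hq, hqP⟩ := Ideal.exists_minimalPrimes_le hJP
    have hqW : (q.map (rename l : _ →ₐ[ℝ] MvPolynomial W ℝ)).IsPrime :=
      isPrime_map_rename hli hq.1.1
    have hle : q.map (rename l : _ →ₐ[ℝ] MvPolynomial W ℝ) ≤ P := Ideal.map_le_iff_le_comap.mpr hqP
    by_cases hs : symbMinors cls ⊆ ext q
    · left
      intro f hf hf0
      obtain ⟨f₀, hf₀⟩ := hlift (supported_mono' (Nat.zero_le t) hf0)
      have h1 : f = rename l f₀ := rename_injective i hi (by rw [hren, hf₀])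
      rw [h1]
      refine hle (Ideal.mem_map_of_mem _ ?_)
      have h2 := hs hf
      rw [← hf₀] at h2
      exact (rename_mem_map_rename hι).mp h2
    have h1 := ht₁ W i hi ((lowVars_mono ((le_max_left _ _).trans (le_max_left _ _))).trans hW) _ hqW
      (by
        intro f hf hf0
        obtain ⟨f₀, hf₀⟩ := hlift (supported_mono' (le_max_left _ _) hf0)
        have h1 : f = rename l f₀ := rename_injective i hi (by rw [hren, hf₀])
        rw [h1]
        refine Ideal.mem_map_of_mem _ (hq.1.2 ?_)
        rw [Ideal.mem_comap, hf₀]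
        exact hf)
    rcases h1 with h1 | h1
    · exact Or.inl fun f hf hf0 => hle (h1 f hf hf0)
    · right
      have hgs : g q ∈ supported ℝ (lowVars C n (max t t₃)) :=
        supported_mono' ((ht₃ ⟨q, hq, rfl⟩).trans (le_max_right _ _)) (htg q)
      obtain ⟨g', hg'⟩ := exists_rename_eq_of_mem_supported (supported_mono hW hgs)
      have hlt : q.map (rename l : _ →ₐ[ℝ] MvPolynomial W ℝ) < P := by
        refine lt_of_le_of_ne hle fun heq => (hg q hq hs).2 ?_
        have h3 : g' ∈ P := hPI g' (by rw [hg']; exact (hg q hq hs).1) (by rw [hg']; exact hgs)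
        rw [← heq] at h3
        have h4 := Ideal.mem_map_of_mem (rename i : _ →ₐ[ℝ] JetRing C n) h3
        rw [Ideal.map_mapₐ, hg'] at h4
        have h5 : (rename i : _ →ₐ[ℝ] JetRing C n).comp (rename l) = rename ι :=
          AlgHom.ext hren
        rwa [h5] at h4
      have h6 := Ideal.height_add_one_le_of_lt_of_isPrime hlt
      refine le_trans ?_ h6
      push_cast
      gcongr

end Height


open MvPolynomial

/-! ### Formal solutions of the adjoint equations over the field of fractions -/

section Linear

variable {n m r : ℕ} {C : Type}

/-- The polynomial with given coefficients that is linear in the jets of the functions. -/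
noncomputable def linForm :
    ((Fin m × Multiset (Fin n)) →₀ JetRing C n) →+ JetRing (C ⊕ Fin m) n :=
  Finsupp.liftAddHom fun v =>
    (AddMonoidHom.mulRight (X (Sum.inr v.1, v.2))).comp
      ((inc : JetRing C n →ₐ[ℝ] JetRing (C ⊕ Fin m) n) : _ →+ _)

@[simp] lemma linForm_single (v : Fin m × Multiset (Fin n)) (p : JetRing C n) :
    linForm (Finsupp.single v p) = inc p * X (Sum.inr v.1, v.2) := by
  simp [linForm]

lemma linForm_smul (a : JetRing C n) (f : (Fin m × Multiset (Fin n)) →₀ JetRing C n) :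
    linForm (a • f) = inc a * linForm f := by
  induction f using Finsupp.induction_linear with
  | zero => simp
  | add f g hf hg => rw [smul_add, map_add, hf, hg, map_add, mul_add]
  | single v p =>
    rw [Finsupp.smul_single, linForm_single, linForm_single, smul_eq_mul, map_mul, mul_assoc]

lemma jd_mem_range_linForm (i : Fin n) {x : JetRing (C ⊕ Fin m) n}
    (hx : x ∈ (linForm (C := C) (n := n) (m := m)).range) :
    jd i x ∈ (linForm (C := C) (n := n) (m := m)).range := by
  obtain ⟨f, rfl⟩ := hx
  induction f using Finsupp.induction_linear with
  | zero => simp [zero_mem]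
  | add f g hf hg => rw [map_add, map_add]; exact add_mem hf hg
  | single v p =>
    refine ⟨Finsupp.single (v.1, i ::ₘ v.2) p + Finsupp.single v (jd i p), ?_⟩
    simp [Derivation.leibniz]
    ring

lemma jdl_mem_range_linForm (w : List (Fin n)) {x : JetRing (C ⊕ Fin m) n}
    (hx : x ∈ (linForm (C := C) (n := n) (m := m)).range) :
    jdl w x ∈ (linForm (C := C) (n := n) (m := m)).range := by
  induction w with
  | nil => exact hx
  | cons i w ih => exact jd_mem_range_linForm i ih

variable (cls : Fin m → Fin (m + 1) → Tup n r → C)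

lemma adjE_mem_range_linForm (α : Fin (m + 1)) :
    adjE cls α ∈ (linForm (C := C) (n := n) (m := m)).range := by
  refine sum_mem fun b _ => sum_mem fun β _ => ?_
  have h : jdl (List.ofFn β.2) (X (Sum.inl (cls b α β), 0) * X (Sum.inr b, 0))
      ∈ (linForm (C := C) (n := n) (m := m)).range :=
    jdl_mem_range_linForm _ ⟨Finsupp.single (b, 0) (X (cls b α β, 0)), by simp⟩
  rcases neg_one_pow_eq_or ℝ (β.1 : ℕ) with h' | h' <;> rw [h']
  · simpa using h
  · rw [neg_smul, one_smul]; exact neg_mem h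

/-- Linear algebra over the field of fractions. If `φ_a` is in the span of the consequences,
clearing denominators gives a multiplier for `φ_a`; if not, a linear functional kills the
consequences but not `φ_a`. Normalized to be `1` on `φ_a`, it is a formal solution with generic
coefficients. -/
lemma exists_mul_X_mem_conseq_or (a : Fin m) {K : Type} [Field K] [Algebra (JetRing C n) K]
    [IsFractionRing (JetRing C n) K] [Algebra ℝ K] [IsScalarTower ℝ (JetRing C n) K] :
    (∃ d : JetRing C n, d ≠ 0 ∧ inc d * X (Sum.inr a, 0) ∈ conseq cls) ∨
    ∃ φ : JetRing (C ⊕ Fin m) n →ₐ[ℝ] K, (∀ c γ, φ (X (Sum.inl c, γ)) =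
        algebraMap (JetRing C n) K (X (c, γ)))
      ∧ φ (X (Sum.inr a, 0)) = 1
      ∧ ∀ (w : List (Fin n)) (α : Fin (m + 1)), φ (jdl w (adjE cls α)) = 0 := by
  classical
  choose ℓ hℓ using fun (p : List (Fin n) × Fin (m + 1)) =>
    jdl_mem_range_linForm p.1 (adjE_mem_range_linForm cls p.2)
  let toK : ((Fin m × Multiset (Fin n)) →₀ JetRing C n) →ₗ[JetRing C n]
      ((Fin m × Multiset (Fin n)) →₀ K) :=
    Finsupp.mapRange.linearMap (Algebra.linearMap (JetRing C n) K)
  have toK_inj : Function.Injective toK :=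
    Finsupp.mapRange_injective _ (map_zero _) (IsFractionRing.injective (JetRing C n) K)
  by_cases hmem : Finsupp.single (a, 0) (1 : K) ∈ Submodule.span K (Set.range (toK ∘ ℓ))
  · left
    obtain ⟨c, hc⟩ := (Finsupp.mem_span_range_iff_exists_finsupp).mp hmem
    obtain ⟨d, hd⟩ := IsLocalization.exist_integer_multiples (nonZeroDivisors (JetRing C n))
      c.support c
    choose! c' hc' using hd
    refine ⟨d, nonZeroDivisors.ne_zero d.2, ?_⟩
    have h1 : Finsupp.single (a, 0) (d : JetRing C n) = ∑ p ∈ c.support, c' p • ℓ p := by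
      refine toK_inj ?_
      rw [map_sum]
      have h2 : toK (Finsupp.single (a, 0) (d : JetRing C n))
          = (d : JetRing C n) • Finsupp.single (a, (0 : Multiset (Fin n))) (1 : K) := by
        simp only [toK, Finsupp.mapRange.linearMap_apply, Finsupp.mapRange_single,
          Algebra.linearMap_apply, Finsupp.smul_single]
        rw [Algebra.smul_def, mul_one]
      rw [h2, ← hc, Finsupp.sum, Finset.smul_sum]
      refine Finset.sum_congr rfl fun p hp => ?_
      rw [map_smul, ← smul_assoc, ← hc' p hp, Function.comp_apply, algebraMap_smul]
    have h3 := congrArg linForm h1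
    rw [linForm_single, map_sum] at h3
    simp only at h3
    rw [h3]
    refine sum_mem fun p _ => ?_
    rw [linForm_smul, hℓ]
    exact AddSubgroup.subset_closure ⟨_, _, _, rfl⟩
  · right
    obtain ⟨g, hg, hker⟩ := Submodule.exists_le_ker_of_notMem hmem
    let φ₀ : (C ⊕ Fin m) × Multiset (Fin n) → K := fun v =>
      match v.1 with
      | Sum.inl c => algebraMap _ K (X (c, v.2) : JetRing C n)
      | Sum.inr b => (g (Finsupp.single (a, 0) 1))⁻¹ * g (Finsupp.single (b, v.2) 1)
    have hinc : ∀ p : JetRing C n, aeval φ₀ (inc p : JetRing (C ⊕ Fin m) n) = algebraMap _ K p := by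
      intro p
      have : ((aeval φ₀).comp (inc : JetRing C n →ₐ[ℝ] JetRing (C ⊕ Fin m) n))
          = IsScalarTower.toAlgHom ℝ (JetRing C n) K := by
        refine algHom_ext fun v => ?_
        simp [φ₀]
      exact DFunLike.congr_fun this p
    have hlin : ∀ f, aeval φ₀ (linForm f) = (g (Finsupp.single (a, 0) 1))⁻¹ * g (toK f) := by
      intro f
      induction f using Finsupp.induction_linear with
      | zero => simp
      | add f g hf hg => rw [map_add, map_add, hf, hg, map_add, map_add, mul_add]
      | single v p =>
        rw [linForm_single, map_mul, hinc, aeval_X]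
        simp only [φ₀, toK, Finsupp.mapRange.linearMap_apply, Finsupp.mapRange_single,
          Algebra.linearMap_apply]
        have : Finsupp.single v (algebraMap _ K p) = algebraMap _ K p • Finsupp.single v (1 : K) := by
          rw [Finsupp.smul_single, smul_eq_mul, mul_one]
        rw [this, map_smul, smul_eq_mul]
        ring
    refine ⟨aeval φ₀, fun c γ => by simp [φ₀], by simp [φ₀, hg], fun w α => ?_⟩
    have h1 := hℓ (w, α)
    simp only at h1
    rw [← h1, hlin]
    have h2 : g (toK (ℓ (w, α))) = 0 := by
      have := hker (Submodule.subset_span (Set.mem_range_self (f := toK ∘ ℓ) (w, α)))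
      exact this
    rw [h2, mul_zero]

end Linear

/-! ### Counting derivatives -/

section Count

/-- Expressions of the `u v` as polynomials in the generators are themselves algebraically
independent, so there are at most as many as the transcendence degree of the polynomial ring in `G`.
-/
lemma card_le_of_algebraicIndependent {K : Type} [Field K] [Algebra ℝ K] {V G : Type} [Finite V]
    [Finite G] {u : V → K} (hu : AlgebraicIndependent ℝ u) (g : G → K)
    (h : ∀ v, u v ∈ Algebra.adjoin ℝ (Set.range g)) : Nat.card V ≤ Nat.card G := by
  have h1 : ∀ v, ∃ p : MvPolynomial G ℝ, aeval g p = u v := fun v => by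
    have := h v
    rwa [Algebra.adjoin_range_eq_range_aeval] at this
  choose p hp using h1
  have h2 : AlgebraicIndependent ℝ p :=
    AlgebraicIndependent.of_comp (aeval g) (by convert hu using 1; exact funext hp)
  have h3 := h2.cardinalMk_le_trdeg
  rw [MvPolynomial.trdeg_of_isDomain, Cardinal.lift_id] at h3
  exact Cardinal.toNat_le_toNat h3 Cardinal.mk_lt_aleph0

/-- Otherwise the number of derivatives of order at most `r k` would grow at least like `(1 +
1/m)^k`, but it is at most `(r k + 1)^n`. -/
lemma exists_growth (n m r : ℕ) (hm : 1 ≤ m) : ∃ s : ℕ,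
    m * Nat.card {γ : Multiset (Fin n) // Multiset.card γ ≤ r + s}
      ≤ (m + 1) * Nat.card {γ : Multiset (Fin n) // Multiset.card γ ≤ s} := by
  classical
  by_contra! hcon
  set N : ℕ → ℕ := fun s => Nat.card {γ : Multiset (Fin n) // Multiset.card γ ≤ s} with hN
  have hm0 : (0 : ℝ) < m := by exact_mod_cast hm
  set q : ℝ := 1 + 1 / m with hq
  have hq1 : 1 < q := by rw [hq]; have := one_div_pos.mpr hm0; linarith
  have hinj : ∀ t, ∃ f : {γ : Multiset (Fin n) // Multiset.card γ ≤ t} → Fin n → Fin (t + 1),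
      Function.Injective f := fun t =>
    ⟨fun γ i => ⟨γ.1.count i, Nat.lt_succ_of_le ((Multiset.count_le_card _ _).trans γ.2)⟩,
      fun a b hab => Subtype.ext (Multiset.ext.mpr fun i => by
        have := congrFun hab i
        simpa using this)⟩
  have hfin : ∀ t, Finite {γ : Multiset (Fin n) // Multiset.card γ ≤ t} := fun t => by
    obtain ⟨f, hf⟩ := hinj t
    exact Finite.of_injective f hf
  have hup : ∀ t, N t ≤ (t + 1) ^ n := fun t => by
    obtain ⟨f, hf⟩ := hinj t
    simpa using Nat.card_le_card_of_injective f hf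
  have hlow : ∀ k : ℕ, q ^ k ≤ N (r * k) := by
    intro k
    induction k with
    | zero =>
      have : Nonempty {γ : Multiset (Fin n) // Multiset.card γ ≤ r * 0} := ⟨⟨0, by simp⟩⟩
      have h1 : 1 ≤ N (r * 0) := Nat.card_pos
      simpa using (by exact_mod_cast h1 : (1 : ℝ) ≤ N (r * 0))
    | succ k ih =>
      have h1 : ((m + 1) * N (r * k) : ℝ) < m * N (r + r * k) := by exact_mod_cast hcon (r * k)
      have h2 : q * N (r * k) ≤ N (r + r * k) := by
        rw [hq, ← mul_le_mul_iff_right₀ hm0]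
        refine le_trans (le_of_eq ?_) h1.le
        field_simp
      rw [pow_succ, mul_comm, Nat.mul_succ, add_comm]
      exact le_trans (mul_le_mul_of_nonneg_left ih (by linarith)) h2
  have hlim := tendsto_pow_const_div_const_pow_of_one_lt n hq1
  have hr0 : (0 : ℝ) < ((r : ℝ) + 1) ^ n * q := by positivity
  obtain ⟨k, hk⟩ := ((hlim.comp (Filter.tendsto_add_atTop_nat 1)).eventually
    (gt_mem_nhds (inv_pos.mpr hr0))).exists
  simp only [Function.comp_apply] at hk
  rw [div_lt_iff₀ (by positivity), pow_succ q k, inv_mul_eq_div, lt_div_iff₀ hr0] at hk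
  have h1 : ((N (r * k) : ℕ) : ℝ) ≤ ((r * k + 1 : ℕ) : ℝ) ^ n := by exact_mod_cast hup (r * k)
  have h2 : ((r * k + 1 : ℕ) : ℝ) ^ n ≤ (((k + 1 : ℕ) : ℝ) * (r + 1)) ^ n := by
    refine pow_le_pow_left₀ (by positivity) ?_ _
    push_cast
    nlinarith [Nat.cast_nonneg (α := ℝ) r, Nat.cast_nonneg (α := ℝ) k]
  have h3 := ((hlow k).trans h1).trans h2
  rw [mul_pow] at h3
  nlinarith

end Count

/-! ### A nonzero multiplier exists -/

section Leibniz

variable {n m r : ℕ} {C : Type}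

lemma jd_mem_adjoin {A : Type} (i : Fin n) {S : Set (JetRing A n)}
    {B : Subalgebra ℝ (JetRing A n)} (hS : ∀ x ∈ S, x ∈ B ∧ jd i x ∈ B) {x : JetRing A n}
    (hx : x ∈ Algebra.adjoin ℝ S) : jd i x ∈ B := by
  suffices h : x ∈ B ∧ jd i x ∈ B from h.2
  induction hx using Algebra.adjoin_induction with
  | mem x hx => exact hS x hx
  | algebraMap t => exact ⟨B.algebraMap_mem t, by simp [B.zero_mem]⟩
  | add x y _ _ hx hy => exact ⟨add_mem hx.1 hy.1, by rw [map_add]; exact add_mem hx.2 hy.2⟩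
  | mul x y _ _ hx hy =>
    refine ⟨mul_mem hx.1 hy.1, ?_⟩
    rw [Derivation.leibniz, smul_eq_mul, smul_eq_mul]
    exact add_mem (mul_mem hx.1 hy.2) (mul_mem hy.1 hx.2)

variable (n m) in
/-- The jets of the coefficient `c` of order less than `k`, and of functions of order
at most `k`. -/
def lowGens (c : C) (k : ℕ) : Set (JetRing (C ⊕ Fin m) n) :=
  {x | ∃ γ : Multiset (Fin n), Multiset.card γ < k ∧ x = X (Sum.inl c, γ)} ∪
  {x | ∃ (b : Fin m) (γ : Multiset (Fin n)), Multiset.card γ ≤ k ∧ x = X (Sum.inr b, γ)}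

/-- Only one term of the Leibniz expansion contains the full derivative of the coefficient; all
others have derivatives of it of lower order. -/
lemma jdl_mul_sub_mem (c : C) (b : Fin m) (w : List (Fin n)) :
    jdl w (X (Sum.inl c, 0) * X (Sum.inr b, 0))
      - X (Sum.inl c, (w : Multiset (Fin n))) * X (Sum.inr b, 0)
      ∈ Algebra.adjoin ℝ (lowGens n m c w.length) := by
  induction w with
  | nil =>
    rw [jdl_nil, Multiset.coe_nil, sub_self]
    exact zero_mem _
  | cons i w ih =>
    have h1 := jd_mem_adjoin i (B := Algebra.adjoin ℝ (lowGens n m c (w.length + 1))) (by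
      rintro x (⟨γ, hγ, rfl⟩ | ⟨b, γ, hγ, rfl⟩)
      · refine ⟨Algebra.subset_adjoin (Or.inl ⟨γ, by omega, rfl⟩),
          Algebra.subset_adjoin (Or.inl ⟨i ::ₘ γ, by simpa using hγ, by simp⟩)⟩
      · refine ⟨Algebra.subset_adjoin (Or.inr ⟨b, γ, by omega, rfl⟩),
          Algebra.subset_adjoin (Or.inr ⟨b, i ::ₘ γ, by simpa using hγ, by simp⟩)⟩) ih
    have h2 : (X (Sum.inl c, (w : Multiset (Fin n))) * X (Sum.inr b, {i}) :
        JetRing (C ⊕ Fin m) n) ∈ Algebra.adjoin ℝ (lowGens n m c (w.length + 1)) :=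
      mul_mem (Algebra.subset_adjoin (Or.inl ⟨w, by simp, rfl⟩))
        (Algebra.subset_adjoin (Or.inr ⟨b, {i}, by simp, rfl⟩))
    rw [List.length_cons]
    convert add_mem h1 h2 using 1
    rw [map_sub, Derivation.leibniz, jdl_cons]
    simp only [jd_X, smul_eq_mul, ← Multiset.cons_coe, Multiset.cons_zero]
    ring

lemma jdl_append {A : Type} (w w' : List (Fin n)) (x : JetRing A n) :
    jdl (w ++ w') x = jdl w (jdl w' x) := List.foldr_append

lemma jdl_mul_mem {K : Type} [CommRing K] [Algebra ℝ K] (φ : JetRing (C ⊕ Fin m) n →ₐ[ℝ] K)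
    (A : Subalgebra ℝ K) (c : C) (b : Fin m) (w : List (Fin n))
    (h1 : ∀ γ : Multiset (Fin n), Multiset.card γ ≤ w.length → φ (X (Sum.inl c, γ)) ∈ A)
    (h2 : ∀ (b : Fin m) (γ : Multiset (Fin n)), Multiset.card γ ≤ w.length →
      φ (X (Sum.inr b, γ)) ∈ A) :
    φ (jdl w (X (Sum.inl c, 0) * X (Sum.inr b, 0))) ∈ A := by
  have h3 : Algebra.adjoin ℝ (lowGens n m c w.length) ≤ A.comap φ := by
    rw [Algebra.adjoin_le_iff]
    rintro x (⟨γ, hγ, rfl⟩ | ⟨b, γ, hγ, rfl⟩)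
    · exact h1 γ (by omega)
    · exact h2 b γ hγ
  have h4 := h3 (jdl_mul_sub_mem c b w)
  rw [Subalgebra.mem_comap, map_sub, map_mul] at h4
  have h5 := add_mem h4 (mul_mem (h1 w (by simp)) (h2 b 0 (by simp)))
  rwa [sub_add_cancel] at h5

variable (cls : Fin m → Fin (m + 1) → Tup n r → C)

/-- The empty tuple of indices. -/
def nilTup (n r : ℕ) : Tup n r := ⟨0, fun i => i.elim0⟩

/-- As `φ_a = 1`, the coefficient `Λ_a^α` of order zero enters the equation with its derivative
along `w` alone, up to lower derivatives of it; the equation is solved for this derivative. -/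
lemma mem_of_jdl_adjE {K : Type} [CommRing K] [Algebra ℝ K]
    (φ : JetRing (C ⊕ Fin m) n →ₐ[ℝ] K) (A : Subalgebra ℝ K) (a : Fin m) (ha : φ (X (Sum.inr a, 0)) = 1)
    (w : List (Fin n)) (α : Fin (m + 1)) (hw : φ (jdl w (adjE cls α)) = 0)
    (h1 : ∀ (b : Fin m) (β : Tup n r), (b, β) ≠ (a, nilTup n r) → ∀ γ : Multiset (Fin n),
      Multiset.card γ ≤ w.length + β.1 → φ (X (Sum.inl (cls b α β), γ)) ∈ A)
    (h2 : ∀ (b : Fin m) (γ : Multiset (Fin n)), Multiset.card γ ≤ r + w.length →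
      φ (X (Sum.inr b, γ)) ∈ A)
    (h3 : ∀ γ : Multiset (Fin n), Multiset.card γ < w.length →
      φ (X (Sum.inl (cls a α (nilTup n r)), γ)) ∈ A) :
    φ (X (Sum.inl (cls a α (nilTup n r)), (w : Multiset (Fin n)))) ∈ A := by
  classical
  have h4 : ∑ p : Fin m × Tup n r, ((-1 : ℝ) ^ (p.2.1 : ℕ)) • φ (jdl (w ++ List.ofFn p.2.2)
      (X (Sum.inl (cls p.1 α p.2), 0) * X (Sum.inr p.1, 0))) = 0 := by
    rw [← hw, adjE, jdl_sum, map_sum, Fintype.sum_prod_type]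
    refine Finset.sum_congr rfl fun b _ => ?_
    rw [jdl_sum, map_sum]
    refine Finset.sum_congr rfl fun β _ => ?_
    rw [jdl_smul, map_smul, jdl_append]
  rw [← Finset.add_sum_erase _ _ (Finset.mem_univ (a, nilTup n r))] at h4
  have h5 : ∑ p ∈ Finset.univ.erase (a, nilTup n r), ((-1 : ℝ) ^ (p.2.1 : ℕ)) •
      φ (jdl (w ++ List.ofFn p.2.2) (X (Sum.inl (cls p.1 α p.2), 0) * X (Sum.inr p.1, 0))) ∈ A := by
    refine sum_mem fun p hp => A.smul_mem (jdl_mul_mem φ A _ _ _ (fun γ hγ => ?_) fun b γ hγ => ?_) _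
    · exact h1 _ _ (Finset.ne_of_mem_erase hp) γ (by simpa using hγ)
    · refine h2 b γ (hγ.trans ?_)
      have := p.2.1.2
      simp only [List.length_append, List.length_ofFn]
      omega
  have h6 : Algebra.adjoin ℝ (lowGens n m (cls a α (nilTup n r)) w.length) ≤ A.comap φ := by
    rw [Algebra.adjoin_le_iff]
    rintro x (⟨γ, hγ, rfl⟩ | ⟨b, γ, hγ, rfl⟩)
    · exact h3 γ hγ
    · exact h2 b γ (by omega)
  have h7 := h6 (jdl_mul_sub_mem (cls a α (nilTup n r)) a w)
  rw [Subalgebra.mem_comap, map_sub, map_mul, ha, mul_one] at h7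
  have h8 : ((-1 : ℝ) ^ ((nilTup n r).1 : ℕ)) • φ (jdl (w ++ List.ofFn (nilTup n r).2)
      (X (Sum.inl (cls a α (nilTup n r)), 0) * X (Sum.inr a, 0)))
      = φ (jdl w (X (Sum.inl (cls a α (nilTup n r)), 0) * X (Sum.inr a, 0))) := by
    have : List.ofFn (nilTup n r).2 = [] := List.ofFn_zero
    rw [this, List.append_nil]
    simp [nilTup]
  simp only at h4
  rw [h8] at h4
  have h9 := neg_mem (add_mem h5 h7)
  rw [← eq_neg_iff_add_eq_zero] at h4
  rw [h4] at h9
  simpa using h9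

/-- Suppose that `φ_a` has no multiplier, and take a formal solution. By induction on the order, the
derivatives of order at most `s` of the `m + 1` coefficients `Λ_a^α` lie in the algebra generated by
the other coefficient jets of order at most `r + s` and the jets of `φ`. This replaces at least `(m
+ 1) N(s)` independent variables by fewer than `m N(r + s)` generators, `N` counting derivatives,
which contradicts algebraic independence for the `s` of `exists_growth`. -/
theorem multIdeal_ne_bot [Finite C] (hm : 1 ≤ m)
    (hinj : ∀ a α a' α' β, cls a α (nilTup n r) = cls a' α' β → a = a' ∧ α = α' ∧ β = nilTup n r) :
    multIdeal cls ≠ ⊥ := by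
  classical
  obtain ⟨s, hs⟩ := exists_growth n m r hm
  have hex : ∀ a : Fin m, ∃ d : JetRing C n, d ≠ 0 ∧ inc d * X (Sum.inr a, 0) ∈ conseq cls := by
    intro a
    rcases exists_mul_X_mem_conseq_or cls a (K := FractionRing (JetRing C n)) with h | h
    · exact h
    exfalso
    obtain ⟨φ, hφ, ha, hw⟩ := h
    let V := lowVars C n (r + s)
    let top : V → Prop := fun v => ∃ α, v.1.1 = cls a α (nilTup n r) ∧ Multiset.card v.1.2 ≤ s
    let Φ := {γ : Multiset (Fin n) // Multiset.card γ ≤ r + s}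
    let Γs := {γ : Multiset (Fin n) // Multiset.card γ ≤ s}
    -- The excluded generator is `φ_a` itself, which equals `1`; it makes the inequality of
    -- cardinalities strict.
    let G₂ := {w : Fin m × Φ // w ≠ (a, ⟨0, by simp⟩)}
    let g : {v : V // ¬ top v} ⊕ G₂ → FractionRing (JetRing C n) := Sum.elim
      (fun v => φ (X (Sum.inl v.1.1.1, v.1.1.2))) (fun w => φ (X (Sum.inr w.1.1, w.1.2.1)))
    let u : V → FractionRing (JetRing C n) := fun v => algebraMap (JetRing C n) _ (X v.1)
    have hu : AlgebraicIndependent ℝ u := by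
      have h1 : AlgebraicIndependent ℝ (fun v : V => (X v.1 : JetRing C n)) :=
        (algebraicIndependent_X _ _).comp _ Subtype.val_injective
      exact h1.map' (f := IsScalarTower.toAlgHom ℝ (JetRing C n) (FractionRing (JetRing C n)))
        (IsFractionRing.injective _ _)
    have hΦ : Finite Φ := by
      have : Function.Injective fun γ : Φ => (⟨(cls a 0 (nilTup n r), γ.1), γ.2⟩ : V) := by
        intro x y hxy
        exact Subtype.ext (by simpa [Subtype.ext_iff] using hxy)
      exact Finite.of_injective _ this
    have hΓ : Finite Γs :=
      Finite.of_injective (fun γ : Γs => (⟨γ.1, γ.2.trans (by omega)⟩ : Φ)) fun x y hxy => by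
        exact Subtype.ext (by simpa [Subtype.ext_iff] using hxy)
    set A := Algebra.adjoin ℝ (Set.range g) with hA
    have hA1 : ∀ v : V, ¬ top v → φ (X (Sum.inl v.1.1, v.1.2)) ∈ A := fun v hv =>
      Algebra.subset_adjoin ⟨Sum.inl ⟨v, hv⟩, rfl⟩
    have hA2 : ∀ (b : Fin m) (γ : Multiset (Fin n)), Multiset.card γ ≤ r + s →
        φ (X (Sum.inr b, γ)) ∈ A := by
      intro b γ hγ
      by_cases h : (b, (⟨γ, hγ⟩ : Φ)) = (a, ⟨0, by simp⟩)
      · have h2 : γ = 0 := congrArg (fun x : Fin m × Φ => x.2.1) h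
        have h1 : b = a := congrArg Prod.fst h
        rw [h1, h2, ha]; exact one_mem _
      · exact Algebra.subset_adjoin ⟨Sum.inr ⟨(b, ⟨γ, hγ⟩), h⟩, rfl⟩
    have hA3 : ∀ k ≤ s, ∀ α (γ : Multiset (Fin n)), Multiset.card γ = k →
        φ (X (Sum.inl (cls a α (nilTup n r)), γ)) ∈ A := by
      intro k
      induction k using Nat.strong_induction_on with
      | _ k ih =>
        intro hk α γ hγ
        have hlen : γ.toList.length = k := by rw [Multiset.length_toList, hγ]
        have h1 := mem_of_jdl_adjE cls φ A a ha γ.toList α (hw _ _)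
        rw [Multiset.coe_toList] at h1
        refine h1 ?_ (fun b γ' h => hA2 b γ' (by omega)) fun γ' h => ih _ (by omega) (by omega) α γ' rfl
        intro b β hne γ' hγ'
        have hβ := β.1.2
        refine hA1 ⟨(cls b α β, γ'), show Multiset.card γ' ≤ r + s by omega⟩ ?_
        rintro ⟨α', h, _⟩
        obtain ⟨rfl, rfl, h'⟩ := hinj _ _ _ _ _ h.symm
        exact hne (by rw [h'])
    have hall : ∀ v, u v ∈ A := by
      intro v
      have h1 : u v = φ (X (Sum.inl v.1.1, v.1.2)) := (hφ _ _).symm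
      rw [h1]
      by_cases h : top v
      · obtain ⟨α, h2, h3⟩ := h
        rw [h2]
        exact hA3 _ h3 α _ rfl
      · exact hA1 v h
    have hcard := card_le_of_algebraicIndependent hu g hall
    rw [Nat.card_sum] at hcard
    have hV : Nat.card V = Nat.card {v // top v} + Nat.card {v // ¬ top v} := by
      rw [← Nat.card_sum]
      exact Nat.card_congr (Equiv.sumCompl top).symm
    have htop : (m + 1) * Nat.card Γs ≤ Nat.card {v // top v} := by
      have : (m + 1) * Nat.card Γs = Nat.card (Fin (m + 1) × Γs) := by simp
      rw [this]
      refine Nat.card_le_card_of_injective (fun p => ⟨⟨(cls a p.1 (nilTup n r), p.2.1),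
        show Multiset.card p.2.1 ≤ r + s from p.2.2.trans (by omega)⟩, p.1, rfl, p.2.2⟩) ?_
      rintro ⟨α, γ⟩ ⟨α', γ'⟩ h
      have h1 := congrArg (fun x : {v // top v} => x.1.1.1) h
      have h2 := congrArg (fun x : {v // top v} => x.1.1.2) h
      exact Prod.ext (hinj _ _ _ _ _ h1).2.1 (Subtype.ext h2)
    have hG : Nat.card G₂ < m * Nat.card Φ := by
      have : m * Nat.card Φ = Nat.card (Fin m × Φ) := by simp
      rw [this]
      exact Finite.card_subtype_lt (x := (a, ⟨0, by simp⟩)) (by simp)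
    have hs' : m * Nat.card Φ ≤ (m + 1) * Nat.card Γs := hs
    omega
  choose d hd0 hd using hex
  -- The product of the multipliers found for the individual `φ_a` serves for all of them.
  refine Submodule.ne_bot_iff _ |>.mpr ⟨∏ a, d a, fun a => ?_, Finset.prod_ne_zero_iff.mpr fun a _ => hd0 a⟩
  rw [← Finset.prod_erase_mul _ _ (Finset.mem_univ a), map_mul, mul_assoc]
  exact inc_mul_mem_conseq _ (hd a)

end Leibniz


open MvPolynomial

/-! ### Integral extensions and weight filtrations -/

section Integral

lemma ringKrullDim_le_of_isIntegral {A D : Type*} [CommRing A] [CommRing D] [Algebra A D]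
    [Algebra.IsIntegral A D] : ringKrullDim D ≤ ringKrullDim A := by
  refine Order.krullDim_le_of_strictMono
    (fun p : PrimeSpectrum D => PrimeSpectrum.comap (algebraMap A D) p) fun p q hpq => ?_
  exact Ideal.IsIntegral.comap_lt_comap (R := A) (I := p.asIdeal) (J := q.asIdeal) hpq

end Integral

section Filtration

variable {A D Q : Type*} [CommRing A] [CommRing D] [Algebra A D] [Fintype Q]

variable (A) in

/-- The span of the monomials of weight less than `N`. -/
def fil (y : Q → D) (ν : Q → ℕ) (N : ℕ) : Submodule A D :=
  Submodule.span A {x | ∃ e : Q → ℕ, ∑ q, e q * ν q < N ∧ x = ∏ q, y q ^ e q}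

variable {y : Q → D} {ν : Q → ℕ}

lemma fil_mono {N N' : ℕ} (h : N ≤ N') : fil A y ν N ≤ fil A y ν N' :=
  Submodule.span_mono fun _ ⟨e, he, hx⟩ => ⟨e, he.trans_le h, hx⟩

/-- The index `N` of `fil` is a strict bound: a factor in level `N + 1` has weight at most `N`. -/
lemma mul_mem_fil {N N' : ℕ} {x z : D} (hx : x ∈ fil A y ν (N + 1)) (hz : z ∈ fil A y ν N') :
    x * z ∈ fil A y ν (N + N') := by
  have h := Submodule.mul_mem_mul hx hz
  rw [fil, fil, Submodule.span_mul_span] at h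
  refine Submodule.span_mono ?_ h
  rintro _ ⟨_, ⟨e, he, rfl⟩, _, ⟨e', he', rfl⟩, rfl⟩
  refine ⟨e + e', ?_, ?_⟩
  · simp only [Pi.add_apply, add_mul, Finset.sum_add_distrib]
    omega
  · simp [pow_add, Finset.prod_mul_distrib]

lemma one_mem_fil {N : ℕ} (hN : 0 < N) : (1 : D) ∈ fil A y ν N :=
  Submodule.subset_span ⟨0, by simpa using hN, by simp⟩

lemma algebraMap_mem_fil (a : A) {N : ℕ} (hN : 0 < N) : algebraMap A D a ∈ fil A y ν N := by
  rw [Algebra.algebraMap_eq_smul_one]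
  exact Submodule.smul_mem _ _ (one_mem_fil hN)

lemma pow_mem_fil (q : Q) (k : ℕ) {N : ℕ} (h : k * ν q < N) : y q ^ k ∈ fil A y ν N := by
  classical
  refine Submodule.subset_span ⟨Pi.single q k, ?_, ?_⟩
  · rw [Finset.sum_eq_single q]
    · simpa using h
    · intro p _ hp; simp [hp]
    · simp
  · rw [Finset.prod_eq_single q]
    · simp
    · intro p _ hp; simp [hp]
    · simp

lemma prod_mem_fil {ι : Type*} (s : Finset ι) (x : ι → D) (N : ι → ℕ)
    (h : ∀ i ∈ s, x i ∈ fil A y ν (N i + 1)) : ∏ i ∈ s, x i ∈ fil A y ν (∑ i ∈ s, N i + 1) := by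
  classical
  induction s using Finset.induction_on with
  | empty => simpa using one_mem_fil one_pos
  | insert i s hi ih =>
    rw [Finset.prod_insert hi, Finset.sum_insert hi, add_assoc]
    exact mul_mem_fil (h i (Finset.mem_insert_self _ _))
      (ih fun j hj => h j (Finset.mem_insert_of_mem hj))

/-- Elements of `A` have weight zero, so replacing each factor by `y q` changes the product only by
terms of lower weight. -/
lemma prod_sub_pow_mem_fil {ι : Type*} (s : Finset ι) (x : ι → D) (q : Q) (hq : 1 ≤ ν q)
    (h : ∀ i ∈ s, ∃ a : A, x i = algebraMap A D a + y q) :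
    ∏ i ∈ s, x i - y q ^ s.card ∈ fil A y ν (s.card * ν q) := by
  classical
  induction s using Finset.induction_on with
  | empty => simp [zero_mem]
  | insert i s hi ih =>
    have ih' := ih fun j hj => h j (Finset.mem_insert_of_mem hj)
    obtain ⟨a, ha⟩ := h i (Finset.mem_insert_self _ _)
    rw [Finset.prod_insert hi, Finset.card_insert_of_notMem hi]
    have h1 : x i ∈ fil A y ν (ν q + 1) := by
      rw [ha]
      exact add_mem (algebraMap_mem_fil a (by omega)) (by simpa using pow_mem_fil q 1 (by omega))
    have h2 := mul_mem_fil h1 ih'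
    have h3 : algebraMap A D a * y q ^ s.card ∈ fil A y ν (s.card * ν q + 1) := by
      rw [← Algebra.smul_def]
      exact Submodule.smul_mem _ _ (pow_mem_fil q _ (by omega))
    have h4 := fil_mono (show s.card * ν q + 1 ≤ ν q + s.card * ν q by omega) h3
    convert add_mem h2 h4 using 1
    · congr 1; ring
    · rw [ha]; ring

lemma exists_mem_fil_of_mem_adjoin {R : Type*} [CommRing R] [Algebra R A] [Algebra R D]
    [IsScalarTower R A D] {S : Set D} (hS : ∀ x ∈ S, ∃ N, x ∈ fil A y ν N) {x : D}
    (hx : x ∈ Algebra.adjoin R S) : ∃ N, x ∈ fil A y ν N := by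
  induction hx using Algebra.adjoin_induction with
  | mem x hx => exact hS x hx
  | algebraMap t =>
    refine ⟨1, ?_⟩
    rw [IsScalarTower.algebraMap_apply R A D]
    exact algebraMap_mem_fil _ one_pos
  | add x y _ _ hx hy =>
    obtain ⟨N, hN⟩ := hx
    obtain ⟨N', hN'⟩ := hy
    exact ⟨max N N', add_mem (fil_mono (le_max_left _ _) hN) (fil_mono (le_max_right _ _) hN')⟩
  | mul x y _ _ hx hy =>
    obtain ⟨N, hN⟩ := hx
    obtain ⟨N', hN'⟩ := hy
    exact ⟨N + N', mul_mem_fil (fil_mono (Nat.le_succ N) hN) hN'⟩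

/-- A monomial with some exponent at least `m` is rewritten by terms of strictly smaller weight, so
the reduction ends with all exponents below `m`. These monomials are finite in number. -/
lemma fil_le_of_pow_mem {m : ℕ} (h : ∀ q, y q ^ m ∈ fil A y ν (m * ν q)) (N : ℕ) :
    fil A y ν N ≤ Submodule.span A (Set.range fun e : Q → Fin m => ∏ q, y q ^ (e q : ℕ)) := by
  classical
  induction N with
  | zero =>
    rw [fil, Submodule.span_le]
    rintro _ ⟨e, he, _⟩
    omega
  | succ N ih =>
    rw [fil, Submodule.span_le]
    rintro _ ⟨e, he, rfl⟩
    by_cases hlt : ∀ q, e q < m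
    · exact Submodule.subset_span ⟨fun q => ⟨e q, hlt q⟩, rfl⟩
    push Not at hlt
    obtain ⟨q, hq⟩ := hlt
    refine ih ?_
    have h1 : ∏ p, y p ^ e p = (∏ p, y p ^ (Function.update e q (e q - m)) p) * y q ^ m := by
      rw [← Finset.prod_erase_mul _ _ (Finset.mem_univ q),
        ← Finset.prod_erase_mul (a := q) _ (fun p => y p ^ Function.update e q (e q - m) p)
          (Finset.mem_univ q), Function.update_self, mul_assoc, ← pow_add, Nat.sub_add_cancel hq]
      congr 1
      refine Finset.prod_congr rfl fun p hp => ?_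
      rw [Function.update_of_ne (Finset.ne_of_mem_erase hp)]
    have h2 : ∑ p, e p * ν p = ∑ p, (Function.update e q (e q - m)) p * ν p + m * ν q := by
      rw [← Finset.sum_erase_add _ _ (Finset.mem_univ q),
        ← Finset.sum_erase_add (a := q) _ (fun p => Function.update e q (e q - m) p * ν p)
          (Finset.mem_univ q), Function.update_self, add_assoc, ← add_mul, Nat.sub_add_cancel hq]
      congr 1
      refine Finset.sum_congr rfl fun p hp => ?_
      rw [Function.update_of_ne (Finset.ne_of_mem_erase hp)]
    rw [h1]
    have h3 : ∏ p, y p ^ (Function.update e q (e q - m)) p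
        ∈ fil A y ν (∑ p, (Function.update e q (e q - m)) p * ν p + 1) :=
      Submodule.subset_span ⟨_, Nat.lt_succ_self _, rfl⟩
    exact fil_mono (by omega) (mul_mem_fil h3 (h q))

lemma isIntegral_of_fil {R : Type*} [CommRing R] [Algebra R A] [Algebra R D]
    [IsScalarTower R A D] {m : ℕ} {S : Set D} (hS : ∀ x ∈ S, ∃ N, x ∈ fil A y ν N)
    (htop : Algebra.adjoin R S = ⊤) (h : ∀ q, y q ^ m ∈ fil A y ν (m * ν q)) :
    Algebra.IsIntegral A D := by
  have : Module.Finite A D := by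
    refine ⟨Submodule.fg_def.mpr ⟨Set.range fun e : Q → Fin m => ∏ q, y q ^ (e q : ℕ),
      Set.finite_range _, ?_⟩⟩
    refine eq_top_iff.mpr fun x _ => ?_
    obtain ⟨N, hN⟩ := exists_mem_fil_of_mem_adjoin (R := R) hS (x := x) (by rw [htop]; trivial)
    exact fil_le_of_pow_mem h N hN
  infer_instance

end Filtration

/-! ### Codimension of the vanishing of the symbol minors -/

section Hankel

/-- The numbers `σ j + j` have mean `m - 1` for every permutation, and the excess of the sum of
squares is their variance, which vanishes only for the antidiagonal. -/
lemma sum_sq_lt {m : ℕ} (K : ℕ) (σ : Equiv.Perm (Fin m)) (hσ : σ ≠ Fin.revPerm) :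
    m * (K + (m - 1)) ^ 2 < ∑ j : Fin m, (K + (σ j + j : ℕ)) ^ 2 := by
  obtain ⟨j₀, hj₀⟩ : ∃ j, σ j ≠ Fin.rev j := by
    by_contra! h
    exact hσ (Equiv.ext h)
  have hm : 1 ≤ m := by have := j₀.2; omega
  have h1 : ∑ j : Fin m, ((σ j : ℤ) + j - (m - 1)) = 0 := by
    have h2 : ∑ j : Fin m, (σ j : ℤ) = ∑ j : Fin m, (Fin.rev j : ℤ) := by
      rw [Equiv.sum_comp σ (fun j => (j : ℤ)), ← Equiv.sum_comp Fin.revPerm (fun j => (j : ℤ))]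
      rfl
    have h3 : ∑ j : Fin m, ((σ j : ℤ) + j - (m - 1))
        = ∑ j : Fin m, (σ j : ℤ) + ∑ j : Fin m, ((j : ℤ) - (m - 1)) := by
      rw [← Finset.sum_add_distrib]
      exact Finset.sum_congr rfl fun j _ => by ring
    rw [h3, h2, ← Finset.sum_add_distrib]
    refine Finset.sum_eq_zero fun j _ => ?_
    have := j.2
    rw [Fin.val_rev]
    push_cast [Nat.cast_sub (show (j : ℕ) + 1 ≤ m by omega)]
    ring
  have h2 : 0 < ∑ j : Fin m, ((σ j : ℤ) + j - (m - 1)) ^ 2 := by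
    refine Finset.sum_pos' (fun j _ => sq_nonneg _) ⟨j₀, Finset.mem_univ _, ?_⟩
    refine sq_pos_of_ne_zero ?_
    intro h
    refine hj₀ (Fin.ext ?_)
    have := j₀.2
    rw [Fin.val_rev]
    omega
  zify
  have h3 : ∑ j : Fin m, ((K : ℤ) + (σ j + j)) ^ 2
      = m * (K + (m - 1)) ^ 2 + 2 * (K + (m - 1)) * ∑ j : Fin m, ((σ j : ℤ) + j - (m - 1))
        + ∑ j : Fin m, ((σ j : ℤ) + j - (m - 1)) ^ 2 := by
    rw [Finset.mul_sum]
    have : (m : ℤ) * (K + (m - 1)) ^ 2 = ∑ j : Fin m, ((K : ℤ) + (m - 1)) ^ 2 := by simp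
    rw [this, ← Finset.sum_add_distrib, ← Finset.sum_add_distrib]
    exact Finset.sum_congr rfl fun j _ => by ring
  rw [Nat.cast_sub hm]
  push_cast
  rw [h3, h1]
  linarith

/-- In each of the chosen determinants the antidiagonal consists of entries of one weight, equal
modulo `A` to a single `y q`. The filtration weights `K - wt²` are strictly concave in `wt`, so the
antidiagonal product strictly dominates the others by `sum_sq_lt`. The vanishing of the determinant
therefore expresses `y q ^ m` by terms of lower filtration weight. Hence `D` is integral over `A`,
which has `n + 1` generators fewer than `W` has elements. -/
theorem ringKrullDim_add_le_of_hankel {D W : Type} [CommRing D] [Algebra ℝ D] [Finite W]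
    {U : W → D} (hU : Algebra.adjoin ℝ (Set.range U) = ⊤) {n m r : ℕ} (hn : 1 ≤ n) (hm : 1 ≤ m)
    (hr : 1 ≤ r) (c : Fin m → Fin (m + 1) → Fin n → W) (wt : W → ℕ)
    (hwt : ∀ a α i, wt (c a α i) = a + α + r * i)
    (hdet : ∀ (i : Fin n) (e : Fin m → Fin (m + 1)),
      (Matrix.of fun a j => U (c a (e j) i)).det = 0) :
    ringKrullDim D + (n + 1 : ℕ) ≤ (Nat.card W : WithBot ℕ∞) := by
  classical
  let z : Fin m := ⟨m - 1, by omega⟩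
  -- One distinguished entry for each of `n + 1` weights: `m - 1`, from the first `m` columns at the
  -- first covector, and `m + r i`, from the last `m` columns at the covector `i`.
  let v : Option (Fin n) → W := fun q => q.elim (c z 0 ⟨0, hn⟩) fun i => c z ⟨1, by omega⟩ i
  let wq : Option (Fin n) → ℕ := fun q => wt (v q)
  have hwq0 : wq none = m - 1 := by simp [wq, v, hwt, z]
  have hwq1 : ∀ i : Fin n, wq (some i) = m + r * i := by
    intro i
    simp only [wq, v, Option.elim_some, hwt, z]
    omega
  have hwqi : Function.Injective wq := by
    rintro (_ | i) (_ | j) h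
    · rfl
    · rw [hwq0, hwq1] at h; omega
    · rw [hwq0, hwq1] at h; omega
    · rw [hwq1, hwq1] at h
      have h1 : r * (i : ℕ) = r * j := by omega
      rw [Fin.ext (Nat.eq_of_mul_eq_mul_left hr h1)]
  have hvi : Function.Injective v := fun p q h => hwqi (by simp only [wq, h])
  let y : Option (Fin n) → D := fun q => U (v q)
  let K : ℕ := (r * n + 2 * m) ^ 2 + 1
  let ν : Option (Fin n) → ℕ := fun q => K - wq q ^ 2
  let ℓ : W → D := fun w => U w - ∑ q, if wt w = wq q then y q else 0
  have hℓ1 : ∀ w q, wt w = wq q → ℓ w = U w - y q := by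
    intro w q h
    simp only [ℓ]
    rw [Finset.sum_eq_single q, if_pos h]
    · intro p _ hp
      rw [if_neg fun h' => hp (hwqi (h'.symm.trans h))]
    · simp
  have hℓ2 : ∀ w, (∀ q, wt w ≠ wq q) → ℓ w = U w := by
    intro w h
    simp only [ℓ]
    rw [Finset.sum_eq_zero fun q _ => if_neg (h q), sub_zero]
  let G := {w : W // w ∉ Set.range v}
  let A : Subalgebra ℝ D := (aeval fun w : G => ℓ w.1 : MvPolynomial G ℝ →ₐ[ℝ] D).range
  have hℓA : ∀ w, ℓ w ∈ A := by
    intro w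
    by_cases hw : w ∈ Set.range v
    · obtain ⟨q, rfl⟩ := hw
      rw [hℓ1 _ q rfl, sub_self]
      exact zero_mem _
    · exact ⟨X ⟨w, hw⟩, aeval_X _ _⟩
  have hwle : ∀ q, wq q ^ 2 + 1 ≤ K := by
    intro q
    refine Nat.succ_le_succ (Nat.pow_le_pow_left ?_ 2)
    rcases q with _ | i
    · rw [hwq0]; omega
    · rw [hwq1]
      have : r * (i : ℕ) ≤ r * n := Nat.mul_le_mul_left _ i.2.le
      omega
  have hUfil : ∀ w, U w ∈ fil A y ν (K - wt w ^ 2 + 1) := by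
    intro w
    by_cases hw : ∃ q, wt w = wq q
    · obtain ⟨q, hq⟩ := hw
      have h1 : U w = algebraMap A D ⟨ℓ w, hℓA w⟩ + y q := by
        change U w = ℓ w + y q
        rw [hℓ1 w q hq]; ring
      rw [h1]
      refine add_mem (algebraMap_mem_fil _ (by omega)) ?_
      have := pow_mem_fil (A := A) (y := y) (ν := ν) q 1 (N := K - wt w ^ 2 + 1)
        (by rw [hq]; simp [ν])
      simpa using this
    · push Not at hw
      have h1 : U w = algebraMap A D ⟨ℓ w, hℓA w⟩ := (hℓ2 w hw).symm
      rw [h1]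
      exact algebraMap_mem_fil _ (by omega)
  have key : ∀ (q : Option (Fin n)) (i : Fin n) (d : ℕ) (e : Fin m → Fin (m + 1)), d ≤ 1 →
      (∀ j, (e j : ℕ) = j + d) → wq q = r * i + d + (m - 1) → y q ^ m ∈ fil A y ν (m * ν q) := by
    intro q i d e hd he hq
    have h1 := hdet i e
    rw [Matrix.det_apply,
      ← Finset.add_sum_erase _ _ (Finset.mem_univ (Fin.revPerm : Equiv.Perm (Fin m)))]
      at h1
    have h2 : ∑ σ ∈ Finset.univ.erase (Fin.revPerm : Equiv.Perm (Fin m)), Equiv.Perm.sign σ •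
        ∏ j, (Matrix.of fun a j => U (c a (e j) i)) (σ j) j ∈ fil A y ν (m * ν q) := by
      refine sum_mem fun σ hσ => ?_
      rw [Units.smul_def]
      refine zsmul_mem ?_ _
      have h3 := prod_mem_fil (A := A) (y := y) (ν := ν) Finset.univ
        (fun j => U (c (σ j) (e j) i)) _ (fun j _ => hUfil _)
      refine fil_mono ?_ h3
      have h4 := sum_sq_lt (r * i + d) σ (Finset.ne_of_mem_erase hσ)
      have h5 : ∀ j : Fin m, wt (c (σ j) (e j) i) = r * i + d + (σ j + j) := fun j => by
        rw [hwt, he]; ring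
      simp only [h5, ν, hq]
      -- The subtractions in the filtration weights are not truncated.
      have h6 : ∀ j : Fin m, (r * i + d + (σ j + j : ℕ)) ^ 2 ≤ K := fun j => by
        refine le_trans (Nat.pow_le_pow_left ?_ 2) (Nat.le_succ _)
        have : r * (i + 1 : ℕ) ≤ r * n := Nat.mul_le_mul_left _ i.2
        have h7 := (σ j).2
        have h8 := j.2
        rw [mul_add] at this
        omega
      have h7 : ∑ j : Fin m, (K - (r * i + d + (σ j + j : ℕ)) ^ 2)
          + ∑ j : Fin m, (r * i + d + (σ j + j : ℕ)) ^ 2 = m * K := by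
        rw [← Finset.sum_add_distrib, Finset.sum_congr rfl fun j _ => Nat.sub_add_cancel (h6 j)]
        simp
      have h8 : m * (K - (r * i + d + (m - 1)) ^ 2) + m * (r * i + d + (m - 1)) ^ 2 = m * K := by
        rw [← mul_add, Nat.sub_add_cancel]
        have := hwle q
        rw [hq] at this
        omega
      omega
    have h3 : Equiv.Perm.sign (Fin.revPerm : Equiv.Perm (Fin m)) •
        ∏ j, (Matrix.of fun a j => U (c a (e j) i)) ((Fin.revPerm : Equiv.Perm (Fin m)) j) j
        ∈ fil A y ν (m * ν q) := by
      rw [eq_neg_of_add_eq_zero_left h1]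
      exact neg_mem h2
    have h4 : ∏ j, U (c (Fin.rev j) (e j) i) ∈ fil A y ν (m * ν q) := by
      rcases Int.units_eq_one_or (Equiv.Perm.sign (Fin.revPerm : Equiv.Perm (Fin m))) with h | h
      · rw [h, one_smul] at h3; exact h3
      · rw [h, Units.neg_smul, one_smul, neg_mem_iff] at h3; exact h3
    have h5 := prod_sub_pow_mem_fil (A := A) (y := y) (ν := ν) (Finset.univ : Finset (Fin m))
      (fun j => U (c (Fin.rev j) (e j) i)) q (by have := hwle q; simp only [ν]; omega) (by
        intro j _
        refine ⟨⟨ℓ (c (Fin.rev j) (e j) i), hℓA _⟩, ?_⟩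
        change _ = ℓ _ + y q
        rw [hℓ1 _ q]
        · ring
        · rw [hwt, hq, he, Fin.val_rev]
          have := j.2
          omega)
    rw [Finset.card_univ, Fintype.card_fin] at h5
    have h6 := sub_mem h4 h5
    rwa [sub_sub_cancel] at h6
  have hpow : ∀ q, y q ^ m ∈ fil A y ν (m * ν q) := by
    rintro (_ | i)
    · exact key none ⟨0, hn⟩ 0 Fin.castSucc (by omega) (fun j => by simp) (by rw [hwq0]; simp)
    · refine key (some i) i 1 Fin.succ le_rfl (fun j => by simp) ?_
      rw [hwq1]; omega
  have hint : Algebra.IsIntegral A D := isIntegral_of_fil (R := ℝ) (S := Set.range U)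
    (by rintro _ ⟨w, rfl⟩; exact ⟨_, hUfil w⟩) hU hpow
  have h1 : ringKrullDim D ≤ (Nat.card G : WithBot ℕ∞) := by
    refine (ringKrullDim_le_of_isIntegral (A := A)).trans ?_
    have h2 := ringKrullDim_le_of_surjective
      (aeval fun w : G => ℓ w.1 : MvPolynomial G ℝ →ₐ[ℝ] D).rangeRestrict.toRingHom
      (AlgHom.rangeRestrict_surjective _)
    refine h2.trans ?_
    rw [MvPolynomial.ringKrullDim_of_isNoetherianRing, ringKrullDim_eq_zero_of_field, zero_add]
  have h2 : Nat.card W = Nat.card G + (n + 1) := by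
    have h3 : Nat.card W = Nat.card (Set.range v) + Nat.card G := by
      rw [← Nat.card_sum]
      exact Nat.card_congr (Equiv.sumCompl fun w => w ∈ Set.range v).symm
    rw [h3, Nat.card_range_of_injective hvi]
    simp
    ring
  rw [h2]
  push_cast
  gcongr

end Hankel


open MvPolynomial

/-! ### Codimension of the zeros of the multipliers -/

section Codim

/-- For the smallest prime `P` of a chain above `𝔞`, the length is at most the coheight of `P`.
Either the dimension of the quotient by `P` bounds it directly, or height plus coheight is at most
the dimension of `R`. -/
lemma ringKrullDim_quotient_add_le {R : Type} [CommRing R] {𝔞 : Ideal R} {h N : ℕ}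
    (hR : ringKrullDim R = (N : WithBot ℕ∞))
    (H : ∀ P : Ideal R, P.IsPrime → 𝔞 ≤ P →
      ringKrullDim (R ⧸ P) + h ≤ (N : WithBot ℕ∞) ∨ (h : ℕ∞) ≤ P.height) :
    ringKrullDim (R ⧸ 𝔞) + h ≤ (N : WithBot ℕ∞) := by
  have key : ∀ p : LTSeries (PrimeSpectrum.zeroLocus (R := R) 𝔞), p.length + h ≤ N := by
    intro p
    let P := p.head.1
    let p' : LTSeries (PrimeSpectrum R) := p.map Subtype.val fun _ _ h => h
    have hhead : p'.head = P := rfl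
    rcases H P.asIdeal P.2 p.head.2 with h1 | h1
    · let p'' : LTSeries (PrimeSpectrum.zeroLocus (R := R) P.asIdeal) :=
        { length := p.length
          toFun := fun i => ⟨(p i).1, fun x hx => p.head_le i hx⟩
          step := fun i => p.step i }
      have h2 : (p.length : WithBot ℕ∞) ≤ ringKrullDim (R ⧸ P.asIdeal) := by
        rw [ringKrullDim_quotient]
        exact Order.LTSeries.length_le_krullDim p''
      have h3 : (p.length : WithBot ℕ∞) + h ≤ N := le_trans (by gcongr) h1
      exact_mod_cast h3
    · have h2 : (p.length : ℕ∞) ≤ Order.coheight P := Order.length_le_coheight_head (p := p')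
      have : Nonempty (PrimeSpectrum R) := ⟨P⟩
      have h3 : ((Order.height P + Order.coheight P : ℕ∞) : WithBot ℕ∞) ≤ ringKrullDim R := by
        rw [ringKrullDim, Order.krullDim_eq_iSup_height_add_coheight_of_nonempty]
        exact WithBot.coe_le_coe.mpr (le_iSup (fun a => Order.height a + Order.coheight a) P)
      have h4 : (h : ℕ∞) ≤ Order.height P := by
        rwa [PrimeSpectrum.height_eq_orderHeight] at h1
      rw [hR] at h3
      have h5 : Order.height P + Order.coheight P ≤ (N : ℕ∞) := by exact_mod_cast h3
      have h6 := (add_le_add h4 h2).trans h5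
      have h7 : h + p.length ≤ N := by exact_mod_cast h6
      omega
  by_cases hN : h ≤ N
  · have h1 : ringKrullDim (R ⧸ 𝔞) ≤ ((N - h : ℕ) : WithBot ℕ∞) := by
      rw [ringKrullDim_quotient, Order.krullDim]
      refine iSup_le fun p => ?_
      have := key p
      exact_mod_cast (by omega : p.length ≤ N - h)
    calc ringKrullDim (R ⧸ 𝔞) + h ≤ ((N - h : ℕ) : WithBot ℕ∞) + h := by gcongr
      _ = N := by rw [← Nat.cast_add, Nat.sub_add_cancel hN]
  · have : IsEmpty (PrimeSpectrum.zeroLocus (R := R) 𝔞) := by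
      refine ⟨fun x => hN ?_⟩
      have := key (RelSeries.singleton _ x)
      simpa using le_trans (Nat.le_add_left _ _) this
    rw [ringKrullDim_quotient, Order.krullDim_eq_bot]
    simp

variable {n m r : ℕ} {C : Type} {cls : Fin m → Fin (m + 1) → Tup n r → C}

/-- Primes over the low order multipliers either have height at least `n + 1` or contain all symbol
minors; in the second case the minors at the basis covectors suffice for the bound by weights. -/
theorem exists_level_dim [Finite C] (hm : 1 ≤ m) (hr : 1 ≤ r)
    (hinj : ∀ a α a' α' β, cls a α (nilTup n r) = cls a' α' β → a = a' ∧ α = α' ∧ β = nilTup n r)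
    (wt : C → ℕ) (hwt : ∀ a α (β : Fin r → Fin n),
      wt (cls a α ⟨Fin.last r, β⟩) = a + α + ∑ i, (β i : ℕ)) :
    ∃ t, ∀ (W : Type) [Finite W] (i : W → C × Multiset (Fin n)), Function.Injective i →
      lowVars C n t ⊆ Set.range i → ∀ 𝔞 : Ideal (MvPolynomial W ℝ),
      ContainsLow i t (multIdeal cls) 𝔞 →
        ringKrullDim (MvPolynomial W ℝ ⧸ 𝔞) + (n + 1 : ℕ) ≤ (Nat.card W : WithBot ℕ∞) := by
  have h0 : multIdeal cls ≠ ⊥ := multIdeal_ne_bot cls hm hinj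
  have hdim : ∀ (W : Type) [Finite W], ringKrullDim (MvPolynomial W ℝ) = (Nat.card W : WithBot ℕ∞) :=
    fun W _ => by
      rw [MvPolynomial.ringKrullDim_of_isNoetherianRing, ringKrullDim_eq_zero_of_field, zero_add]
  -- Without covectors a single nonzero multiplier gives codimension one, which is `n + 1`.
  rcases Nat.eq_zero_or_pos n with hn | hn
  · obtain ⟨d, hd, hd0⟩ := Submodule.exists_mem_ne_zero_of_ne_bot h0
    obtain ⟨t, ht⟩ := exists_mem_supported_lowVars d
    refine ⟨t, fun W _ i hi hW 𝔞 h𝔞 => ringKrullDim_quotient_add_le (hdim W) fun P hP hle => ?_⟩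
    right
    obtain ⟨d', hd'⟩ := exists_rename_eq_of_mem_supported (supported_mono hW ht)
    have h1 : d' ∈ P := hle (h𝔞 d' (by rw [hd']; exact hd) (by rw [hd']; exact ht))
    have h2 : ⊥ < P := bot_lt_iff_ne_bot.mpr fun h => hd0 (by
      rw [h, Ideal.mem_bot] at h1
      rw [← hd', h1, map_zero])
    have h3 := Ideal.height_add_one_le_of_lt_of_isPrime h2
    subst hn
    exact le_trans (by simp) h3
  · obtain ⟨t, ht⟩ := exists_level_of_height h0 (n + 1)
    refine ⟨t, fun W _ i hi hW 𝔞 h𝔞 => ringKrullDim_quotient_add_le (hdim W) fun P hP hle => ?_⟩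
    rcases ht W i hi hW P hP fun f hf hf' => hle (h𝔞 f hf hf') with h | h
    · left
      have hW0 : lowVars C n 0 ⊆ Set.range i := (lowVars_mono (Nat.zero_le t)).trans hW
      have hsec : ∀ c : C, ∃ w, i w = (c, 0) := fun c => hW0 (by simp [lowVars])
      choose sec hsec using hsec
      have hren : ∀ (x : Fin n → ℝ) (e : Fin m → Fin (m + 1)),
          rename i (symbMinor cls (fun c => X (sec c)) (fun j => MvPolynomial.C (x j)) e)
          = symbMinor cls u0 (fun j => MvPolynomial.C (x j)) e := by
        intro x e
        have := map_symbMinor (cls := cls) (rename i : MvPolynomial W ℝ →ₐ[ℝ] JetRing C n).toRingHom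
          (fun c => X (sec c)) (fun j => MvPolynomial.C (x j)) e
        refine this.trans ?_
        congr 1
        · funext c
          simp [u0, hsec]
        · funext j
          simp
      have hmin : ∀ (x : Fin n → ℝ) (e : Fin m → Fin (m + 1)),
          symbMinor cls (fun c => X (sec c)) (fun j => MvPolynomial.C (x j)) e ∈ P := fun x e =>
        h _ (by rw [hren]; exact ⟨x, e, rfl⟩) (by rw [hren]; exact symbMinor_mem_supported x e)
      let U : W → MvPolynomial W ℝ ⧸ P := fun w => Ideal.Quotient.mk P (X w)
      have hU : Algebra.adjoin ℝ (Set.range U) = ⊤ := by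
        have h1 := congrArg (Subalgebra.map (Ideal.Quotient.mkₐ ℝ P)) (adjoin_range_X (R := ℝ) (σ := W))
        rw [AlgHom.map_adjoin, ← Set.range_comp, Algebra.map_top,
          (AlgHom.range_eq_top _).mpr (Ideal.Quotient.mkₐ_surjective ℝ P)] at h1
        exact h1
      refine ringKrullDim_add_le_of_hankel hU hn hm hr
        (fun a α j => sec (cls a α ⟨Fin.last r, fun _ => j⟩)) (fun w => wt (i w).1) ?_ ?_
      · intro a α j
        simp [hsec, hwt]
      · intro j e
        have h1 := hmin (Pi.single j 1) e
        rw [← Ideal.Quotient.eq_zero_iff_mem, symbMinor, RingHom.map_det] at h1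
        rw [← h1]
        congr 1
        ext a b
        simp only [Matrix.of_apply, RingHom.mapMatrix_apply, Matrix.map_apply, U]
        congr 1
        rw [symb, Finset.sum_eq_single fun _ => j]
        · simp
        · intro β _ hβ
          obtain ⟨k, hk⟩ : ∃ k, β k ≠ j := by
            by_contra! hcon
            exact hβ (funext hcon)
          rw [Finset.prod_eq_zero (Finset.mem_univ k), mul_zero]
          simp [hk]
        · simp
    · right
      exact h

end Codim


/-! ### Iterated partial derivatives of smooth functions -/

section Partial

variable {n : ℕ}

/-- The `i`-th vector of the standard basis. -/
noncomputable abbrev bvec (i : Fin n) : E n := EuclideanSpace.single i (1 : ℝ)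

/-- The `i`-th partial derivative. -/
noncomputable def pds (i : Fin n) (f : E n → ℝ) : E n → ℝ := fun y => fderiv ℝ f y (bvec i)

/-- Iterated partial derivatives. -/
noncomputable def pdl (w : List (Fin n)) (f : E n → ℝ) : E n → ℝ := w.foldr pds f

@[simp] lemma pdl_nil (f : E n → ℝ) : pdl [] f = f := rfl

@[simp] lemma pdl_cons (i : Fin n) (w : List (Fin n)) (f : E n → ℝ) :
    pdl (i :: w) f = pds i (pdl w f) := rfl

lemma pdl_append (w w' : List (Fin n)) (f : E n → ℝ) : pdl (w ++ w') f = pdl w (pdl w' f) :=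
  List.foldr_append

variable {V : Set (E n)} {f g : E n → ℝ}

lemma smooth_differentiableAt (hV : IsOpen V) (hf : ContDiffOn ℝ ∞ f V) {y : E n} (hy : y ∈ V) :
    DifferentiableAt ℝ f y :=
  (hf.contDiffAt (hV.mem_nhds hy)).differentiableAt (by simp)

lemma smooth_pds (hV : IsOpen V) (i : Fin n) (hf : ContDiffOn ℝ ∞ f V) :
    ContDiffOn ℝ ∞ (pds i f) V :=
  (hf.fderiv_of_isOpen hV (m := ∞) (by simp)).clm_apply contDiffOn_const

lemma smooth_pdl (hV : IsOpen V) (w : List (Fin n)) (hf : ContDiffOn ℝ ∞ f V) :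
    ContDiffOn ℝ ∞ (pdl w f) V := by
  induction w with
  | nil => exact hf
  | cons i w ih => exact smooth_pds hV i ih

lemma pds_congr (hV : IsOpen V) (i : Fin n) (h : Set.EqOn f g V) :
    Set.EqOn (pds i f) (pds i g) V := fun y hy => by
  rw [pds, pds, (h.eventuallyEq_of_mem (hV.mem_nhds hy)).fderiv_eq]

lemma pdl_congr (hV : IsOpen V) (w : List (Fin n)) (h : Set.EqOn f g V) :
    Set.EqOn (pdl w f) (pdl w g) V := by
  induction w with
  | nil => exact h
  | cons i w ih => exact pds_congr hV i ih

lemma pds_add (hV : IsOpen V) (i : Fin n) (hf : ContDiffOn ℝ ∞ f V) (hg : ContDiffOn ℝ ∞ g V) :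
    Set.EqOn (pds i fun y => f y + g y) (fun y => pds i f y + pds i g y) V := fun y hy => by
  simp only [pds]
  rw [fderiv_fun_add (smooth_differentiableAt hV hf hy) (smooth_differentiableAt hV hg hy)]
  rfl

lemma pds_mul (hV : IsOpen V) (i : Fin n) (hf : ContDiffOn ℝ ∞ f V) (hg : ContDiffOn ℝ ∞ g V) :
    Set.EqOn (pds i fun y => f y * g y) (fun y => pds i f y * g y + f y * pds i g y) V :=
  fun y hy => by
  simp only [pds]
  rw [fderiv_fun_mul (smooth_differentiableAt hV hf hy) (smooth_differentiableAt hV hg hy)]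
  simp only [add_apply, smul_apply, smul_eq_mul]
  ring

lemma pds_sum {ι : Type*} (hV : IsOpen V) (i : Fin n) (s : Finset ι) {F : ι → E n → ℝ}
    (hF : ∀ k ∈ s, ContDiffOn ℝ ∞ (F k) V) :
    Set.EqOn (pds i fun y => ∑ k ∈ s, F k y) (fun y => ∑ k ∈ s, pds i (F k) y) V := fun y hy => by
  simp only [pds]
  rw [fderiv_fun_sum fun k hk => smooth_differentiableAt hV (hF k hk) hy]
  simp

lemma pdl_sum {ι : Type*} (hV : IsOpen V) (w : List (Fin n)) (s : Finset ι) {F : ι → E n → ℝ}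
    (hF : ∀ k ∈ s, ContDiffOn ℝ ∞ (F k) V) :
    Set.EqOn (pdl w fun y => ∑ k ∈ s, F k y) (fun y => ∑ k ∈ s, pdl w (F k) y) V := by
  induction w with
  | nil => exact fun y _ => rfl
  | cons i w ih =>
    exact (pds_congr hV i ih).trans (pds_sum hV i s fun k hk => smooth_pdl hV w (hF k hk))

lemma pds_const (i : Fin n) (c : ℝ) : pds i (fun _ => c) = fun _ => 0 := by
  funext y; simp [pds]

lemma pds_const_mul (hV : IsOpen V) (i : Fin n) (c : ℝ) (hf : ContDiffOn ℝ ∞ f V) :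
    Set.EqOn (pds i fun y => c * f y) (fun y => c * pds i f y) V := fun y hy => by
  have := pds_mul hV i contDiffOn_const hf hy (f := fun _ => c)
  simpa [pds_const] using this

lemma pdl_const_mul (hV : IsOpen V) (w : List (Fin n)) (c : ℝ) (hf : ContDiffOn ℝ ∞ f V) :
    Set.EqOn (pdl w fun y => c * f y) (fun y => c * pdl w f y) V := by
  induction w with
  | nil => exact fun y _ => rfl
  | cons i w ih => exact (pds_congr hV i ih).trans (pds_const_mul hV i c (smooth_pdl hV w hf))

lemma pds_comm (hV : IsOpen V) (i j : Fin n) (hf : ContDiffOn ℝ ∞ f V) :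
    Set.EqOn (pds i (pds j f)) (pds j (pds i f)) V := fun y hy => by
  have h1 : ContDiffAt ℝ ∞ f y := hf.contDiffAt (hV.mem_nhds hy)
  have h2 : DifferentiableAt ℝ (fderiv ℝ f) y :=
    (h1.fderiv_right (m := ∞) (by simp)).differentiableAt (by simp)
  have h3 : IsSymmSndFDerivAt ℝ f y := h1.isSymmSndFDerivAt (by
    rw [minSmoothness_of_isRCLikeNormedField]; exact WithTop.coe_le_coe.mpr le_top)
  have h4 : ∀ v : E n, fderiv ℝ (fun z => fderiv ℝ f z v) y = (fderiv ℝ (fderiv ℝ f) y).flip v := by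
    intro v
    rw [fderiv_clm_apply h2 (differentiableAt_const v)]
    ext x
    simp
  change fderiv ℝ (fun z => fderiv ℝ f z (bvec j)) y (bvec i)
    = fderiv ℝ (fun z => fderiv ℝ f z (bvec i)) y (bvec j)
  rw [h4, h4]
  exact h3 _ _

lemma pdl_perm (hV : IsOpen V) {w w' : List (Fin n)} (h : w.Perm w') (hf : ContDiffOn ℝ ∞ f V) :
    Set.EqOn (pdl w f) (pdl w' f) V := by
  induction h with
  | nil => exact fun y _ => rfl
  | cons i _ ih => exact pds_congr hV i ih
  | swap i j w => exact pds_comm hV _ _ (smooth_pdl hV w hf)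
  | trans _ _ ih ih' => exact ih.trans ih'

lemma pd_eq_pdl (hV : IsOpen V) (hf : ContDiffOn ℝ ∞ f V) {j : ℕ} (β : Fin j → Fin n) {y : E n}
    (hy : y ∈ V) : pd β f y = pdl (List.ofFn β) f y := by
  induction j generalizing y with
  | zero => simp [pd]
  | succ j ih =>
    have h1 : ContDiffAt ℝ ∞ f y := hf.contDiffAt (hV.mem_nhds hy)
    have h2 : DifferentiableAt ℝ (iteratedFDeriv ℝ j f) y :=
      h1.differentiableAt_iteratedFDeriv (by exact_mod_cast ENat.natCast_lt_top j)
    have h3 : pd (fun i => β i.succ) f =ᶠ[nhds y] pdl (List.ofFn fun i => β i.succ) f :=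
      Filter.eventuallyEq_of_mem (hV.mem_nhds hy) fun z hz => ih _ hz
    rw [List.ofFn_succ, pdl_cons, pds, ← h3.fderiv_eq, pd, iteratedFDeriv_succ_apply_left]
    have h4 : fderiv ℝ (pd (fun i => β i.succ) f) y
        = (ContinuousMultilinearMap.apply ℝ (fun _ : Fin j => E n) ℝ
          (fun i => bvec (β i.succ))).comp (fderiv ℝ (iteratedFDeriv ℝ j f) y) :=
      ((ContinuousMultilinearMap.apply ℝ (fun _ : Fin j => E n) ℝ
        (fun i => bvec (β i.succ))).hasFDerivAt.comp y h2.hasFDerivAt).fderiv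
    rw [h4]
    rfl

lemma smooth_pd (hV : IsOpen V) (hf : ContDiffOn ℝ ∞ f V) {j : ℕ} (β : Fin j → Fin n) :
    ContDiffOn ℝ ∞ (pd β f) V :=
  (smooth_pdl hV _ hf).congr fun _ hy => pd_eq_pdl hV hf β hy

lemma pd_comp_perm (hV : IsOpen V) (hf : ContDiffOn ℝ ∞ f V) {j : ℕ} (β : Fin j → Fin n)
    (σ : Equiv.Perm (Fin j)) {y : E n} (hy : y ∈ V) : pd (β ∘ σ) f y = pd β f y := by
  rw [pd_eq_pdl hV hf _ hy, pd_eq_pdl hV hf _ hy]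
  exact pdl_perm hV (Equiv.Perm.ofFn_comp_perm σ β) hf hy

end Partial

/-! ### Evaluation of differential polynomials at functions -/

section Evaluation

open MvPolynomial

variable {n : ℕ} {A : Type} {V : Set (E n)} {u : A → E n → ℝ}

/-- Evaluation of a polynomial in formal derivatives at the derivatives of given functions. -/
noncomputable def ev (u : A → E n → ℝ) (y : E n) : JetRing A n →ₐ[ℝ] ℝ :=
  aeval fun v => pdl v.2.toList (u v.1) y

lemma ev_X (u : A → E n → ℝ) (y : E n) (v : A × Multiset (Fin n)) :
    ev u y (X v) = pdl v.2.toList (u v.1) y := aeval_X _ _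

lemma smooth_ev (hV : IsOpen V) (hu : ∀ a, ContDiffOn ℝ ∞ (u a) V) (p : JetRing A n) :
    ContDiffOn ℝ ∞ (fun y => ev u y p) V := by
  induction p using MvPolynomial.induction_on with
  | C t =>
    simp only [← algebraMap_eq, AlgHom.commutes]
    exact contDiffOn_const
  | add p q hp hq => simp only [map_add]; exact hp.add hq
  | mul_X p v hp =>
    simp only [map_mul, ev_X]
    exact hp.mul (smooth_pdl hV _ (hu _))

lemma pds_ev (hV : IsOpen V) (hu : ∀ a, ContDiffOn ℝ ∞ (u a) V) (i : Fin n) (p : JetRing A n) :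
    Set.EqOn (pds i fun y => ev u y p) (fun y => ev u y (jd i p)) V := by
  induction p using MvPolynomial.induction_on with
  | C t =>
    intro y _
    simp only [← algebraMap_eq, AlgHom.commutes, pds_const, Derivation.map_algebraMap, map_zero]
  | add p q hp hq =>
    intro y hy
    simp only [map_add]
    rw [pds_add hV i (smooth_ev hV hu p) (smooth_ev hV hu q) hy]
    simp only [hp hy, hq hy]
  | mul_X p v hp =>
    intro y hy
    simp only [map_mul, ev_X]
    rw [pds_mul hV i (smooth_ev hV hu p) (smooth_pdl hV _ (hu _)) hy]
    simp only [hp hy, Derivation.leibniz, map_add, smul_eq_mul, map_mul, jd_X, ev_X]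
    have : pds i (pdl v.2.toList (u v.1)) y = pdl (i ::ₘ v.2).toList (u v.1) y := by
      refine pdl_perm hV ?_ (hu _) hy (w := i :: v.2.toList)
      rw [← Multiset.coe_eq_coe, ← Multiset.cons_coe, Multiset.coe_toList, Multiset.coe_toList]
    rw [this]
    ring

lemma pdl_ev (hV : IsOpen V) (hu : ∀ a, ContDiffOn ℝ ∞ (u a) V) (w : List (Fin n))
    (p : JetRing A n) : Set.EqOn (pdl w fun y => ev u y p) (fun y => ev u y (jdl w p)) V := by
  induction w with
  | nil => exact fun y _ => rfl
  | cons i w ih => exact (pds_congr hV i ih).trans (pds_ev hV hu i _)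

end Evaluation


/-! ### Monomials as test functions at a point -/

section Taylor

variable {n : ℕ}

/-- The monomial `∏ᵢ (y - z)_{γᵢ}`. -/
noncomputable def tens {j : ℕ} (γ : Fin j → Fin n) (z y : E n) : ℝ := ∏ i, (y (γ i) - z (γ i))

lemma smooth_tens {j : ℕ} (γ : Fin j → Fin n) (z : E n) : ContDiff ℝ ∞ (tens γ z) := by
  unfold tens
  fun_prop

lemma tens_comp_perm {j : ℕ} (γ : Fin j → Fin n) (π : Equiv.Perm (Fin j)) :
    tens (γ ∘ π) = tens γ := by
  funext z y
  exact Equiv.prod_comp π fun i => y (γ i) - z (γ i)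

/-- The multilinear form whose restriction to the diagonal is a monomial. -/
noncomputable def tensForm {j : ℕ} (γ : Fin j → Fin n) : (E n)[×j]→L[ℝ] ℝ :=
  (ContinuousMultilinearMap.mkPiAlgebra ℝ (Fin j) ℝ).compContinuousLinearMap
    fun i => EuclideanSpace.proj (γ i)

lemma tensForm_apply {j : ℕ} (γ : Fin j → Fin n) (v : Fin j → E n) :
    tensForm γ v = ∏ i, v i (γ i) := by
  simp [tensForm]

lemma pd_tens_eq {i j : ℕ} (β : Fin i → Fin n) (γ : Fin j → Fin n) (z : E n) :
    pd β (tens γ z) z = iteratedFDeriv ℝ i (fun y => tensForm γ fun _ => y) 0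
      fun k => bvec (β k) := by
  have h : tens γ z = fun y => (fun y => tensForm γ fun _ => y) (y - z) := by
    funext y
    simp [tensForm_apply, tens]
  rw [pd, h, iteratedFDeriv_comp_sub (f := fun y => tensForm γ fun _ => y), sub_self]

lemma pd_tens {j : ℕ} (β γ : Fin j → Fin n) (z : E n) :
    pd β (tens γ z) z = ∑ σ : Equiv.Perm (Fin j), if γ = β ∘ σ then (1 : ℝ) else 0 := by
  rw [pd_tens_eq, ContinuousMultilinearMap.iteratedFDeriv_comp_diagonal]
  refine Finset.sum_congr rfl fun σ _ => ?_
  rw [tensForm_apply]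
  split_ifs with h
  · subst h
    simp
  · obtain ⟨k, hk⟩ := Function.ne_iff.1 h
    exact Finset.prod_eq_zero (Finset.mem_univ k) (by simpa using hk)

/-- Scaling the argument by `2` multiplies the derivative of order `i` at the origin of a form of
degree `j` both by `2^j` and by `2^i`. -/
lemma pd_tens_of_ne {i j : ℕ} (hij : i ≠ j) (β : Fin i → Fin n) (γ : Fin j → Fin n) (z : E n) :
    pd β (tens γ z) z = 0 := by
  rw [pd_tens_eq]
  set F : E n → ℝ := fun y => tensForm γ fun _ => y with hF
  have hs : ContDiff ℝ ∞ F :=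
    (tensForm γ).contDiff.comp (contDiff_pi.2 fun _ => contDiff_id)
  have h1 : F ∘ ((2 : ℝ) • ContinuousLinearMap.id ℝ (E n)) = fun y => (2 : ℝ) ^ j • F y := by
    funext y
    have := (tensForm γ).map_smul_univ (fun _ => (2 : ℝ)) fun _ => y
    simpa [hF] using this
  have h2 := ContinuousLinearMap.iteratedFDeriv_comp_right
    ((2 : ℝ) • ContinuousLinearMap.id ℝ (E n)) hs 0 (i := i) (by exact_mod_cast le_top)
  rw [h1, iteratedFDeriv_const_smul_apply'
    (hs.contDiffAt.of_le (by exact_mod_cast le_top))] at h2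
  have h3 := congrArg (fun G => G fun k => bvec (β k)) h2
  simp only [smul_apply, map_zero, ContinuousMultilinearMap.compContinuousLinearMap_apply,
    ContinuousLinearMap.id_apply] at h3
  rw [(iteratedFDeriv ℝ i F 0).map_smul_univ (fun _ => (2 : ℝ))] at h3
  simp only [Finset.prod_const, Finset.card_univ, Fintype.card_fin, smul_eq_mul] at h3
  have h4 : (2 : ℝ) ^ j ≠ 2 ^ i := fun h =>
    hij (Nat.pow_right_injective le_rfl (by exact_mod_cast h)).symm
  exact (mul_eq_mul_right_iff.1 h3).resolve_left h4

lemma pd_tens_translate {i j : ℕ} (β : Fin i → Fin n) (γ : Fin j → Fin n) (z z' : E n) :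
    pd β (tens γ z) z = pd β (tens γ z') z' := by
  rw [pd_tens_eq, pd_tens_eq]

lemma pd_tens_comm {i j : ℕ} (β : Fin i → Fin n) (γ : Fin j → Fin n) (z : E n) :
    pd β (tens γ z) z = pd γ (tens β z) z := by
  rcases ne_or_eq i j with h | h
  · rw [pd_tens_of_ne h, pd_tens_of_ne h.symm]
  · subst h
    rw [pd_tens, pd_tens, ← Equiv.sum_comp (Equiv.inv _)]
    refine Finset.sum_congr rfl fun σ _ => if_congr ⟨?_, ?_⟩ rfl rfl
    · rintro rfl; funext k; simp
    · rintro rfl; funext k; simp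

/-- The inverse factorial of the order. -/
noncomputable def facInv {k : ℕ} (γ : Tup n k) : ℝ := ((γ.1 : ℕ).factorial : ℝ)⁻¹

/-- Sums run over ordered tuples, so a monomial picks out a symmetric coefficient once for each
permutation of its indices; `facInv` removes this multiplicity. -/
lemma sum_mul_pd_tens {k : ℕ} {F : Tup n k → ℝ}
    (hF : ∀ (j : Fin (k + 1)) (β : Fin (j : ℕ) → Fin n) (π : Equiv.Perm (Fin (j : ℕ))),
      F ⟨j, β ∘ π⟩ = F ⟨j, β⟩) (γ : Tup n k) (z : E n) :
    facInv γ * ∑ β, F β * pd β.2 (tens γ.2 z) z = F γ := by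
  obtain ⟨j, γ⟩ := γ
  rw [Fintype.sum_sigma, Finset.sum_eq_single j]
  · have h1 : ∀ β : Fin (j : ℕ) → Fin n, F ⟨j, β⟩ * pd β (tens γ z) z
        = ∑ σ : Equiv.Perm (Fin (j : ℕ)), if β = γ ∘ σ then F ⟨j, γ⟩ else 0 := by
      intro β
      rw [pd_tens_comm, pd_tens, Finset.mul_sum]
      refine Finset.sum_congr rfl fun σ _ => ?_
      split_ifs with h
      · subst h; simp [hF]
      · simp
    simp only [h1]
    rw [Finset.sum_comm]
    simp only [Finset.sum_ite_eq', Finset.mem_univ, if_true, Finset.sum_const, Finset.card_univ,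
      Fintype.card_perm, Fintype.card_fin, facInv, nsmul_eq_mul]
    rw [inv_mul_cancel_left₀]
    exact_mod_cast Nat.factorial_ne_zero _
  · intro i _ hij
    refine Finset.sum_eq_zero fun β _ => ?_
    simp only
    rw [pd_tens_of_ne (fun h => hij (Fin.ext h)), mul_zero]
  · simp

lemma sum_facInv_mul_pd_tens {k : ℕ} {F : Tup n k → ℝ}
    (hF : ∀ (j : Fin (k + 1)) (β : Fin (j : ℕ) → Fin n) (π : Equiv.Perm (Fin (j : ℕ))),
      F ⟨j, β ∘ π⟩ = F ⟨j, β⟩) (γ : Tup n k) (z : E n) :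
    ∑ β, facInv β * F β * pd γ.2 (tens β.2 z) z = F γ := by
  rw [← sum_mul_pd_tens hF γ z, Finset.mul_sum]
  refine Finset.sum_congr rfl fun β _ => ?_
  rw [pd_tens_comm]
  by_cases h : (β.1 : ℕ) = γ.1
  · have h' : facInv β = facInv γ := by simp only [facInv, h]
    rw [h']; ring
  · rw [pd_tens_of_ne h]; ring

end Taylor

/-! ### The chain rule of higher order -/

section Chain

variable {n : ℕ} {V V' : Set (E n)} {θ : E n → E n} {ν : E n → ℝ}

lemma apply_eq_sum_bvec (T : E n →L[ℝ] ℝ) (v : E n) : T v = ∑ j, v j * T (bvec j) := by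
  conv_lhs => rw [← (EuclideanSpace.basisFun (Fin n) ℝ).sum_repr v]
  simp [EuclideanSpace.basisFun_apply]

lemma smooth_coord (hθ : ContDiffOn ℝ ∞ θ V) (j : Fin n) :
    ContDiffOn ℝ ∞ (fun y => θ y j) V :=
  (EuclideanSpace.proj (𝕜 := ℝ) j).contDiff.comp_contDiffOn hθ

lemma pds_comp (hV : IsOpen V) (hV' : IsOpen V') (hθ : ContDiffOn ℝ ∞ θ V)
    (hm : Set.MapsTo θ V V') {g : E n → ℝ} (hg : ContDiffOn ℝ ∞ g V') (i : Fin n) :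
    Set.EqOn (pds i fun y => g (θ y))
      (fun y => ∑ j, pds i (fun y => θ y j) y * pds j g (θ y)) V := fun y hy => by
  have h1 : DifferentiableAt ℝ θ y :=
    (hθ.contDiffAt (hV.mem_nhds hy)).differentiableAt (by simp)
  have h2 := smooth_differentiableAt hV' hg (hm hy)
  have h3 : ∀ j, pds i (fun y => θ y j) y = fderiv ℝ θ y (bvec i) j := fun j => by
    have := ((EuclideanSpace.proj (𝕜 := ℝ) j).hasFDerivAt.comp y h1.hasFDerivAt).fderiv
    exact congrArg (fun T => T (bvec i)) this
  simp only [h3]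
  change fderiv ℝ (g ∘ θ) y (bvec i) = _
  rw [fderiv_comp y h2 h1, ContinuousLinearMap.comp_apply, apply_eq_sum_bvec]
  rfl

/-- `F f z` is a linear combination, with smooth coefficients, of the derivatives of order at most
`k` of `f` at `θ z`. -/
def IsOp (V V' : Set (E n)) (θ : E n → E n) (k : ℕ) (F : (E n → ℝ) → E n → ℝ) : Prop :=
  ∃ c : Tup n k → E n → ℝ, (∀ β, ContDiffOn ℝ ∞ (c β) V) ∧
    ∀ f, ContDiffOn ℝ ∞ f V' → ∀ z ∈ V, F f z = ∑ β, c β z * pd β.2 f (θ z)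

lemma IsOp.congr {k : ℕ} {F G : (E n → ℝ) → E n → ℝ} (hF : IsOp V V' θ k F)
    (h : ∀ f, ContDiffOn ℝ ∞ f V' → ∀ z ∈ V, G f z = F f z) : IsOp V V' θ k G := by
  obtain ⟨c, hc, hF⟩ := hF
  exact ⟨c, hc, fun f hf z hz => (h f hf z hz).trans (hF f hf z hz)⟩

lemma IsOp.add {k : ℕ} {F G : (E n → ℝ) → E n → ℝ} (hF : IsOp V V' θ k F)
    (hG : IsOp V V' θ k G) : IsOp V V' θ k fun f z => F f z + G f z := by
  obtain ⟨c, hc, hF⟩ := hF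
  obtain ⟨d, hd, hG⟩ := hG
  refine ⟨fun β z => c β z + d β z, fun β => (hc β).add (hd β), fun f hf z hz => ?_⟩
  simp only [hF f hf z hz, hG f hf z hz, ← Finset.sum_add_distrib, add_mul]

lemma IsOp.sum {ι : Type*} {k : ℕ} (s : Finset ι) {F : ι → (E n → ℝ) → E n → ℝ}
    (hF : ∀ i ∈ s, IsOp V V' θ k (F i)) : IsOp V V' θ k fun f z => ∑ i ∈ s, F i f z := by
  classical
  induction s using Finset.induction_on with
  | empty => exact ⟨fun _ _ => 0, fun _ => contDiffOn_const, fun f _ z _ => by simp⟩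
  | insert i s hi ih =>
    simp only [Finset.sum_insert hi]
    exact (hF i (Finset.mem_insert_self i s)).add
      (ih fun j hj => hF j (Finset.mem_insert_of_mem hj))

lemma isOp_mul_pdl (hV' : IsOpen V') (hm : Set.MapsTo θ V V') {a : E n → ℝ}
    (ha : ContDiffOn ℝ ∞ a V) {w : List (Fin n)} {k : ℕ} (hw : w.length ≤ k) :
    IsOp V V' θ k fun f z => a z * pdl w f (θ z) := by
  classical
  refine ⟨fun β z => if β = ⟨⟨w.length, Nat.lt_succ_of_le hw⟩, w.get⟩ then a z else 0,
    fun β => ?_, fun f hf z hz => ?_⟩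
  · simp only
    split_ifs
    · exact ha
    · exact contDiffOn_const
  · simp only [ite_mul, zero_mul, Finset.sum_ite_eq', Finset.mem_univ, if_true]
    rw [pd_eq_pdl hV' hf _ (hm hz)]
    congr 2
    exact (List.ofFn_get w).symm

lemma isOp_pdl (hV : IsOpen V) (hV' : IsOpen V') (hθ : ContDiffOn ℝ ∞ θ V)
    (hm : Set.MapsTo θ V V') (hν : ContDiffOn ℝ ∞ ν V) (w : List (Fin n)) (k : ℕ)
    (hk : w.length ≤ k) :
    IsOp V V' θ k fun f z => pdl w (fun y => ν y * f (θ y)) z := by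
  induction w generalizing k with
  | nil => exact isOp_mul_pdl hV' hm hν (w := []) (by simp)
  | cons i w ih =>
    obtain ⟨c, hc, hF⟩ := ih w.length le_rfl
    have key : IsOp V V' θ k fun f z => ∑ β : Tup n w.length,
        (pds i (c β) z * pdl (List.ofFn β.2) f (θ z) + ∑ j, c β z * pds i (fun y => θ y j) z *
          pdl (j :: List.ofFn β.2) f (θ z)) := by
      have hl : ∀ β : Tup n w.length, (List.ofFn β.2).length ≤ w.length := fun β => by
        rw [List.length_ofFn]; exact Nat.le_of_lt_succ β.1.2
      have hk' : w.length + 1 ≤ k := hk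
      refine IsOp.sum _ fun β _ => IsOp.add ?_ (IsOp.sum _ fun j _ => ?_)
      · exact isOp_mul_pdl hV' hm (smooth_pds hV i (hc β)) ((hl β).trans (by omega))
      · refine isOp_mul_pdl hV' hm ((hc β).mul (smooth_pds hV i (smooth_coord hθ j))) ?_
        rw [List.length_cons]
        exact (Nat.succ_le_succ (hl β)).trans hk'
    refine key.congr fun f hf z hz => ?_
    have h1 : Set.EqOn (pdl w fun y => ν y * f (θ y))
        (fun y => ∑ β : Tup n w.length, c β y * pdl (List.ofFn β.2) f (θ y)) V := fun y hy => by
      refine (hF f hf y hy).trans ?_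
      exact Finset.sum_congr rfl fun β _ => by rw [pd_eq_pdl hV' hf _ (hm hy)]
    have h2 : ∀ β : Tup n w.length,
        ContDiffOn ℝ ∞ (fun y => pdl (List.ofFn β.2) f (θ y)) V := fun β =>
      (smooth_pdl hV' _ hf).comp hθ hm
    rw [pdl_cons, pds_congr hV i h1 hz,
      pds_sum hV i Finset.univ (fun β _ => (hc β).mul (h2 β)) hz]
    refine Finset.sum_congr rfl fun β _ => ?_
    have h3 := pds_comp hV hV' hθ hm (smooth_pdl hV' (List.ofFn β.2) hf) i hz
    simp only at h3
    rw [pds_mul hV i (hc β) (h2 β) hz]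
    simp only [h3, pdl_cons, Finset.mul_sum]
    congr 1
    exact Finset.sum_congr rfl fun j _ => by ring

/-- The coefficients of the chain rule for `∂_β (ν · f ∘ θ)`. -/
noncomputable def chainC {k : ℕ} (ν : E n → ℝ) (θ : E n → E n) {j : ℕ} (β : Fin j → Fin n)
    (γ : Tup n k) (z : E n) : ℝ :=
  facInv γ * pd β (fun y => ν y * tens γ.2 (θ z) (θ y)) z

lemma chainC_comp_perm {k : ℕ} (ν : E n → ℝ) (θ : E n → E n) {j : ℕ} (β : Fin j → Fin n)
    (i : Fin (k + 1)) (γ : Fin (i : ℕ) → Fin n) (π : Equiv.Perm (Fin (i : ℕ))) :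
    chainC ν θ β (⟨i, γ ∘ π⟩ : Tup n k) = chainC ν θ β (⟨i, γ⟩ : Tup n k) := by
  funext z
  simp only [chainC, tens_comp_perm]
  rfl

/-- Iterating the product and chain rules gives some smooth coefficients; testing on monomials
centred at `θ z` replaces them by their symmetrization `chainC`. Derivatives of monomials at their
centre do not depend on the centre, which gives smoothness. -/
lemma exists_chainC (hV : IsOpen V) (hV' : IsOpen V') (hθ : ContDiffOn ℝ ∞ θ V)
    (hm : Set.MapsTo θ V V') (hν : ContDiffOn ℝ ∞ ν V) {j k : ℕ} (hjk : j ≤ k)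
    (β : Fin j → Fin n) :
    (∀ γ : Tup n k, ContDiffOn ℝ ∞ (chainC ν θ β γ) V) ∧
    ∀ f, ContDiffOn ℝ ∞ f V' → ∀ z ∈ V,
      pd β (fun y => ν y * f (θ y)) z = ∑ γ : Tup n k, chainC ν θ β γ z * pd γ.2 f (θ z) := by
  obtain ⟨c, hc, hF⟩ := isOp_pdl hV hV' hθ hm hν (List.ofFn β) k (by simpa using hjk)
  have hF' : ∀ f, ContDiffOn ℝ ∞ f V' → ∀ z ∈ V,
      pd β (fun y => ν y * f (θ y)) z = ∑ γ : Tup n k, c γ z * pd γ.2 f (θ z) :=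
    fun f hf z hz => by
      exact (pd_eq_pdl hV (hν.mul (hf.comp hθ hm)) β hz).trans (hF f hf z hz)
  have h1 : ∀ γ : Tup n k, ∀ z ∈ V, chainC ν θ β γ z
      = facInv γ * ∑ δ : Tup n k, c δ z * pd δ.2 (tens γ.2 (θ z)) (θ z) := fun γ z hz => by
    rw [chainC, hF' _ (smooth_tens _ _).contDiffOn z hz]
  refine ⟨fun γ => ?_, fun f hf z hz => ?_⟩
  · have h2 : ContDiffOn ℝ ∞ (fun z => facInv γ * ∑ δ : Tup n k,
        c δ z * pd δ.2 (tens γ.2 (0 : E n)) 0) V :=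
      contDiffOn_const.mul (ContDiffOn.sum fun δ _ => (hc δ).mul contDiffOn_const)
    refine h2.congr fun z hz => ?_
    rw [h1 γ z hz]
    congr 1
    exact Finset.sum_congr rfl fun δ _ => by rw [pd_tens_translate]
  · rw [hF' f hf z hz]
    have h2 : ∀ γ : Tup n k, chainC ν θ β γ z * pd γ.2 f (θ z) = ∑ δ : Tup n k,
        c δ z * (facInv γ * pd γ.2 f (θ z) * pd δ.2 (tens γ.2 (θ z)) (θ z)) := fun γ => by
      rw [h1 γ z hz, Finset.mul_sum, Finset.sum_mul]
      exact Finset.sum_congr rfl fun δ _ => by ring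
    simp only [h2]
    rw [Finset.sum_comm]
    refine Finset.sum_congr rfl fun δ _ => ?_
    rw [← Finset.mul_sum, sum_facInv_mul_pd_tens (F := fun γ : Tup n k => pd γ.2 f (θ z))
      (fun j β π => pd_comp_perm hV' hf β π (hm hz))]

end Chain


/-! ### Test functions and integration by parts -/

section TestFunctions

open MeasureTheory

variable {n : ℕ} {V : Set (E n)} {F G φ : E n → ℝ}

/-- Smooth functions with compact support in `V`. -/
structure IsTest (V : Set (E n)) (φ : E n → ℝ) : Prop where
  smooth : ContDiff ℝ ∞ φ
  compact : HasCompactSupport φ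
  subset : tsupport φ ⊆ V

lemma IsTest.mono_tsupport {ψ : E n → ℝ} (hφ : IsTest V φ) (hψ : ContDiff ℝ ∞ ψ)
    (h : tsupport ψ ⊆ tsupport φ) : IsTest V ψ :=
  ⟨hψ, hφ.compact.mono' ((subset_tsupport ψ).trans h), h.trans hφ.subset⟩

lemma IsTest.integrable (hφ : IsTest V φ) : Integrable φ :=
  hφ.smooth.continuous.integrable_of_hasCompactSupport hφ.compact

lemma IsTest.mul (hV : IsOpen V) (hF : ContDiffOn ℝ ∞ F V) (hφ : IsTest V φ) :
    IsTest V fun y => F y * φ y := by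
  have h : tsupport (fun y => F y * φ y) ⊆ tsupport φ := tsupport_mul_subset_right
  refine hφ.mono_tsupport (contDiff_iff_contDiffAt.2 fun y => ?_) h
  by_cases hy : y ∈ tsupport φ
  · exact (hF.contDiffAt (hV.mem_nhds (hφ.subset hy))).mul hφ.smooth.contDiffAt
  · refine (contDiffAt_const (c := (0 : ℝ))).congr_of_eventuallyEq ?_
    filter_upwards [(isClosed_tsupport φ).isOpen_compl.mem_nhds hy] with z hz
    rw [image_eq_zero_of_notMem_tsupport hz, mul_zero]

lemma IsTest.pds (hφ : IsTest V φ) (i : Fin n) : IsTest V (pds i φ) :=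
  hφ.mono_tsupport (contDiffOn_univ.1 (smooth_pds isOpen_univ i hφ.smooth.contDiffOn))
    (tsupport_fderiv_apply_subset ℝ _)

lemma IsTest.pdl (hφ : IsTest V φ) (w : List (Fin n)) : IsTest V (pdl w φ) := by
  induction w with
  | nil => exact hφ
  | cons i w ih => exact ih.pds i

lemma IsTest.pd_eq (hφ : IsTest V φ) {j : ℕ} (β : Fin j → Fin n) :
    pd β φ = UTS.pdl (List.ofFn β) φ :=
  funext fun _ => pd_eq_pdl isOpen_univ hφ.smooth.contDiffOn β trivial

lemma IsTest.pd (hφ : IsTest V φ) {j : ℕ} (β : Fin j → Fin n) : IsTest V (pd β φ) := by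
  rw [hφ.pd_eq]; exact hφ.pdl _

lemma IsTest.const_mul (hφ : IsTest V φ) (c : ℝ) : IsTest V fun y => c * φ y :=
  hφ.mono_tsupport (contDiff_const.mul hφ.smooth) tsupport_mul_subset_right

lemma isTest_zero : IsTest V fun _ => 0 :=
  ⟨contDiff_const, HasCompactSupport.zero, by
    rw [tsupport_eq_empty_iff.2 (by rfl)]; exact Set.empty_subset _⟩

lemma IsTest.add {ψ : E n → ℝ} (hφ : IsTest V φ) (hψ : IsTest V ψ) :
    IsTest V fun y => φ y + ψ y :=
  ⟨hφ.smooth.add hψ.smooth, hφ.compact.add hψ.compact,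
    (tsupport_add φ ψ).trans (Set.union_subset hφ.subset hψ.subset)⟩

lemma IsTest.sum {ι : Type*} (s : Finset ι) {φ : ι → E n → ℝ} (hφ : ∀ i ∈ s, IsTest V (φ i)) :
    IsTest V fun y => ∑ i ∈ s, φ i y := by
  classical
  induction s using Finset.induction_on with
  | empty => simpa using isTest_zero
  | insert i s hi ih =>
    simp only [Finset.sum_insert hi]
    exact (hφ i (Finset.mem_insert_self i s)).add
      (ih fun j hj => hφ j (Finset.mem_insert_of_mem hj))

lemma integral_pds_mul (hV : IsOpen V) (hF : ContDiffOn ℝ ∞ F V) (hφ : IsTest V φ) (i : Fin n) :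
    ∫ y, pds i F y * φ y = -∫ y, F y * pds i φ y := by
  have h1 := (IsTest.mul hV (smooth_pds hV i hF) hφ).integrable
  have h2 := (IsTest.mul hV hF (hφ.pds i)).integrable
  have h3 := (IsTest.mul hV hF hφ).integrable
  have h4 := integral_mul_fderiv_eq_neg_fderiv_mul_of_integrable (v := bvec i) h1 h2 h3
    (fun y hy => smooth_differentiableAt hV hF (hφ.subset hy))
    (fun y _ => hφ.smooth.contDiffAt.differentiableAt (by simp))
  rw [eq_neg_iff_add_eq_zero, add_comm, ← eq_neg_iff_add_eq_zero]
  exact h4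

lemma integral_pdl_mul (hV : IsOpen V) (hF : ContDiffOn ℝ ∞ F V) (w : List (Fin n))
    (hφ : IsTest V φ) : ∫ y, pdl w F y * φ y = (-1) ^ w.length * ∫ y, F y * pdl w φ y := by
  induction w generalizing φ with
  | nil => simp
  | cons i w ih =>
    rw [pdl_cons, integral_pds_mul hV (smooth_pdl hV w hF) hφ, ih (hφ.pds i), List.length_cons,
      pow_succ]
    have h : pdl w (pds i φ) = pds i (pdl w φ) := by
      have h1 : pdl w (pds i φ) = pdl (w ++ [i]) φ := by rw [pdl_append]; rfl
      rw [h1, ← pdl_cons]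
      exact funext fun y => pdl_perm isOpen_univ (List.perm_append_singleton i w)
        hφ.smooth.contDiffOn trivial
    rw [h]
    simp only [pdl_cons]
    ring

lemma integral_pd_mul (hV : IsOpen V) (hF : ContDiffOn ℝ ∞ F V) {j : ℕ} (β : Fin j → Fin n)
    (hφ : IsTest V φ) : ∫ y, pd β F y * φ y = (-1) ^ j * ∫ y, F y * pd β φ y := by
  have h := integral_pdl_mul hV hF (List.ofFn β) hφ
  rw [List.length_ofFn] at h
  rw [hφ.pd_eq, ← h]
  refine integral_congr_ae (Filter.Eventually.of_forall fun y => ?_)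
  by_cases hy : y ∈ V
  · simp only [pd_eq_pdl hV hF β hy]
  · simp only [image_eq_zero_of_notMem_tsupport fun h => hy (hφ.subset h), mul_zero]

lemma eqOn_of_integral_mul_test (hV : IsOpen V) (hF : ContDiffOn ℝ ∞ F V)
    (hG : ContDiffOn ℝ ∞ G V) (h : ∀ φ, IsTest V φ → ∫ y, F y * φ y = ∫ y, G y * φ y) :
    Set.EqOn F G V := by
  have h1 : ∀ᵐ y, y ∈ V → F y - G y = 0 := by
    refine hV.ae_eq_zero_of_integral_contDiff_smul_eq_zero
      ((hF.sub hG).continuousOn.locallyIntegrableOn hV.measurableSet) fun g h1 h2 h3 => ?_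
    have hg : IsTest V g := ⟨h1, h2, h3⟩
    have h4 := integral_sub (IsTest.mul hV hF hg).integrable (IsTest.mul hV hG hg).integrable
    rw [h g hg, sub_self] at h4
    rw [← h4]
    refine integral_congr_ae (Filter.Eventually.of_forall fun y => ?_)
    simp only [smul_eq_mul, mul_comm, mul_sub]
  refine Measure.eqOn_open_of_ae_eq (μ := volume) ?_ hV hF.continuousOn hG.continuousOn
  exact (ae_restrict_iff' hV.measurableSet).2 (h1.mono fun y hy hyV => sub_eq_zero.1 (hy hyV))

end TestFunctions

/-! ### The formal adjoint -/

section Adjoint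

open MeasureTheory

variable {n q m r : ℕ} {V : Set (E n)} {l : E n → Coef n q m r}

/-- The formal adjoint of the operator with coefficients `l`. -/
noncomputable def adj (l : E n → Coef n q m r) (φ : Fin m → E n → ℝ) (α : Fin q) : E n → ℝ :=
  fun y => ∑ b, ∑ β : Tup n r, (-1) ^ (β.1 : ℕ) * pd β.2 (fun z => l z b α β * φ b z) y

/-- The components of `l` are smooth on `V`. -/
def SmoothCoef (V : Set (E n)) (l : E n → Coef n q m r) : Prop :=
  ∀ a α β, ContDiffOn ℝ ∞ (fun y => l y a α β) V

lemma SmoothCoef.mono {V' : Set (E n)} (h : SmoothCoef V l) (hV : V' ⊆ V) : SmoothCoef V' l :=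
  fun a α β => (h a α β).mono hV

lemma smooth_adj (hV : IsOpen V) (hl : SmoothCoef V l) {φ : Fin m → E n → ℝ}
    (hφ : ∀ b, ContDiffOn ℝ ∞ (φ b) V) (α : Fin q) : ContDiffOn ℝ ∞ (adj l φ α) V :=
  ContDiffOn.sum fun b _ => ContDiffOn.sum fun β _ =>
    contDiffOn_const.mul (smooth_pd hV ((hl b α β).mul (hφ b)) _)

lemma IsTest.adj (hV : IsOpen V) (hl : SmoothCoef V l) {φ : Fin m → E n → ℝ}
    (hφ : ∀ b, IsTest V (φ b)) (α : Fin q) : IsTest V (adj l φ α) :=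
  IsTest.sum _ fun b _ => IsTest.sum _ fun β _ =>
    ((IsTest.mul hV (hl b α β) (hφ b)).pd _).const_mul _

lemma smooth_applyCoef (hV : IsOpen V) (hl : SmoothCoef V l) {h : E n → Fin q → ℝ}
    (hh : ∀ α, ContDiffOn ℝ ∞ (fun y => h y α) V) (a : Fin m) :
    ContDiffOn ℝ ∞ (fun y => applyCoef (l y) h y a) V :=
  ContDiffOn.sum fun α _ => ContDiffOn.sum fun β _ => (hl a α β).mul (smooth_pd hV (hh α) _)

lemma integral_applyCoef (hV : IsOpen V) (hl : SmoothCoef V l) {h : E n → Fin q → ℝ}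
    (hh : ∀ α, ContDiffOn ℝ ∞ (fun y => h y α) V) {φ : Fin m → E n → ℝ}
    (hφ : ∀ b, IsTest V (φ b)) :
    ∑ a, ∫ y, applyCoef (l y) h y a * φ a y = ∑ α, ∫ y, h y α * UTS.adj l φ α y := by
  have h1 : ∀ a α β, IsTest V fun y => pd β.2 (fun z => h z α) y * (l y a α β * φ a y) :=
    fun a α β => IsTest.mul hV (smooth_pd hV (hh α) _) (IsTest.mul hV (hl a α β) (hφ a))
  have h2 : ∀ a α (β : Tup n r), IsTest V fun y => h y α *
      ((-1) ^ (β.1 : ℕ) * pd β.2 (fun z => l z a α β * φ a z) y) := fun a α β =>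
    IsTest.mul hV (hh α) (((IsTest.mul hV (hl a α β) (hφ a)).pd _).const_mul _)
  have h3 : ∀ a, ∫ y, applyCoef (l y) h y a * φ a y
      = ∑ α, ∑ β : Tup n r, ∫ y, pd β.2 (fun z => h z α) y * (l y a α β * φ a y) := fun a => by
    rw [← Finset.sum_congr rfl fun α _ => integral_finsetSum _ fun β _ => (h1 a α β).integrable,
      ← integral_finsetSum _ fun α _ => (IsTest.sum _ fun β _ => h1 a α β).integrable]
    congr 1
    funext y
    simp only [applyCoef, Finset.sum_mul]
    exact Finset.sum_congr rfl fun α _ => Finset.sum_congr rfl fun β _ => by ring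
  have h4 : ∀ α, ∫ y, h y α * UTS.adj l φ α y = ∑ a, ∑ β : Tup n r, ∫ y, h y α *
      ((-1) ^ (β.1 : ℕ) * pd β.2 (fun z => l z a α β * φ a z) y) := fun α => by
    rw [← Finset.sum_congr rfl fun a _ => integral_finsetSum _ fun β _ => (h2 a α β).integrable,
      ← integral_finsetSum _ fun a _ => (IsTest.sum _ fun β _ => h2 a α β).integrable]
    simp only [UTS.adj, Finset.mul_sum]
  simp only [h3, h4]
  rw [Finset.sum_comm]
  refine Finset.sum_congr rfl fun α _ => Finset.sum_congr rfl fun a _ =>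
    Finset.sum_congr rfl fun β _ => ?_
  rw [integral_pd_mul hV (hh α) β.2 (IsTest.mul hV (hl a α β) (hφ a)), ← integral_const_mul]
  congr 1
  funext y
  ring

lemma eqOn_of_sum_integral_mul_test {ι : Type*} [Fintype ι] (hV : IsOpen V) {F G : ι → E n → ℝ}
    (hF : ∀ i, ContDiffOn ℝ ∞ (F i) V) (hG : ∀ i, ContDiffOn ℝ ∞ (G i) V)
    (h : ∀ φ : ι → E n → ℝ, (∀ i, IsTest V (φ i)) →
      ∑ i, ∫ y, F i y * φ i y = ∑ i, ∫ y, G i y * φ i y) (i : ι) : Set.EqOn (F i) (G i) V := by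
  classical
  refine eqOn_of_integral_mul_test hV (hF i) (hG i) fun φ hφ => ?_
  have h1 := h (fun j => if j = i then φ else fun _ => 0) fun j => by
    split_ifs
    · exact hφ
    · exact isTest_zero
  rw [Finset.sum_eq_single i, Finset.sum_eq_single i] at h1
  · simpa using h1
  · intro j _ hj; simp [hj]
  · simp
  · intro j _ hj; simp [hj]
  · simp

end Adjoint


/-! ### Operators whose coefficients depend on jets -/

section Jets

variable {n q m r : ℕ} {V : Set (E n)} {l : E n → Coef n q m r}

/-- Tuples of length at most `k` as tuples of length at most `K`. -/
def upT {k K : ℕ} (h : k ≤ K) (β : Tup n k) : Tup n K :=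
  ⟨Fin.castLE (Nat.succ_le_succ h) β.1, β.2⟩

/-- The `k`-jet underlying a `K`-jet. -/
def truncJ {k K : ℕ} (h : k ≤ K) (p : JetIdx n q m r K → ℝ) : JetIdx n q m r k → ℝ :=
  fun x => p (x.1, x.2.1, x.2.2.1, upT h x.2.2.2)

lemma truncJ_jet {k K : ℕ} (h : k ≤ K) (l : E n → Coef n q m r) (y : E n) :
    truncJ h (jet K l y) = jet k l y := rfl

lemma contDiff_truncJ {k K : ℕ} (h : k ≤ K) :
    ContDiff ℝ ∞ (truncJ h : (JetIdx n q m r K → ℝ) → JetIdx n q m r k → ℝ) :=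
  contDiff_pi.2 fun _ => contDiff_apply _ _ _

lemma isOpen_preimage_truncJ {k K : ℕ} (h : k ≤ K) {Ω : Set (JetIdx n q m r k → ℝ)}
    (hΩ : IsOpen Ω) : IsOpen ((truncJ h : (JetIdx n q m r K → ℝ) → _) ⁻¹' Ω) :=
  hΩ.preimage (contDiff_truncJ h).continuous

lemma smooth_jet (hV : IsOpen V) (hl : SmoothCoef V l) (k : ℕ) :
    ContDiffOn ℝ ∞ (jet k l) V :=
  contDiffOn_pi.2 fun _ => smooth_pd hV (hl _ _ _) _

/-- One more derivative in the direction `i`. -/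
def shiftJ {k : ℕ} (i : Fin n) (x : JetIdx n q m r k) : JetIdx n q m r (k + 1) :=
  (x.1, x.2.1, x.2.2.1, ⟨x.2.2.2.1.succ, Fin.cons i x.2.2.2.2⟩)

/-- The total derivative of a function of the jet. -/
noncomputable def totalD {k : ℕ} (i : Fin n) (G : (JetIdx n q m r k → ℝ) → ℝ) :
    (JetIdx n q m r (k + 1) → ℝ) → ℝ :=
  fun p => fderiv ℝ G (truncJ (Nat.le_succ k) p) fun x => p (shiftJ i x)

lemma pds_pd (hV : IsOpen V) {f : E n → ℝ} (hf : ContDiffOn ℝ ∞ f V) (i : Fin n) {j : ℕ}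
    (γ : Fin j → Fin n) :
    Set.EqOn (pds i (pd γ f)) (pd (Fin.cons i γ : Fin (j + 1) → Fin n) f) V := fun y hy => by
  rw [pds_congr hV i (fun z hz => pd_eq_pdl hV hf γ hz) hy, pd_eq_pdl hV hf _ hy, List.ofFn_succ,
    pdl_cons]
  simp

lemma smooth_totalD {k : ℕ} {G : (JetIdx n q m r k → ℝ) → ℝ} {Ω : Set (JetIdx n q m r k → ℝ)}
    (hΩ : IsOpen Ω) (hG : ContDiffOn ℝ ∞ G Ω) (i : Fin n) :
    ContDiffOn ℝ ∞ (totalD i G) (truncJ (Nat.le_succ k) ⁻¹' Ω) := by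
  have h1 : ContDiffOn ℝ ∞ (fun p => fderiv ℝ G (truncJ (Nat.le_succ k) p))
      (truncJ (Nat.le_succ k) ⁻¹' Ω) :=
    (hG.fderiv_of_isOpen hΩ (m := ∞) (by simp)).comp (contDiff_truncJ _).contDiffOn fun _ h => h
  have h2 : ContDiff ℝ ∞ fun (p : JetIdx n q m r (k + 1) → ℝ) (x : JetIdx n q m r k) =>
      p (shiftJ i x) := contDiff_pi.2 fun _ => contDiff_apply _ _ _
  exact h1.clm_apply h2.contDiffOn

lemma pds_comp_jet (hV : IsOpen V) (hl : SmoothCoef V l) {k : ℕ}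
    {G : (JetIdx n q m r k → ℝ) → ℝ} {Ω : Set (JetIdx n q m r k → ℝ)} (hΩ : IsOpen Ω)
    (hG : ContDiffOn ℝ ∞ G Ω) (hm : Set.MapsTo (jet k l) V Ω) (i : Fin n) :
    Set.EqOn (pds i fun y => G (jet k l y)) (fun y => totalD i G (jet (k + 1) l y)) V :=
  fun y hy => by
  have h1 : DifferentiableAt ℝ (jet k l) y :=
    ((smooth_jet hV hl k).contDiffAt (hV.mem_nhds hy)).differentiableAt (by simp)
  have h2 : DifferentiableAt ℝ G (jet k l y) :=
    (hG.contDiffAt (hΩ.mem_nhds (hm hy))).differentiableAt (by simp)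
  change fderiv ℝ (G ∘ jet k l) y (bvec i) = _
  rw [fderiv_comp y h2 h1, ContinuousLinearMap.comp_apply]
  change _ = fderiv ℝ G (jet k l y) fun x => jet (k + 1) l y (shiftJ i x)
  congr 1
  funext x
  have h3 := ((ContinuousLinearMap.proj (R := ℝ) (φ := fun _ : JetIdx n q m r k => ℝ)
    x).hasFDerivAt.comp y h1.hasFDerivAt).fderiv
  have h4 := congrArg (fun T => T (bvec i)) h3
  exact h4.symm.trans (pds_pd hV (hl _ _ _) i _ hy)

/-- `F l g y` is a linear combination of the derivatives of order at most `s` of `g` at `y`, whose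
coefficients are smooth functions of the `K`-jet of `l`, as long as its `k`-jet lies in `Ω`. -/
def IsJetOp {k K : ℕ} (h : k ≤ K) (s : ℕ) (Ω : Set (JetIdx n q m r k → ℝ))
    (F : (E n → Coef n q m r) → (E n → ℝ) → E n → ℝ) : Prop :=
  ∃ c : Tup n s → (JetIdx n q m r K → ℝ) → ℝ, (∀ γ, ContDiffOn ℝ ∞ (c γ) (truncJ h ⁻¹' Ω)) ∧
    ∀ V l g, IsOpen V → SmoothCoef V l → Set.MapsTo (jet k l) V Ω → ContDiffOn ℝ ∞ g V →
      ∀ y ∈ V, F l g y = ∑ γ, c γ (jet K l y) * pd γ.2 g y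

variable {k K s : ℕ} {h : k ≤ K} {Ω : Set (JetIdx n q m r k → ℝ)}
  {F F' : (E n → Coef n q m r) → (E n → ℝ) → E n → ℝ}

lemma IsJetOp.congr (hF : IsJetOp h s Ω F)
    (hF' : ∀ V l g, IsOpen V → SmoothCoef V l → Set.MapsTo (jet k l) V Ω → ContDiffOn ℝ ∞ g V →
      ∀ y ∈ V, F' l g y = F l g y) : IsJetOp h s Ω F' := by
  obtain ⟨c, hc, hF⟩ := hF
  exact ⟨c, hc, fun V l g h1 h2 h3 h4 y hy =>
    (hF' V l g h1 h2 h3 h4 y hy).trans (hF V l g h1 h2 h3 h4 y hy)⟩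

lemma IsJetOp.add (hF : IsJetOp h s Ω F) (hF' : IsJetOp h s Ω F') :
    IsJetOp h s Ω fun l g y => F l g y + F' l g y := by
  obtain ⟨c, hc, hF⟩ := hF
  obtain ⟨c', hc', hF'⟩ := hF'
  refine ⟨fun γ p => c γ p + c' γ p, fun γ => (hc γ).add (hc' γ),
    fun V l g h1 h2 h3 h4 y hy => ?_⟩
  simp only [hF V l g h1 h2 h3 h4 y hy, hF' V l g h1 h2 h3 h4 y hy, ← Finset.sum_add_distrib,
    add_mul]

lemma IsJetOp.sum {ι : Type*} (S : Finset ι)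
    {F : ι → (E n → Coef n q m r) → (E n → ℝ) → E n → ℝ}
    (hF : ∀ i ∈ S, IsJetOp h s Ω (F i)) : IsJetOp h s Ω fun l g y => ∑ i ∈ S, F i l g y := by
  classical
  induction S using Finset.induction_on with
  | empty => exact ⟨fun _ _ => 0, fun _ => contDiffOn_const, by simp⟩
  | insert i S hi ih =>
    simp only [Finset.sum_insert hi]
    exact (hF i (Finset.mem_insert_self i S)).add
      (ih fun j hj => hF j (Finset.mem_insert_of_mem hj))

lemma isJetOp_mul_pdl {b : (JetIdx n q m r K → ℝ) → ℝ}
    (hb : ContDiffOn ℝ ∞ b (truncJ h ⁻¹' Ω)) {w : List (Fin n)} (hw : w.length ≤ s) :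
    IsJetOp h s Ω fun l g y => b (jet K l y) * pdl w g y := by
  classical
  refine ⟨fun γ p => if γ = ⟨⟨w.length, Nat.lt_succ_of_le hw⟩, w.get⟩ then b p else 0,
    fun γ => ?_, fun V l g h1 h2 h3 h4 y hy => ?_⟩
  · simp only
    split_ifs
    · exact hb
    · exact contDiffOn_const
  · simp only [ite_mul, zero_mul, Finset.sum_ite_eq', Finset.mem_univ, if_true]
    rw [pd_eq_pdl h1 h4 _ hy]
    congr 2
    exact (List.ofFn_get w).symm

/-- Each differentiation replaces a coefficient by itself and its total derivatives, which raises
the order of the jet and the order of the operator by one. The domain is still prescribed by the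
`k`-jet alone. -/
lemma isJetOp_pdl (hΩ : IsOpen Ω) {G : (JetIdx n q m r k → ℝ) → ℝ} (hG : ContDiffOn ℝ ∞ G Ω)
    (w : List (Fin n)) {K s : ℕ} (h : k ≤ K) (hK : k + w.length ≤ K) (hs : w.length ≤ s) :
    IsJetOp h s Ω fun l g y => pdl w (fun y => G (jet k l y) * g y) y := by
  induction w generalizing K s with
  | nil =>
    exact isJetOp_mul_pdl (b := fun p => G (truncJ h p)) (w := [])
      (hG.comp (contDiff_truncJ h).contDiffOn fun _ h => h) (by simp)
  | cons i w ih =>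
    rw [List.length_cons] at hK hs
    have h1 : k ≤ k + w.length := Nat.le_add_right _ _
    have h2 : k + w.length ≤ K := by omega
    obtain ⟨c, hc, hF⟩ := ih h1 le_rfl (le_refl w.length)
    have hΩ' := isOpen_preimage_truncJ h1 hΩ
    have h4 : ∀ {b : (JetIdx n q m r (k + w.length) → ℝ) → ℝ},
        ContDiffOn ℝ ∞ b (truncJ h1 ⁻¹' Ω) →
        ContDiffOn ℝ ∞ (fun p => b (truncJ h2 p)) (truncJ h ⁻¹' Ω) := fun hb =>
      hb.comp (contDiff_truncJ h2).contDiffOn fun _ h => h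
    have h5 : ∀ γ, ContDiffOn ℝ ∞ (fun p => totalD i (c γ) (truncJ hK p))
        (truncJ h ⁻¹' Ω) := fun γ =>
      (smooth_totalD hΩ' (hc γ) i).comp (contDiff_truncJ _).contDiffOn fun _ h => h
    have hl : ∀ β : Tup n w.length, (List.ofFn β.2).length ≤ w.length := fun β => by
      rw [List.length_ofFn]; exact Nat.le_of_lt_succ β.1.2
    have key : IsJetOp h s Ω fun l g y => ∑ γ : Tup n w.length,
        (totalD i (c γ) (truncJ hK (jet K l y)) * pdl (List.ofFn γ.2) g y +
          c γ (truncJ h2 (jet K l y)) * pdl (i :: List.ofFn γ.2) g y) := by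
      refine IsJetOp.sum _ fun γ _ => IsJetOp.add ?_ ?_
      · exact isJetOp_mul_pdl (h5 γ) ((hl γ).trans (by omega))
      · refine isJetOp_mul_pdl (h4 (hc γ)) ?_
        rw [List.length_cons]
        exact (Nat.succ_le_succ (hl γ)).trans hs
    refine key.congr fun V l g hV hl' hm hg y hy => ?_
    have h6 : Set.EqOn (pdl w fun y => G (jet k l y) * g y)
        (fun y => ∑ γ : Tup n w.length, c γ (jet (k + w.length) l y) * pdl (List.ofFn γ.2) g y) V :=
      fun z hz => (hF V l g hV hl' hm hg z hz).trans
        (Finset.sum_congr rfl fun γ _ => by rw [pd_eq_pdl hV hg _ hz])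
    have hm' : Set.MapsTo (jet (k + w.length) l) V (truncJ h1 ⁻¹' Ω) := fun z hz => hm hz
    have h7 : ∀ γ, ContDiffOn ℝ ∞ (fun y => c γ (jet (k + w.length) l y)) V := fun γ =>
      (hc γ).comp (smooth_jet hV hl' _) hm'
    rw [pdl_cons, pds_congr hV i h6 hy,
      pds_sum hV i Finset.univ (fun γ _ => (h7 γ).mul (smooth_pdl hV _ hg)) hy]
    refine Finset.sum_congr rfl fun γ _ => ?_
    rw [pds_mul hV i (h7 γ) (smooth_pdl hV _ hg) hy]
    have h8 := pds_comp_jet hV hl' hΩ' (hc γ) hm' i hy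
    simp only at h8
    simp only [h8, truncJ_jet, pdl_cons]

end Jets

/-! ### From left inverses of the adjoint to local right inverses -/

section LocalInverse

open MeasureTheory

variable {n m r : ℕ} {V : Set (E n)} {l : E n → Coef n (m + 1) m r}

/-- Smooth upper totally symmetric coefficients on `V`. -/
structure IsUTSField (V : Set (E n)) (l : E n → Coef n (m + 1) m r) : Prop where
  smooth : SmoothCoef V l
  symm : ∀ y ∈ V, IsSymm (l y)
  uts : ∀ y ∈ V, IsUTS (l y)

lemma IsUTSField.mono {V' : Set (E n)} (h : IsUTSField V l) (hV : V' ⊆ V) : IsUTSField V' l :=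
  ⟨h.smooth.mono hV, fun y hy => h.symm y (hV hy), fun y hy => h.uts y (hV hy)⟩

/-- A differential operator of order `t` with coefficients `c` whose composite with the adjoint of
any upper totally symmetric operator is the multiplication by `d`, a polynomial in the jet of this
operator. -/
structure IsAdjLeftInverse {k t : ℕ} (d : MvPolynomial (JetIdx n (m + 1) m r k) ℝ)
    (c : Fin m → Fin (m + 1) → Tup n t → (JetIdx n (m + 1) m r k → ℝ) → ℝ) : Prop where
  smooth : ∀ a α β, ContDiff ℝ ∞ (c a α β)
  eq : ∀ V l φ, IsOpen V → IsUTSField V l → (∀ b, ContDiffOn ℝ ∞ (φ b) V) → ∀ y ∈ V, ∀ a,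
    ∑ α, ∑ β, c a α β (jet k l y) * pd β.2 (adj l φ α) y
      = MvPolynomial.eval (jet k l y) d * φ a y

/-- The adjoint of the operator with coefficients `c`. -/
noncomputable def dualOp {k t : ℕ}
    (c : Fin m → Fin (m + 1) → Tup n t → (JetIdx n (m + 1) m r k → ℝ) → ℝ)
    (l : E n → Coef n (m + 1) m r) (g : E n → Fin m → ℝ) (y : E n) (α : Fin (m + 1)) : ℝ :=
  ∑ a, ∑ β : Tup n t, (-1) ^ (β.1 : ℕ) * pd β.2 (fun z => c a α β (jet k l z) * g z a) y

lemma smooth_dualOp {k t : ℕ}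
    {c : Fin m → Fin (m + 1) → Tup n t → (JetIdx n (m + 1) m r k → ℝ) → ℝ} (hV : IsOpen V)
    (hl : SmoothCoef V l) (hc : ∀ a α β, ContDiff ℝ ∞ (c a α β)) {g : E n → Fin m → ℝ}
    (hg : ∀ a, ContDiffOn ℝ ∞ (fun y => g y a) V) (α : Fin (m + 1)) :
    ContDiffOn ℝ ∞ (fun y => dualOp c l g y α) V :=
  ContDiffOn.sum fun a _ => ContDiffOn.sum fun β _ => contDiffOn_const.mul
    (smooth_pd hV (((hc a α β).comp_contDiffOn (smooth_jet hV hl k)).mul (hg a)) _)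

lemma smooth_eval_jet {k : ℕ} (P : MvPolynomial (JetIdx n (m + 1) m r k) ℝ) :
    ContDiff ℝ ∞ fun p : JetIdx n (m + 1) m r k → ℝ => MvPolynomial.eval p P := by
  induction P using MvPolynomial.induction_on with
  | C t => simpa using contDiff_const
  | add p q hp hq => simpa using hp.add hq
  | mul_X p v hp => simpa using hp.mul (contDiff_apply _ _ v)

/-- Dualization of `IsAdjLeftInverse`: two integrations by parts against test functions `φ` give `∫
L(Mg) φ = ∫ Mg · L*φ = ∫ g d φ`, where `M` is `dualOp c l`. -/
lemma applyCoef_dualOp {k t : ℕ} {d : MvPolynomial (JetIdx n (m + 1) m r k) ℝ}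
    {c : Fin m → Fin (m + 1) → Tup n t → (JetIdx n (m + 1) m r k → ℝ) → ℝ}
    (h : IsAdjLeftInverse d c) (hV : IsOpen V) (hl : IsUTSField V l) {g : E n → Fin m → ℝ}
    (hg : ∀ a, ContDiffOn ℝ ∞ (fun y => g y a) V) (a : Fin m) :
    Set.EqOn (fun y => applyCoef (l y) (dualOp c l g) y a)
      (fun y => MvPolynomial.eval (jet k l y) d * g y a) V := by
  have hs := smooth_dualOp hV hl.smooth h.smooth hg
  refine eqOn_of_sum_integral_mul_test hV
    (F := fun a y => applyCoef (l y) (dualOp c l g) y a)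
    (G := fun a y => MvPolynomial.eval (jet k l y) d * g y a)
    (smooth_applyCoef hV hl.smooth hs)
    (fun a => ((smooth_eval_jet d).comp_contDiffOn (smooth_jet hV hl.smooth k)).mul (hg a))
    (fun φ hφ => ?_) a
  rw [integral_applyCoef hV hl.smooth hs hφ]
  have h1 : ∀ a α (β : Tup n t), ContDiffOn ℝ ∞ (fun z => c a α β (jet k l z) * g z a) V :=
    fun a α β => ((h.smooth a α β).comp_contDiffOn (smooth_jet hV hl.smooth k)).mul (hg a)
  have h2 := fun α => IsTest.adj hV hl.smooth hφ α
  have h3 : ∀ α, ∫ y, dualOp c l g y α * adj l φ α y = ∑ a, ∑ β : Tup n t,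
      ∫ y, (c a α β (jet k l y) * g y a) * pd β.2 (adj l φ α) y := fun α => by
    have h4 : ∀ a (β : Tup n t), IsTest V fun y => ((-1) ^ (β.1 : ℕ) *
        pd β.2 (fun z => c a α β (jet k l z) * g z a) y) * adj l φ α y := fun a β =>
      IsTest.mul hV (contDiffOn_const.mul (smooth_pd hV (h1 a α β) _)) (h2 α)
    simp only [dualOp, Finset.sum_mul]
    rw [integral_finsetSum _ fun a _ => (IsTest.sum _ fun β _ => h4 a β).integrable]
    refine Finset.sum_congr rfl fun a _ => ?_
    rw [integral_finsetSum _ fun β _ => (h4 a β).integrable]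
    refine Finset.sum_congr rfl fun β _ => ?_
    simp only [mul_assoc]
    rw [integral_const_mul]
    have h5 := integral_pd_mul hV (h1 a α β) β.2 (h2 α)
    rw [h5, ← mul_assoc, ← pow_add, ← two_mul, pow_mul]
    simp [mul_assoc]
  have h6 : ∀ a α (β : Tup n t), Integrable fun y =>
      (c a α β (jet k l y) * g y a) * pd β.2 (adj l φ α) y := fun a α β =>
    (IsTest.mul hV (h1 a α β) ((h2 α).pd _)).integrable
  simp only [h3]
  rw [Finset.sum_comm]
  refine Finset.sum_congr rfl fun a _ => ?_
  rw [← Finset.sum_congr rfl fun α _ => integral_finsetSum _ fun β _ => h6 a α β,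
    ← integral_finsetSum _ fun α _ => integrable_finsetSum _ fun β _ => h6 a α β]
  refine integral_congr_ae (Filter.Eventually.of_forall fun y => ?_)
  by_cases hy : y ∈ V
  · have h7 := h.eq V l φ hV hl (fun b => (hφ b).smooth.contDiffOn) y hy a
    calc ∑ α, ∑ β : Tup n t, (c a α β (jet k l y) * g y a) * pd β.2 (adj l φ α) y
        = g y a * ∑ α, ∑ β : Tup n t, c a α β (jet k l y) * pd β.2 (adj l φ α) y := by
          simp only [Finset.mul_sum]
          exact Finset.sum_congr rfl fun α _ => Finset.sum_congr rfl fun β _ => by ring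
      _ = _ := by rw [h7]; ring
  · have h8 : ∀ {ψ : E n → ℝ}, IsTest V ψ → ψ y = 0 := fun hψ =>
      image_eq_zero_of_notMem_tsupport fun h => hy (hψ.subset h)
    simp only [h8 (hφ a), mul_zero]
    exact Finset.sum_eq_zero fun α _ => Finset.sum_eq_zero fun β _ => by
      rw [h8 ((h2 α).pd _), mul_zero]

lemma applyCoef_sum {q q' : ℕ} {ι : Type*} (S : Finset ι) (hV : IsOpen V) (c : Coef n q q' r)
    {h : ι → E n → Fin q → ℝ} (hh : ∀ i ∈ S, ∀ α, ContDiffOn ℝ ∞ (fun y => h i y α) V) {y : E n}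
    (hy : y ∈ V) (a : Fin q') :
    applyCoef c (fun z α => ∑ i ∈ S, h i z α) y a = ∑ i ∈ S, applyCoef c (h i) y a := by
  have h1 : ∀ (α : Fin q) (β : Tup n r), pd β.2 (fun z => ∑ i ∈ S, h i z α) y
      = ∑ i ∈ S, pd β.2 (fun z => h i z α) y := fun α β => by
    rw [pd_eq_pdl hV (ContDiffOn.sum fun i hi => hh i hi α) _ hy,
      pdl_sum hV _ S (fun i hi => hh i hi α) hy]
    exact Finset.sum_congr rfl fun i hi => (pd_eq_pdl hV (hh i hi α) _ hy).symm
  simp only [applyCoef, h1, Finset.mul_sum]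
  rw [Finset.sum_congr rfl fun α _ => Finset.sum_comm]
  exact Finset.sum_comm

lemma applyCoef_congr {q q' : ℕ} (hV : IsOpen V) (c : Coef n q q' r) {h h' : E n → Fin q → ℝ}
    (hh : Set.EqOn h h' V) {y : E n} (hy : y ∈ V) : applyCoef c h y = applyCoef c h' y := by
  funext a
  refine Finset.sum_congr rfl fun α _ => Finset.sum_congr rfl fun β _ => ?_
  congr 1
  have : (fun z => h z α) =ᶠ[nhds y] fun z => h' z α :=
    Filter.eventuallyEq_of_mem (hV.mem_nhds hy) fun z hz => by simp only [hh hz]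
  simp only [pd, (this.iteratedFDeriv ℝ _).eq_of_nhds]

/-- The `i`-th dual operator is applied to `G i · g` with `G i = d i / ∑ (d j)²`. Composition with
`L` multiplies by `d i`, and `∑ d i · G i = 1` wherever some `d i` is nonzero. The division must
precede the dual operator, which differentiates it too. -/
theorem exists_local_rightInverse {k t K s : ℕ} (hK : k + t ≤ K) (hs : t ≤ s) {ι : Type*}
    [Fintype ι] {d : ι → MvPolynomial (JetIdx n (m + 1) m r k) ℝ}
    {c : ι → Fin m → Fin (m + 1) → Tup n t → (JetIdx n (m + 1) m r k → ℝ) → ℝ}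
    (h : ∀ i, IsAdjLeftInverse (d i) (c i)) :
    ∃ N : (JetIdx n (m + 1) m r K → ℝ) → Coef n m (m + 1) s,
      ContDiffOn ℝ ∞ N
        {p | ∃ i, MvPolynomial.eval (truncJ ((Nat.le_add_right k t).trans hK) p) (d i) ≠ 0} ∧
      ∀ V l g, IsOpen V → IsUTSField V l →
        (∀ y ∈ V, ∃ i, MvPolynomial.eval (jet k l y) (d i) ≠ 0) →
        (∀ a, ContDiffOn ℝ ∞ (fun y => g y a) V) → ∀ y ∈ V,
          applyCoef (l y) (fun z => applyCoef (N (jet K l z)) g z) y = g y := by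
  classical
  have hk : k ≤ K := (Nat.le_add_right k t).trans hK
  set Ω : Set (JetIdx n (m + 1) m r k → ℝ) := {p | ∃ i, MvPolynomial.eval p (d i) ≠ 0} with hΩd
  have hΩ : IsOpen Ω := by
    rw [hΩd, Set.ofPred_exists]
    exact isOpen_iUnion fun i => isOpen_ne_fun (smooth_eval_jet (d i)).continuous
      continuous_const
  set Δ : (JetIdx n (m + 1) m r k → ℝ) → ℝ := fun p => ∑ i, MvPolynomial.eval p (d i) ^ 2
  have hΔ : ContDiff ℝ ∞ Δ := ContDiff.sum fun i _ => (smooth_eval_jet (d i)).pow 2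
  have hΔ0 : ∀ p ∈ Ω, Δ p ≠ 0 := fun p ⟨i, hi⟩ => by
    have : 0 < Δ p := Finset.sum_pos' (fun j _ => sq_nonneg _)
      ⟨i, Finset.mem_univ i, by positivity⟩
    exact this.ne'
  set G : ι → (JetIdx n (m + 1) m r k → ℝ) → ℝ := fun i p => MvPolynomial.eval p (d i) / Δ p
  have hG : ∀ i, ContDiffOn ℝ ∞ (G i) Ω := fun i =>
    (smooth_eval_jet (d i)).contDiffOn.div hΔ.contDiffOn hΔ0
  have h1 : ∀ i a α (β : Tup n t), IsJetOp hk s Ω fun l g y =>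
      pdl (List.ofFn β.2) (fun y => (c i a α β (jet k l y) * G i (jet k l y)) * g y) y :=
    fun i a α β => by
    have hβ : (β.1 : ℕ) ≤ t := Nat.le_of_lt_succ β.1.2
    exact isJetOp_pdl hΩ (G := fun p => c i a α β p * G i p)
      (((h i).smooth a α β).contDiffOn.mul (hG i)) _ hk
      (by rw [List.length_ofFn]; omega) (by rw [List.length_ofFn]; omega)
  choose b hb hF using h1
  refine ⟨fun p α a γ => ∑ i, ∑ β : Tup n t, (-1) ^ (β.1 : ℕ) * b i a α β γ p, ?_, ?_⟩
  · refine contDiffOn_pi.2 fun α => contDiffOn_pi.2 fun a => contDiffOn_pi.2 fun γ => ?_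
    exact ContDiffOn.sum fun i _ => ContDiffOn.sum fun β _ =>
      contDiffOn_const.mul (hb i a α β γ)
  · intro V l g hV hl hm hg y hy
    have hm' : Set.MapsTo (jet k l) V Ω := hm
    have hGj : ∀ i, ContDiffOn ℝ ∞ (fun y => G i (jet k l y)) V := fun i =>
      (hG i).comp (smooth_jet hV hl.smooth k) hm'
    have hg' : ∀ i a, ContDiffOn ℝ ∞ (fun y => G i (jet k l y) * g y a) V := fun i a =>
      (hGj i).mul (hg a)
    have h2 : Set.EqOn (fun z => applyCoef (fun α a γ => ∑ i, ∑ β : Tup n t,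
        (-1) ^ (β.1 : ℕ) * b i a α β γ (jet K l z)) g z)
        (fun z α => ∑ i, dualOp (c i) l (fun y a => G i (jet k l y) * g y a) z α) V := by
      intro z hz
      funext α
      have h5 : ∀ i a (β : Tup n t), pd β.2 (fun z => c i a α β (jet k l z) *
          (G i (jet k l z) * g z a)) z
          = ∑ γ : Tup n s, b i a α β γ (jet K l z) * pd γ.2 (fun z => g z a) z := by
        intro i a β
        refine (pd_eq_pdl hV ((((h i).smooth a α β).comp_contDiffOn
          (smooth_jet hV hl.smooth k)).mul (hg' i a)) _ hz).trans ?_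
        simp only [Function.comp_def, ← mul_assoc]
        exact hF i a α β V l (fun z => g z a) hV hl.smooth hm' (hg a) z hz
      simp only [applyCoef, dualOp, h5, Finset.sum_mul, Finset.mul_sum, mul_assoc]
      rw [Finset.sum_comm (s := Finset.univ (α := ι))]
      refine Finset.sum_congr rfl fun a _ => ?_
      rw [Finset.sum_comm]
      exact Finset.sum_congr rfl fun i _ => Finset.sum_comm
    rw [applyCoef_congr hV _ h2 hy]
    funext a
    rw [applyCoef_sum Finset.univ hV _
      (fun i _ α => smooth_dualOp hV hl.smooth (h i).smooth (hg' i) α) hy]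
    have h3 := fun i => applyCoef_dualOp (h i) hV hl (hg' i) a hy
    simp only at h3
    simp only [h3]
    have h4 : ∑ i, MvPolynomial.eval (jet k l y) (d i) * (G i (jet k l y) * g y a)
        = Δ (jet k l y) / Δ (jet k l y) * g y a := by
      simp only [G, Finset.sum_div, Finset.sum_mul, Δ]
      refine Finset.sum_congr rfl fun i _ => by ring
    rw [h4, div_self (hΔ0 _ (hm' hy)), one_mul]

end LocalInverse


/-! ### Coefficients and jets under changes of coordinates -/

section Transition

variable {n q m r : ℕ} {V V' : Set (E n)} {θ θ' : E n → E n}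

/-- `θ : V → V'` and `θ' : V' → V` are mutually inverse diffeomorphisms. -/
structure Transition (V V' : Set (E n)) (θ θ' : E n → E n) : Prop where
  isOpen : IsOpen V
  isOpen' : IsOpen V'
  smooth : ContDiffOn ℝ ∞ θ V
  smooth' : ContDiffOn ℝ ∞ θ' V'
  maps : Set.MapsTo θ V V'
  maps' : Set.MapsTo θ' V' V
  left_inv : ∀ z ∈ V, θ' (θ z) = z
  right_inv : ∀ z ∈ V', θ (θ' z) = z

lemma Transition.symm (T : Transition V V' θ θ') : Transition V' V θ' θ :=
  ⟨T.isOpen', T.isOpen, T.smooth', T.smooth, T.maps', T.maps, T.right_inv, T.left_inv⟩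

/-- The coefficients of `∂_β (f ∘ θ')` at `θ z`. -/
noncomputable def trC (θ θ' : E n → E n) (β γ : Tup n r) (z : E n) : ℝ :=
  chainC (fun _ => 1) θ' β.2 γ (θ z)

/-- The coefficients, at `z`, of the operator which in the coordinates `θ` has the coefficients `l`
at `θ z`. -/
noncomputable def Tr (θ θ' : E n → E n) (z : E n) (l : Coef n q m r) : Coef n q m r :=
  fun a α γ => ∑ β, trC θ θ' β γ z * l a α β

/-- The coefficients in the coordinates `z` of an operator given in the coordinates `θ z`. -/
noncomputable def trField (θ θ' : E n → E n) (l : E n → Coef n q m r) : E n → Coef n q m r :=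
  fun z => Tr θ θ' z (l (θ z))

lemma isSymm_tr (z : E n) (l : Coef n q m r) : IsSymm (Tr θ θ' z l) := fun a α j β π => by
  simp only [Tr, trC, chainC_comp_perm]

lemma Transition.smooth_trC (T : Transition V V' θ θ') (β γ : Tup n r) :
    ContDiffOn ℝ ∞ (trC θ θ' β γ) V :=
  ((exists_chainC T.isOpen' T.isOpen T.smooth' T.maps' contDiffOn_const
    (Nat.le_of_lt_succ β.1.2) β.2).1 γ).comp T.smooth T.maps

lemma Transition.smooth_trField (T : Transition V V' θ θ') {l : E n → Coef n q m r}
    (hl : SmoothCoef V' l) : SmoothCoef V (trField θ θ' l) := fun a α γ =>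
  ContDiffOn.sum fun β _ => (T.smooth_trC β γ).mul ((hl a α β).comp T.smooth T.maps)

lemma Transition.applyCoef_tr (T : Transition V V' θ θ') {z : E n} (hz : z ∈ V)
    (l : Coef n q m r) {h : E n → Fin q → ℝ} (hh : ∀ α, ContDiffOn ℝ ∞ (fun y => h y α) V) :
    applyCoef (Tr θ θ' z l) h z = applyCoef l (h ∘ θ') (θ z) := by
  funext a
  refine Finset.sum_congr rfl fun α _ => ?_
  have h1 : ∀ β : Tup n r, pd β.2 (fun y => (h ∘ θ') y α) (θ z)
      = ∑ γ, trC θ θ' β γ z * pd γ.2 (fun y => h y α) z := fun β => by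
    have := (exists_chainC T.isOpen' T.isOpen T.smooth' T.maps' (contDiffOn_const (c := (1 : ℝ)))
      (Nat.le_of_lt_succ β.1.2) β.2).2 _ (hh α) (θ z) (T.maps hz)
    rw [T.left_inv z hz] at this
    simp only [one_mul] at this
    exact this
  simp only [h1, Tr, Finset.sum_mul, Finset.mul_sum]
  rw [Finset.sum_comm]
  exact Finset.sum_congr rfl fun β _ => Finset.sum_congr rfl fun γ _ => by ring

/-- Monomials centred at `z` recover each symmetric coefficient. -/
lemma coef_ext {l l' : Coef n q m r} (hl : IsSymm l) (hl' : IsSymm l') (z : E n)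
    (h : ∀ f : E n → Fin q → ℝ, ContDiff ℝ ∞ f → applyCoef l f z = applyCoef l' f z) :
    l = l' := by
  classical
  have key : ∀ {l : Coef n q m r}, IsSymm l → ∀ a α γ, l a α γ = facInv γ *
      applyCoef l (fun y α' => if α' = α then tens γ.2 z y else 0) z a := by
    intro l hl a α γ
    rw [applyCoef, Finset.sum_eq_single α]
    · simp only [if_true]
      exact (sum_mul_pd_tens (hl a α) γ z).symm
    · intro α' _ hα
      simp only [hα, if_false]
      refine Finset.sum_eq_zero fun β _ => ?_
      rw [pd_eq_pdl isOpen_univ contDiffOn_const _ trivial]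
      have : ∀ w : List (Fin n), pdl w (fun _ : E n => (0 : ℝ)) = fun _ => 0 := fun w => by
        induction w with
        | nil => rfl
        | cons i w ih => rw [pdl_cons, ih, pds_const]
      rw [this, mul_zero]
    · simp
  funext a α γ
  rw [key hl, key hl', h]
  refine contDiff_pi.2 fun α' => ?_
  split_ifs
  · exact smooth_tens _ _
  · exact contDiff_const

lemma Transition.tr_tr (T : Transition V V' θ θ') {z : E n} (hz : z ∈ V) {l : Coef n q m r}
    (hl : IsSymm l) : Tr θ' θ (θ z) (Tr θ θ' z l) = l := by
  refine coef_ext (isSymm_tr _ _) hl (θ z) fun f hf => ?_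
  have hf' : ∀ α, ContDiff ℝ ∞ fun y => f y α := contDiff_pi.1 hf
  rw [T.symm.applyCoef_tr (T.maps hz) _ fun α => (hf' α).contDiffOn, T.left_inv z hz,
    T.applyCoef_tr hz _ (h := f ∘ θ) fun α => (hf' α).comp_contDiffOn T.smooth]
  refine applyCoef_congr T.isOpen' l (fun y hy => ?_) (T.maps hz)
  simp only [Function.comp_apply, T.right_inv y hy]

lemma Transition.trField_trField (T : Transition V V' θ θ') {l : E n → Coef n q m r}
    (hl : ∀ y ∈ V', IsSymm (l y)) : Set.EqOn (trField θ' θ (trField θ θ' l)) l V' := by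
  intro y hy
  have := T.tr_tr (T.maps' hy) (hl (θ (θ' y)) (by rwa [T.right_inv y hy]))
  rw [T.right_inv y hy] at this
  simp only [trField]
  rw [T.right_inv y hy]
  exact this

/-- The transformation of jets of coefficients under a change of coordinates. -/
noncomputable def jetTr {k : ℕ} (θ θ' : E n → E n) (z : E n) (p : JetIdx n q m r k → ℝ) :
    JetIdx n q m r k → ℝ := fun x =>
  ∑ β, ∑ γ : Tup n k, chainC (trC θ θ' β x.2.2.1) θ x.2.2.2.2 γ z * p (x.1, x.2.1, β, γ)

lemma Transition.jet_trField (T : Transition V V' θ θ') {l : E n → Coef n q m r}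
    (hl : SmoothCoef V' l) (k : ℕ) {z : E n} (hz : z ∈ V) :
    jet k (trField θ θ' l) z = jetTr θ θ' z (jet k l (θ z)) := by
  funext x
  have h1 : ∀ β, ContDiffOn ℝ ∞
      (fun y => trC θ θ' β x.2.2.1 y * l (θ y) x.1 x.2.1 β) V := fun β =>
    (T.smooth_trC _ _).mul ((hl _ _ _).comp T.smooth T.maps)
  simp only [jet, jetTr, trField, Tr]
  rw [pd_eq_pdl T.isOpen (ContDiffOn.sum fun β _ => h1 β) _ hz,
    pdl_sum T.isOpen _ Finset.univ (fun β _ => h1 β) hz]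
  refine Finset.sum_congr rfl fun β _ => ?_
  rw [← pd_eq_pdl T.isOpen (h1 β) _ hz]
  exact (exists_chainC T.isOpen T.isOpen' T.smooth T.maps (T.smooth_trC β x.2.2.1)
    (Nat.le_of_lt_succ x.2.2.2.1.2) x.2.2.2.2).2 _ (hl x.1 x.2.1 β) z hz

lemma Transition.smooth_jetTr (T : Transition V V' θ θ') (k : ℕ) :
    ContDiffOn ℝ ∞ (fun x : E n × (JetIdx n q m r k → ℝ) => jetTr θ θ' x.1 x.2)
      (V ×ˢ Set.univ) := by
  refine contDiffOn_pi.2 fun x => ContDiffOn.sum fun β _ => ContDiffOn.sum fun γ _ => ?_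
  refine ContDiffOn.mul ?_ ?_
  · exact ((exists_chainC T.isOpen T.isOpen' T.smooth T.maps (T.smooth_trC β x.2.2.1)
      (Nat.le_of_lt_succ x.2.2.2.1.2) x.2.2.2.2).1 γ).comp contDiffOn_fst fun y hy => hy.1
  · exact ((contDiff_apply ℝ ℝ _).comp contDiff_snd).contDiffOn

end Transition

/-! ### Covariance of the adjoint -/

section Covariance

open MeasureTheory

variable {n q m r : ℕ} {V V' : Set (E n)} {θ θ' : E n → E n}

/-- The absolute value of the Jacobian determinant. -/
noncomputable def jac (θ : E n → E n) (z : E n) : ℝ := |(fderiv ℝ θ z).det|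

lemma Transition.hasFDerivAt (T : Transition V V' θ θ') {z : E n} (hz : z ∈ V) :
    HasFDerivAt θ (fderiv ℝ θ z) z :=
  ((T.smooth.contDiffAt (T.isOpen.mem_nhds hz)).differentiableAt (by simp)).hasFDerivAt

lemma Transition.det_ne_zero (T : Transition V V' θ θ') {z : E n} (hz : z ∈ V) :
    (fderiv ℝ θ z).det ≠ 0 := by
  have h1 := (T.symm.hasFDerivAt (T.maps hz)).comp z (T.hasFDerivAt hz)
  have h2 : HasFDerivAt (θ' ∘ θ) (ContinuousLinearMap.id ℝ (E n)) z :=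
    (hasFDerivAt_id z).congr_of_eventuallyEq
      (Filter.eventuallyEq_of_mem (T.isOpen.mem_nhds hz) fun y hy => T.left_inv y hy)
  have h3 := congrArg ContinuousLinearMap.det (h1.unique h2)
  intro h0
  have h4 : ((fderiv ℝ θ' (θ z)).comp (fderiv ℝ θ z)).det
      = (fderiv ℝ θ' (θ z)).det * (fderiv ℝ θ z).det := LinearMap.det_comp _ _
  rw [h4, h0, mul_zero] at h3
  have h5 : (ContinuousLinearMap.id ℝ (E n)).det = 1 := LinearMap.det_id
  exact zero_ne_one (h3.trans h5)

lemma Transition.jac_pos (T : Transition V V' θ θ') {z : E n} (hz : z ∈ V) : 0 < jac θ z :=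
  abs_pos.2 (T.det_ne_zero hz)

lemma contDiff_det : ContDiff ℝ ∞ fun A : E n →L[ℝ] E n => A.det := by
  have h : (fun A : E n →L[ℝ] E n => A.det)
      = fun A => (Matrix.of fun i j => A (bvec j) i).det := by
    funext A
    have h1 := LinearMap.det_toMatrix (EuclideanSpace.basisFun (Fin n) ℝ).toBasis
      (A : E n →ₗ[ℝ] E n)
    change LinearMap.det (A : E n →ₗ[ℝ] E n) = _
    rw [← h1]
    congr 1
  rw [h]
  simp only [Matrix.det_apply, Matrix.of_apply]
  refine ContDiff.sum fun σ _ => ContDiff.const_smul _ (contDiff_prod fun i _ => ?_)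
  exact (EuclideanSpace.proj (𝕜 := ℝ) (σ i)).contDiff.comp
    (ContinuousLinearMap.apply ℝ (E n) (bvec i)).contDiff

lemma Transition.smooth_jac (T : Transition V V' θ θ') : ContDiffOn ℝ ∞ (jac θ) V := by
  intro z hz
  have h1 : ContDiffOn ℝ ∞ (fun z => (fderiv ℝ θ z).det) V :=
    contDiff_det.comp_contDiffOn (T.smooth.fderiv_of_isOpen T.isOpen (m := ∞) (by simp))
  exact (((contDiffAt_abs (T.det_ne_zero hz)).comp z
    (h1.contDiffAt (T.isOpen.mem_nhds hz)))).contDiffWithinAt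

lemma Transition.integral_eq (T : Transition V V' θ θ') {f : E n → ℝ} (hf : ∀ y ∉ V', f y = 0)
    {g : E n → ℝ} (hg : ∀ y ∉ V, g y = 0) (h : ∀ y ∈ V, g y = jac θ y * f (θ y)) :
    ∫ y, f y = ∫ y, g y := by
  have h1 : θ '' V = V' := Set.Subset.antisymm (Set.image_subset_iff.2 T.maps)
    fun y hy => ⟨θ' y, T.maps' hy, T.right_inv y hy⟩
  have h2 := integral_image_eq_integral_abs_det_fderiv_smul volume T.isOpen.measurableSet
    (fun y hy => (T.hasFDerivAt hy).hasFDerivWithinAt)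
    (fun y hy y' hy' e => by rw [← T.left_inv y hy, ← T.left_inv y' hy', e]) f
  rw [h1, setIntegral_eq_integral_of_forall_compl_eq_zero hf] at h2
  rw [h2, ← setIntegral_eq_integral_of_forall_compl_eq_zero hg]
  refine setIntegral_congr_fun T.isOpen.measurableSet fun y hy => ?_
  simp only [h y hy, jac, smul_eq_mul]

open Classical in
/-- The extension by zero of `φ ∘ θ`. -/
noncomputable def pullTest (V : Set (E n)) (θ : E n → E n) (φ : E n → ℝ) (y : E n) : ℝ :=
  if y ∈ V then φ (θ y) else 0

lemma pullTest_of_mem {φ : E n → ℝ} {y : E n} (hy : y ∈ V) : pullTest V θ φ y = φ (θ y) :=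
  if_pos hy

lemma pullTest_of_notMem {φ : E n → ℝ} {y : E n} (hy : y ∉ V) : pullTest V θ φ y = 0 :=
  if_neg hy

lemma IsTest.comp (T : Transition V V' θ θ') {φ : E n → ℝ} (hφ : IsTest V' φ) :
    IsTest V (pullTest V θ φ) := by
  set K := θ' '' tsupport φ with hK
  have hKc : IsCompact K := hφ.compact.isCompact.image_of_continuousOn
    (T.smooth'.continuousOn.mono hφ.subset)
  have hKV : K ⊆ V := by
    rintro _ ⟨y, hy, rfl⟩
    exact T.maps' (hφ.subset hy)
  have h0 : ∀ y ∉ K, pullTest V θ φ y = 0 := fun y hy => by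
    unfold pullTest
    split_ifs with hV
    · refine image_eq_zero_of_notMem_tsupport fun h => hy ⟨θ y, h, T.left_inv y hV⟩
    · rfl
  have hs : tsupport (pullTest V θ φ) ⊆ K :=
    closure_minimal (fun y hy => by_contra fun h => hy (h0 y h)) hKc.isClosed
  refine ⟨contDiff_iff_contDiffAt.2 fun y => ?_, hKc.of_isClosed_subset (isClosed_tsupport _) hs,
    hs.trans hKV⟩
  by_cases hy : y ∈ V
  · refine (hφ.smooth.contDiffAt.comp y (T.smooth.contDiffAt
      (T.isOpen.mem_nhds hy))).congr_of_eventuallyEq ?_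
    filter_upwards [T.isOpen.mem_nhds hy] with z hz
    exact pullTest_of_mem hz
  · refine (contDiffAt_const (c := (0 : ℝ))).congr_of_eventuallyEq ?_
    filter_upwards [hKc.isClosed.isOpen_compl.mem_nhds fun h => hy (hKV h)] with z hz
    exact h0 z hz

/-- The adjoint acts on densities, whence the Jacobian. The identity is checked weakly: both sides
pair equally with every test function, by the change of variables in the integral and the definition
of the adjoint. -/
lemma Transition.adj_trField (T : Transition V V' θ θ') {l : E n → Coef n q m r}
    (hl : SmoothCoef V' l) {φ : Fin m → E n → ℝ} (hφ : ∀ b, IsTest V' (φ b)) (α : Fin q) :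
    Set.EqOn (adj (trField θ θ' l) (fun b y => jac θ y * pullTest V θ (φ b) y) α)
      (fun y => jac θ y * adj l φ α (θ y)) V := by
  have hl2 := T.smooth_trField hl
  have hψ : ∀ b, IsTest V fun y => jac θ y * pullTest V θ (φ b) y := fun b =>
    IsTest.mul T.isOpen T.smooth_jac ((hφ b).comp T)
  refine eqOn_of_sum_integral_mul_test T.isOpen
    (F := adj (trField θ θ' l) fun b y => jac θ y * pullTest V θ (φ b) y)
    (G := fun α y => jac θ y * adj l φ α (θ y))
    (fun α => (IsTest.adj T.isOpen hl2 hψ α).smooth.contDiffOn)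
    (fun α => T.smooth_jac.mul
      ((IsTest.adj T.isOpen' hl hφ α).smooth.comp_contDiffOn T.smooth)) (fun h hh => ?_) α
  have hz : ∀ {W : Set (E n)} {ψ : E n → ℝ}, IsTest W ψ → ∀ y ∉ W, ψ y = 0 := fun hψ y hy =>
    image_eq_zero_of_notMem_tsupport fun h => hy (hψ.subset h)
  have h1 := integral_applyCoef T.isOpen hl2 (h := fun y α => h α y)
    (fun α => (hh α).smooth.contDiffOn) hψ
  have h2 := integral_applyCoef T.isOpen' hl (h := fun y α => h α (θ' y))
    (fun α => (hh α).smooth.comp_contDiffOn T.smooth') hφ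
  have h3 : ∀ a, ∫ y, applyCoef (l y) (fun y α => h α (θ' y)) y a * φ a y
      = ∫ y, applyCoef (trField θ θ' l y) (fun y α => h α y) y a *
        (jac θ y * pullTest V θ (φ a) y) := fun a => by
    refine T.integral_eq (fun y hy => by rw [hz (hφ a) y hy, mul_zero])
      (fun y hy => by rw [pullTest_of_notMem hy, mul_zero, mul_zero]) fun y hy => ?_
    rw [trField, T.applyCoef_tr hy _ fun α => (hh α).smooth.contDiffOn]
    simp only [pullTest_of_mem hy, Function.comp_def]
    ring
  have h4 : ∀ α, ∫ y, h α (θ' y) * adj l φ α y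
      = ∫ y, jac θ y * adj l φ α (θ y) * h α y := fun α => by
    refine T.integral_eq (fun y hy => by rw [hz (IsTest.adj T.isOpen' hl hφ α) y hy, mul_zero])
      (fun y hy => by rw [hz (hh α) y hy, mul_zero]) fun y hy => ?_
    rw [T.left_inv y hy]
    ring
  simp only [h3, h4] at h2
  rw [← h2, h1]
  simp only [mul_comm]

end Covariance


/-! ### Reduction to one point -/

section Localization

variable {n q m r : ℕ} {V : Set (E n)}

lemma pd_translate {j : ℕ} (β : Fin j → Fin n) (f : E n → ℝ) (w x : E n) :
    pd β (fun y => f (y + w)) x = pd β f (x + w) := by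
  rw [pd, iteratedFDeriv_comp_add_right]
  rfl

lemma adj_translate (l : E n → Coef n q m r) (φ : Fin m → E n → ℝ) (w : E n) (α : Fin q) :
    adj (fun y => l (y + w)) (fun b y => φ b (y + w)) α = fun y => adj l φ α (y + w) := by
  funext y
  simp only [adj, ← pd_translate]

lemma pd_eventuallyEq {j : ℕ} (β : Fin j → Fin n) {f g : E n → ℝ} {y : E n}
    (h : f =ᶠ[nhds y] g) : pd β f =ᶠ[nhds y] pd β g :=
  (h.iteratedFDeriv ℝ j).mono fun z hz => by rw [pd, hz]; rfl

lemma adj_eventuallyEq (l : E n → Coef n q m r) {φ ψ : Fin m → E n → ℝ} {y : E n}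
    (h : ∀ b, φ b =ᶠ[nhds y] ψ b) (α : Fin q) : adj l φ α =ᶠ[nhds y] adj l ψ α := by
  have h1 : ∀ b (β : Tup n r), pd β.2 (fun z => l z b α β * φ b z)
      =ᶠ[nhds y] pd β.2 (fun z => l z b α β * ψ b z) := fun b β =>
    pd_eventuallyEq _ ((h b).mono fun z hz => by simp only [hz])
  filter_upwards [Filter.eventually_all.2 fun b => Filter.eventually_all.2 (h1 b)] with z hz
  simp only [adj, hz]

lemma exists_isTest_eventuallyEq (hV : IsOpen V) {y : E n} (hy : y ∈ V) {f : E n → ℝ}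
    (hf : ContDiffOn ℝ ∞ f V) : ∃ ψ, IsTest V ψ ∧ ψ =ᶠ[nhds y] f := by
  obtain ⟨ε, hε, hεV⟩ := Metric.nhds_basis_closedBall.mem_iff.1 (hV.mem_nhds hy)
  let χ : ContDiffBump y := ⟨ε / 2, ε, half_pos hε, half_lt_self hε⟩
  have hχ : IsTest V χ := ⟨χ.contDiff, χ.hasCompactSupport, by rw [χ.tsupport_eq]; exact hεV⟩
  refine ⟨_, IsTest.mul hV hf hχ, ?_⟩
  filter_upwards [χ.eventuallyEq_one] with z hz
  rw [hz, Pi.one_apply, mul_one]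

/-- Neither `d` nor `c` involves the base point, so a translation moves any point to `y₀`. Only
germs matter, so the functions may be taken with compact support. -/
lemma IsAdjLeftInverse.of_point {k t : ℕ} {d : MvPolynomial (JetIdx n (m + 1) m r k) ℝ}
    {c : Fin m → Fin (m + 1) → Tup n t → (JetIdx n (m + 1) m r k → ℝ) → ℝ}
    (hc : ∀ a α β, ContDiff ℝ ∞ (c a α β)) {V₀ : Set (E n)} (hV₀ : IsOpen V₀) {y₀ : E n}
    (hy₀ : y₀ ∈ V₀)
    (h : ∀ V l φ, IsOpen V → V ⊆ V₀ → y₀ ∈ V → IsUTSField V l → (∀ b, IsTest V (φ b)) → ∀ a,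
      ∑ α, ∑ β, c a α β (jet k l y₀) * pd β.2 (adj l φ α) y₀
        = MvPolynomial.eval (jet k l y₀) d * φ a y₀) : IsAdjLeftInverse d c := by
  refine ⟨hc, fun V l φ hV hl hφ y hy a => ?_⟩
  obtain ⟨w, rfl⟩ : ∃ w, y = y₀ + w := ⟨y - y₀, by abel⟩
  have hcont : Continuous fun x : E n => x + w := by fun_prop
  set V₁ := (fun x => x + w) ⁻¹' V ∩ V₀
  have hV₁ : IsOpen V₁ := (hV.preimage hcont).inter hV₀
  have hm : Set.MapsTo (fun x : E n => x + w) V₁ V := fun x hx => hx.1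
  have hsm : ContDiffOn ℝ ∞ (fun x : E n => x + w) V₁ :=
    (contDiff_id.add contDiff_const).contDiffOn
  have hy1 : y₀ ∈ V₁ := ⟨hy, hy₀⟩
  have hl1 : IsUTSField V₁ fun x => l (x + w) :=
    ⟨fun a α β => (hl.smooth a α β).comp hsm hm, fun x hx => hl.symm _ (hm hx),
      fun x hx => hl.uts _ (hm hx)⟩
  choose ψ hψ hψe using fun b => exists_isTest_eventuallyEq hV₁ hy1 ((hφ b).comp hsm hm)
  have h1 := h V₁ _ ψ hV₁ (fun x hx => hx.2) hy1 hl1 hψ a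
  have h2 : jet k (fun x => l (x + w)) y₀ = jet k l (y₀ + w) := by
    funext x
    exact pd_translate x.2.2.2.2 (fun y => l y x.1 x.2.1 x.2.2.1) w y₀
  have h3 : ∀ α (β : Tup n t), pd β.2 (adj (fun x => l (x + w)) ψ α) y₀
      = pd β.2 (adj l φ α) (y₀ + w) := fun α β => by
    rw [← pd_translate, ← adj_translate]
    exact (pd_eventuallyEq _ (adj_eventuallyEq _ hψe α)).eq_of_nhds
  rw [h2, (hψe a).eq_of_nhds] at h1
  simp only [h3] at h1
  exact h1

end Localization

/-! ### Invariance of the good jets -/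

section Transport

variable {n m r : ℕ} {V V' : Set (E n)} {θ θ' : E n → E n}

lemma Transition.restrict (T : Transition V V' θ θ') {W : Set (E n)} (hW : IsOpen W)
    (h : W ⊆ V') : Transition (V ∩ θ ⁻¹' W) W θ θ' where
  isOpen := T.smooth.continuousOn.isOpen_inter_preimage T.isOpen hW
  isOpen' := hW
  smooth := T.smooth.mono Set.inter_subset_left
  smooth' := T.smooth'.mono h
  maps := fun _ hx => hx.2
  maps' := fun x hx => ⟨T.maps' (h hx), by rwa [Set.mem_preimage, T.right_inv x (h hx)]⟩
  left_inv := fun z hz => T.left_inv z hz.1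
  right_inv := fun z hz => T.right_inv z (h hz)

/-- The change of coordinates maps upper totally symmetric coefficients on `V'` to upper totally
symmetric coefficients on `V`. -/
def PreservesUTS (m r : ℕ) (V : Set (E n)) (θ θ' : E n → E n) : Prop :=
  ∀ z ∈ V, ∀ l : Coef n (m + 1) m r, IsSymm l → IsUTS l → IsUTS (Tr θ θ' z l)

lemma Transition.isUTSField_trField (T : Transition V V' θ θ') (hp : PreservesUTS m r V θ θ')
    {l : E n → Coef n (m + 1) m r} (hl : IsUTSField V' l) : IsUTSField V (trField θ θ' l) :=
  ⟨T.smooth_trField hl.smooth, fun _ _ => isSymm_tr _ _,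
    fun y hy => hp y hy _ (hl.symm _ (T.maps hy)) (hl.uts _ (T.maps hy))⟩

/-- Conjugate the left inverse by the change of coordinates and freeze the transformation at the
single point `z`. The new factor is then a polynomial with constant coefficients, and
`IsAdjLeftInverse.of_point` extends the identity from that point to all others. -/
lemma Transition.exists_isAdjLeftInverse (T : Transition V V' θ θ')
    (hp : PreservesUTS m r V θ θ') {k t : ℕ} {d : MvPolynomial (JetIdx n (m + 1) m r k) ℝ}
    {c : Fin m → Fin (m + 1) → Tup n t → (JetIdx n (m + 1) m r k → ℝ) → ℝ}
    (h : IsAdjLeftInverse d c) {z : E n} (hz : z ∈ V) :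
    ∃ (d' : MvPolynomial (JetIdx n (m + 1) m r k) ℝ)
      (c' : Fin m → Fin (m + 1) → Tup n t → (JetIdx n (m + 1) m r k → ℝ) → ℝ),
      IsAdjLeftInverse d' c' ∧ ∀ q, MvPolynomial.eval q d'
        = jac θ z * MvPolynomial.eval (jetTr θ θ' z q) d := by
  classical
  set d' : MvPolynomial (JetIdx n (m + 1) m r k) ℝ :=
    MvPolynomial.C (jac θ z) * MvPolynomial.bind₁ (fun x => ∑ β, ∑ γ : Tup n k,
      MvPolynomial.C (chainC (trC θ θ' β x.2.2.1) θ x.2.2.2.2 γ z) *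
        MvPolynomial.X (x.1, x.2.1, β, γ)) d with hd'
  have hev : ∀ q, MvPolynomial.eval q d'
      = jac θ z * MvPolynomial.eval (jetTr θ θ' z q) d := fun q => by
    rw [hd', map_mul, MvPolynomial.eval_C, ← MvPolynomial.aeval_eq_eval,
      ← MvPolynomial.aeval_eq_eval]
    simp only [MvPolynomial.aeval_bind₁]
    congr 3
    funext x
    simp [jetTr]
  refine ⟨d', fun a α γ q => ∑ β, c a α β (jetTr θ θ' z q) * chainC (jac θ) θ β.2 γ z,
    IsAdjLeftInverse.of_point ?_ T.isOpen' (T.maps hz) ?_, hev⟩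
  · intro a α γ
    refine ContDiff.sum fun β _ => ContDiff.mul ((h.smooth a α β).comp ?_) contDiff_const
    exact contDiff_pi.2 fun x => ContDiff.sum fun β _ => ContDiff.sum fun γ _ =>
      contDiff_const.mul (contDiff_apply _ _ _)
  · intro W l φ hW hWV hzW hl hφ a
    have T' := T.restrict hW hWV
    have hz' : z ∈ V ∩ θ ⁻¹' W := ⟨hz, hzW⟩
    have hp' : PreservesUTS m r (V ∩ θ ⁻¹' W) θ θ' := fun y hy => hp y hy.1
    have hs : ∀ α, ContDiffOn ℝ ∞ (adj l φ α) W := fun α =>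
      (IsTest.adj hW hl.smooth hφ α).smooth.contDiffOn
    have h1 := h.eq _ _ _ T'.isOpen (T'.isUTSField_trField hp' hl)
      (fun b => (IsTest.mul T'.isOpen T'.smooth_jac ((hφ b).comp T')).smooth.contDiffOn) z hz' a
    have h2 : ∀ α (β : Tup n t), pd β.2 (adj (trField θ θ' l) (fun b y => jac θ y *
        pullTest (V ∩ θ ⁻¹' W) θ (φ b) y) α) z
        = ∑ γ, chainC (jac θ) θ β.2 γ z * pd γ.2 (adj l φ α) (θ z) := fun α β => by
      rw [(pd_eventuallyEq β.2 (Filter.eventuallyEq_of_mem (T'.isOpen.mem_nhds hz')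
        (T'.adj_trField hl.smooth hφ α))).eq_of_nhds]
      exact (exists_chainC T'.isOpen T'.isOpen' T'.smooth T'.maps T'.smooth_jac
        (Nat.le_of_lt_succ β.1.2) β.2).2 _ (hs α) z hz'
    simp only [h2, pullTest_of_mem hz'] at h1
    rw [T'.jet_trField hl.smooth k hz'] at h1
    rw [hev]
    have h3 : jac θ z * MvPolynomial.eval (jetTr θ θ' z (jet k l (θ z))) d * φ a (θ z)
      = MvPolynomial.eval (jetTr θ θ' z (jet k l (θ z))) d * (jac θ z * φ a (θ z)) := by ring
    rw [h3, ← h1]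
    refine Finset.sum_congr rfl fun α _ => ?_
    simp only [Finset.sum_mul, Finset.mul_sum, mul_assoc]
    exact Finset.sum_comm

/-- Coefficients with a given jet at `z`. -/
noncomputable def realize {K : ℕ} (p : JetIdx n (m + 1) m r K → ℝ) (z : E n) :
    E n → Coef n (m + 1) m r :=
  fun y a α β => ∑ γ : Tup n K, facInv γ * p (a, α, β, γ) * tens γ.2 z y

lemma isUTSField_realize {K : ℕ} {p : JetIdx n (m + 1) m r K → ℝ} (hp : p ∈ utsJets n m r K)
    (z : E n) : IsUTSField Set.univ (realize p z) where
  smooth a α β := ContDiffOn.sum fun γ _ =>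
    contDiffOn_const.mul (smooth_tens _ _).contDiffOn
  symm y _ a α j β π := Finset.sum_congr rfl fun γ _ => by
    have := (hp.2 γ).1 a α j β π
    simp only at this
    rw [this]
  uts y _ a α α' β β' π h := Finset.sum_congr rfl fun γ _ => by
    have := (hp.2 γ).2 a α α' β β' π h
    simp only at this
    rw [this]

lemma jet_realize {K : ℕ} {p : JetIdx n (m + 1) m r K → ℝ} (hp : p ∈ utsJets n m r K)
    (z : E n) : jet K (realize p z) z = p := by
  funext x
  obtain ⟨a, α, β, γ⟩ := x
  have h1 : ∀ δ : Tup n K, ContDiffOn ℝ ∞ (fun y => facInv δ * p (a, α, β, δ) * tens δ.2 z y)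
      Set.univ := fun δ => contDiffOn_const.mul (smooth_tens _ _).contDiffOn
  simp only [jet, realize]
  rw [pd_eq_pdl isOpen_univ (ContDiffOn.sum fun δ _ => h1 δ) _ trivial,
    pdl_sum isOpen_univ _ Finset.univ (fun δ _ => h1 δ) trivial,
    ← sum_facInv_mul_pd_tens (F := fun δ => p (a, α, β, δ)) (fun j δ π => hp.1 a α β j δ π) γ z]
  refine Finset.sum_congr rfl fun δ _ => ?_
  rw [pdl_const_mul isOpen_univ _ _ (smooth_tens _ _).contDiffOn trivial,
    pd_eq_pdl isOpen_univ (smooth_tens _ _).contDiffOn _ trivial]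

lemma jet_mem_utsJets {l : E n → Coef n (m + 1) m r} (hV : IsOpen V) (hl : IsUTSField V l)
    {K : ℕ} {y : E n} (hy : y ∈ V) : jet K l y ∈ utsJets n m r K := by
  refine ⟨fun a α β j γ π => pd_comp_perm hV (hl.smooth a α β) γ π hy, fun γ => ⟨?_, ?_⟩⟩
  · intro a α j β π
    exact (pd_eventuallyEq γ.2 (Filter.eventuallyEq_of_mem (hV.mem_nhds hy)
      fun z hz => hl.symm z hz a α j β π)).eq_of_nhds
  · intro a α α' β β' π h
    exact (pd_eventuallyEq γ.2 (Filter.eventuallyEq_of_mem (hV.mem_nhds hy)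
      fun z hz => hl.uts z hz a α α' β β' π h)).eq_of_nhds

/-- The jets at which some operator which is, up to a polynomial factor, a left inverse of the
adjoints has a nonzero factor. -/
def goodJets (n m r t : ℕ) {k K : ℕ} (h : k ≤ K) : Set (JetIdx n (m + 1) m r K → ℝ) :=
  {p ∈ utsJets n m r K | ∃ (d : MvPolynomial (JetIdx n (m + 1) m r k) ℝ)
    (c : Fin m → Fin (m + 1) → Tup n t → (JetIdx n (m + 1) m r k → ℝ) → ℝ),
    IsAdjLeftInverse d c ∧ MvPolynomial.eval (truncJ h p) d ≠ 0}

lemma Transition.jet_mem_goodJets (T : Transition V V' θ θ') (hp : PreservesUTS m r V θ θ')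
    {t k K : ℕ} {h : k ≤ K} {l : E n → Coef n (m + 1) m r} (hl : IsUTSField V' l) {z : E n}
    (hz : z ∈ V) (hg : jet K (trField θ θ' l) z ∈ goodJets n m r t h) :
    jet K l (θ z) ∈ goodJets n m r t h := by
  obtain ⟨-, d, c, hdc, hd⟩ := hg
  obtain ⟨d', c', hdc', hd'⟩ := T.exists_isAdjLeftInverse hp hdc hz
  refine ⟨jet_mem_utsJets T.isOpen' hl (T.maps hz), d', c', hdc', ?_⟩
  rw [truncJ_jet, hd', ← T.jet_trField hl.smooth k hz]
  exact mul_ne_zero (T.jac_pos hz).ne' hd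

lemma jet_eventuallyEq {l l' : E n → Coef n (m + 1) m r} {y : E n} (h : l =ᶠ[nhds y] l') (k : ℕ) :
    jet k l y = jet k l' y := by
  funext x
  exact (pd_eventuallyEq _ (h.mono fun z hz => by simp only [hz])).eq_of_nhds

/-- The jet is realized by a polynomial field of coefficients, which turns the statement about jets
into the one about fields for the inverse change of coordinates. -/
lemma Transition.jetTr_mem_goodJets (T : Transition V V' θ θ') (hp : PreservesUTS m r V θ θ')
    (hp' : PreservesUTS m r V' θ' θ) {t k K : ℕ} {h : k ≤ K}
    {p : JetIdx n (m + 1) m r K → ℝ} (hpg : p ∈ goodJets n m r t h) {z : E n} (hz : z ∈ V) :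
    jetTr θ θ' z p ∈ goodJets n m r t h := by
  have hl : IsUTSField V' (realize p (θ z)) :=
    (isUTSField_realize hpg.1 (θ z)).mono (Set.subset_univ _)
  have hj : jet K (realize p (θ z)) (θ z) = p := jet_realize hpg.1 _
  rw [← hj, ← T.jet_trField hl.smooth K hz]
  have h1 := T.symm.jet_mem_goodJets hp' (T.isUTSField_trField hp hl) (T.maps hz) (t := t) (h := h)
  rw [T.left_inv z hz] at h1
  refine h1 ?_
  rwa [jet_eventuallyEq (Filter.eventuallyEq_of_mem (T.isOpen'.mem_nhds (T.maps hz))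
    (T.trField_trField hl.symm)), hj]

end Transport


/-! ### Charts and extension by zero -/

section ChangeOfCoordinates

variable {n : ℕ} {M : Type*} [TopologicalSpace M] {c c' : OpenPartialHomeomorph M (E n)}

/-- The domain of the change of coordinates from `c` to `c'`. -/
def chartDom (c c' : OpenPartialHomeomorph M (E n)) : Set (E n) :=
  c.target ∩ c.symm ⁻¹' c'.source

/-- The change of coordinates from `c` to `c'`. -/
def chartTr (c c' : OpenPartialHomeomorph M (E n)) : E n → E n := fun y => c' (c.symm y)

lemma chartTr_apply {x : M} (hx : x ∈ c.source) : chartTr c c' (c x) = c' x := by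
  rw [chartTr, c.left_inv hx]

lemma mem_chartDom {x : M} (hx : x ∈ c.source) (hx' : x ∈ c'.source) : c x ∈ chartDom c c' :=
  ⟨c.map_source hx, by rwa [Set.mem_preimage, c.left_inv hx]⟩

lemma isClosed_symm_image [T2Space M] {K : Set (E n)} (hK : IsCompact K) (h : K ⊆ c.target) :
    IsClosed (c.symm '' K) :=
  (hK.image_of_continuousOn (c.continuousOn_symm.mono h)).isClosed

lemma symm_image_subset {K : Set (E n)} (h : K ⊆ c.target) : c.symm '' K ⊆ c.source := by
  rintro _ ⟨y, hy, rfl⟩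
  exact c.map_target (h hy)

end ChangeOfCoordinates

section ExtensionByZero

variable {n : ℕ} {M : Type*} [TopologicalSpace M] {c : OpenPartialHomeomorph M (E n)}
  {G : Type*} [Zero G]

open Classical in
/-- The extension by zero of a function given in the chart `c`. -/
noncomputable def extZ (c : OpenPartialHomeomorph M (E n)) (F : E n → G) (x : M) : G :=
  if x ∈ c.source then F (c x) else 0

lemma extZ_of_mem {F : E n → G} {x : M} (hx : x ∈ c.source) : extZ c F x = F (c x) := if_pos hx

lemma extZ_of_notMem {F : E n → G} {x : M} (hx : x ∉ c.source) : extZ c F x = 0 := if_neg hx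

lemma extZ_symm {F : E n → G} {y : E n} (hy : y ∈ c.target) : extZ c F (c.symm y) = F y := by
  rw [extZ_of_mem (c.map_target hy), c.right_inv hy]

lemma extZ_eq_zero {F : E n → G} {Z : Set M} (h0 : ∀ y ∈ c.target, c.symm y ∉ Z → F y = 0)
    {x : M} (hx : x ∉ Z) : extZ c F x = 0 := by
  by_cases h : x ∈ c.source
  · rw [extZ_of_mem h]
    exact h0 _ (c.map_source h) (by rwa [c.left_inv h])
  · exact extZ_of_notMem h

end ExtensionByZero

section Charts

variable {n : ℕ} {M : Type*} [TopologicalSpace M] [ChartedSpace (E n) M]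
  {G : Type*} [NormedAddCommGroup G] [NormedSpace ℝ G]
  {c c' : OpenPartialHomeomorph M (E n)}

lemma transition_chart (hc : c ∈ IsManifold.maximalAtlas (𝓡 n) ∞ M)
    (hc' : c' ∈ IsManifold.maximalAtlas (𝓡 n) ∞ M) :
    Transition (chartDom c c') (chartDom c' c) (chartTr c c') (chartTr c' c) := by
  have h : ∀ {c c' : OpenPartialHomeomorph M (E n)}, c ∈ IsManifold.maximalAtlas (𝓡 n) ∞ M →
      c' ∈ IsManifold.maximalAtlas (𝓡 n) ∞ M → ContDiffOn ℝ ∞ (chartTr c c') (chartDom c c') := by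
    intro c c' hc hc'
    have h1 := contMDiffOn_of_mem_maximalAtlas hc'
    have h2 := contMDiffOn_symm_of_mem_maximalAtlas hc
    have h3 := h1.comp' h2
    exact contMDiffOn_iff_contDiffOn.1 h3
  have hm : ∀ c c' : OpenPartialHomeomorph M (E n),
      Set.MapsTo (chartTr c c') (chartDom c c') (chartDom c' c) := fun c c' y hy => by
    refine ⟨c'.map_source hy.2, ?_⟩
    rw [Set.mem_preimage, chartTr, c'.left_inv hy.2]
    exact c.map_target hy.1
  have hi : ∀ c c' : OpenPartialHomeomorph M (E n), ∀ z ∈ chartDom c c',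
      chartTr c' c (chartTr c c' z) = z := fun c c' z hz => by
    rw [chartTr, chartTr, c'.left_inv hz.2, c.right_inv hz.1]
  exact ⟨c.isOpen_inter_preimage_symm c'.open_source, c'.isOpen_inter_preimage_symm c.open_source,
    h hc hc', h hc' hc, hm _ _, hm _ _, hi _ _, hi _ _⟩

lemma smooth_chart (hc : c ∈ IsManifold.maximalAtlas (𝓡 n) ∞ M) {h : M → G}
    (hh : ContMDiff (𝓡 n) 𝓘(ℝ, G) ∞ h) : ContDiffOn ℝ ∞ (h ∘ c.symm) c.target :=
  contMDiffOn_iff_contDiffOn.1 (hh.comp_contMDiffOn (contMDiffOn_symm_of_mem_maximalAtlas hc))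

lemma contMDiffAt_of_chart (hc : c ∈ IsManifold.maximalAtlas (𝓡 n) ∞ M) {h : M → G} {F : E n → G}
    (hF : ContDiffOn ℝ ∞ F c.target) {x : M} (hx : x ∈ c.source)
    (hh : h =ᶠ[nhds x] F ∘ c) : ContMDiffAt (𝓡 n) 𝓘(ℝ, G) ∞ h x := by
  refine ContMDiffAt.congr_of_eventuallyEq ?_ hh
  have h1 : ContMDiffOn (𝓡 n) 𝓘(ℝ, G) ∞ (F ∘ c) c.source :=
    (contMDiffOn_iff_contDiffOn.2 hF).comp (contMDiffOn_of_mem_maximalAtlas hc) c.mapsTo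
  exact h1.contMDiffAt (c.open_source.mem_nhds hx)

lemma contMDiff_extZ (hc : c ∈ IsManifold.maximalAtlas (𝓡 n) ∞ M) {F : E n → G}
    (hF : ContDiffOn ℝ ∞ F c.target) {Z : Set M} (hZ : IsClosed Z) (hZc : Z ⊆ c.source)
    (h0 : ∀ y ∈ c.target, c.symm y ∉ Z → F y = 0) : ContMDiff (𝓡 n) 𝓘(ℝ, G) ∞ (extZ c F) := by
  intro x
  by_cases hx : x ∈ c.source
  · refine contMDiffAt_of_chart hc hF hx ?_
    filter_upwards [c.open_source.mem_nhds hx] with z hz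
    exact extZ_of_mem hz
  · refine (contMDiffAt_const (c := (0 : G))).congr_of_eventuallyEq ?_
    filter_upwards [hZ.isOpen_compl.mem_nhds fun h => hx (hZc h)] with z hz
    exact extZ_eq_zero h0 hz

/-- Compatibility of components is tested on global functions only; a cutoff shows that these
realize every germ. The Hausdorff property makes the support closed in `M`. -/
lemma exists_contMDiff_eventuallyEq [T2Space M] (hc : c ∈ IsManifold.maximalAtlas (𝓡 n) ∞ M)
    {y : E n} (hy : y ∈ c.target) {F : E n → G} (hF : ContDiffOn ℝ ∞ F c.target) :
    ∃ h : M → G, ContMDiff (𝓡 n) 𝓘(ℝ, G) ∞ h ∧ h ∘ c.symm =ᶠ[nhds y] F := by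
  obtain ⟨χ, hχ, hχe⟩ := exists_isTest_eventuallyEq c.open_target hy
    (contDiffOn_const (c := (1 : ℝ)))
  refine ⟨extZ c fun z => χ z • F z, contMDiff_extZ hc (hχ.smooth.contDiffOn.smul hF)
    (isClosed_symm_image hχ.compact.isCompact hχ.subset) (symm_image_subset hχ.subset)
    fun z hz hzZ => ?_, ?_⟩
  · rw [image_eq_zero_of_notMem_tsupport fun h => hzZ ⟨z, h, rfl⟩, zero_smul]
  · filter_upwards [c.open_target.mem_nhds hy, hχe] with z hz hz'
    rw [Function.comp_apply, extZ_symm hz, hz', one_smul]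

end Charts

/-! ### Global operators and the bundle of good jets -/

section Operators

variable {n : ℕ} {M : Type*} [TopologicalSpace M] [ChartedSpace (E n) M]
  {𝒜 : Set (OpenPartialHomeomorph M (E n))} {q q' r : ℕ}

lemma applyCoef_eventuallyEq (l : Coef n q q' r) {h h' : E n → Fin q → ℝ} {y : E n}
    (hh : h =ᶠ[nhds y] h') : applyCoef l h y = applyCoef l h' y := by
  funext a
  refine Finset.sum_congr rfl fun α _ => Finset.sum_congr rfl fun β _ => ?_
  rw [(pd_eventuallyEq β.2 (hh.mono fun z hz => by simp only [hz] : (fun z => h z α)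
    =ᶠ[nhds y] fun z => h' z α)).eq_of_nhds]

lemma pd_zero {j : ℕ} (β : Fin j → Fin n) : pd β (fun _ => (0 : ℝ)) = fun _ => 0 := by
  funext y
  have := iteratedFDeriv_fun_zero (𝕜 := ℝ) (E := E n) (F := ℝ) (n := j)
  rw [pd]
  change iteratedFDeriv ℝ j (fun _ => (0 : ℝ)) y _ = 0
  rw [this]
  rfl

lemma applyCoef_zero (l : Coef n q q' r) (y : E n) : applyCoef l (fun _ => 0) y = 0 := by
  funext a
  refine Finset.sum_eq_zero fun α _ => Finset.sum_eq_zero fun β _ => ?_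
  have : pd β.2 (fun z => (fun _ => 0 : E n → Fin q → ℝ) z α) y = 0 := congrFun (pd_zero β.2) y
  rw [this, mul_zero]

lemma contDiffOn_apply {V : Set (E n)} {h : E n → Fin q → ℝ} (hh : ContDiffOn ℝ ∞ h V) (α : Fin q) :
    ContDiffOn ℝ ∞ (fun y => h y α) V := contDiffOn_pi.1 hh α

lemma applyCoef_tr_chart {c c' : OpenPartialHomeomorph M (E n)}
    (hc : c ∈ IsManifold.maximalAtlas (𝓡 n) ∞ M) (hc' : c' ∈ IsManifold.maximalAtlas (𝓡 n) ∞ M)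
    (l : Coef n q q' r) {h : M → Fin q → ℝ} (hh : ContMDiff (𝓡 n) 𝓘(ℝ, Fin q → ℝ) ∞ h) {x : M}
    (hx : x ∈ c.source) (hx' : x ∈ c'.source) :
    applyCoef (Tr (chartTr c c') (chartTr c' c) (c x) l) (h ∘ c.symm) (c x)
      = applyCoef l (h ∘ c'.symm) (c' x) := by
  have T := transition_chart hc hc'
  rw [T.applyCoef_tr (mem_chartDom hx hx') l fun α =>
    (contDiffOn_apply (smooth_chart hc hh) α).mono Set.inter_subset_left, chartTr_apply hx]
  refine applyCoef_congr T.isOpen' l (fun y hy => ?_) (mem_chartDom hx' hx)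
  simp only [Function.comp_apply]
  rw [chartTr, c.left_inv hy.2]

lemma LinPDO.coef_eq_tr [T2Space M] (h𝒜 : 𝒜 ⊆ IsManifold.maximalAtlas (𝓡 n) ∞ M)
    (L : LinPDO 𝒜 q q' r) (c c' : 𝒜) {x : M} (hx : x ∈ c.1.source) (hx' : x ∈ c'.1.source) :
    L.coef c (c.1 x) = Tr (chartTr c.1 c'.1) (chartTr c'.1 c.1) (c.1 x) (L.coef c' (c'.1 x)) := by
  refine coef_ext (L.symm c _ (c.1.map_source hx)) (isSymm_tr _ _) (c.1 x) fun f hf => ?_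
  obtain ⟨h, hh, hhe⟩ := exists_contMDiff_eventuallyEq (h𝒜 c.2) (c.1.map_source hx) hf.contDiffOn
  rw [← applyCoef_eventuallyEq _ hhe, ← applyCoef_eventuallyEq _ hhe,
    applyCoef_tr_chart (h𝒜 c.2) (h𝒜 c'.2) _ hh hx hx']
  exact L.compat c c' h hh x ⟨hx, hx'⟩

lemma LinPDO.coef_eq_trField [T2Space M] (h𝒜 : 𝒜 ⊆ IsManifold.maximalAtlas (𝓡 n) ∞ M)
    (L : LinPDO 𝒜 q q' r) (c c' : 𝒜) : Set.EqOn (L.coef c)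
      (trField (chartTr c.1 c'.1) (chartTr c'.1 c.1) (L.coef c')) (chartDom c.1 c'.1) := by
  intro y hy
  have := L.coef_eq_tr h𝒜 c c' (c.1.map_target hy.1) hy.2
  rwa [c.1.right_inv hy.1] at this

lemma applyCoef_smul (t : ℝ) (l : Coef n q q' r) (h : E n → Fin q → ℝ) (y : E n) :
    applyCoef (fun a α β => t * l a α β) h y = t • applyCoef l h y := by
  funext a
  simp only [applyCoef, Pi.smul_apply, smul_eq_mul, Finset.mul_sum, mul_assoc]

-- The atlas condition `uts_iff` speaks of global operators. Cutting off the operator with constant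
-- coefficients `l` in one chart turns it into a condition on arbitrary symmetric coefficients at a
-- point.
open Classical in
lemma exists_linPDO_coef_eq [T2Space M] (h𝒜 : 𝒜 ⊆ IsManifold.maximalAtlas (𝓡 n) ∞ M) (c : 𝒜)
    {y : E n} (hy : y ∈ c.1.target) {l : Coef n q q' r} (hl : IsSymm l) :
    ∃ L : LinPDO 𝒜 q q' r, L.coef c y = l := by
  obtain ⟨χ, hχ, hχe⟩ := exists_isTest_eventuallyEq c.1.open_target hy
    (contDiffOn_const (c := (1 : ℝ)))
  set f : 𝒜 → E n → Coef n q q' r := fun c' z a α β => if z ∈ chartDom c'.1 c.1 then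
    χ (chartTr c'.1 c.1 z) * Tr (chartTr c'.1 c.1) (chartTr c.1 c'.1) z l a α β else 0 with hf
  -- The value of the operator is the same expression in `x` for every chart `c'`, which gives
  -- compatibility.
  have key : ∀ (c' : 𝒜) (h : M → Fin q → ℝ), ContMDiff (𝓡 n) 𝓘(ℝ, Fin q → ℝ) ∞ h →
      ∀ x ∈ c'.1.source, applyCoef (f c' (c'.1 x)) (h ∘ c'.1.symm) (c'.1 x)
        = if x ∈ c.1.source then χ (c.1 x) • applyCoef l (h ∘ c.1.symm) (c.1 x) else 0 := by
    intro c' h hh x hx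
    split_ifs with hxc
    · have h1 := mem_chartDom hx hxc
      simp only [hf, h1, if_true]
      rw [applyCoef_smul, chartTr_apply hx, applyCoef_tr_chart (h𝒜 c'.2) (h𝒜 c.2) _ hh hx hxc]
    · have h1 : c'.1 x ∉ chartDom c'.1 c.1 := fun h => hxc (by
        have := h.2; rwa [Set.mem_preimage, c'.1.left_inv hx] at this)
      simp only [hf, h1, if_false]
      funext a
      simp [applyCoef]
  refine ⟨⟨f, fun c' z _ a α j β π => ?_, fun c' a α β => ?_, fun c₁ c₂ h hh x hx => ?_⟩, ?_⟩
  · simp only [hf]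
    rw [isSymm_tr z l a α j β π]
  · set T := transition_chart (h𝒜 c'.2) (h𝒜 c.2)
    intro z hz
    by_cases hzd : z ∈ chartDom c'.1 c.1
    · have h1 : ContDiffOn ℝ ∞ (fun z => χ (chartTr c'.1 c.1 z) *
          Tr (chartTr c'.1 c.1) (chartTr c.1 c'.1) z l a α β) (chartDom c'.1 c.1) :=
        (hχ.smooth.comp_contDiffOn T.smooth).mul
          (T.smooth_trField (l := fun _ => l) (fun _ _ _ => contDiffOn_const) a α β)
      refine ((h1.contDiffAt (T.isOpen.mem_nhds hzd)).congr_of_eventuallyEq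
        ?_).contDiffWithinAt
      filter_upwards [T.isOpen.mem_nhds hzd] with w hw
      simp only [hf, hw, if_true]
    · refine ((contDiffAt_const (c := (0 : ℝ))).congr_of_eventuallyEq ?_).contDiffWithinAt
      have hZ := isClosed_symm_image (c := c.1) hχ.compact.isCompact hχ.subset
      have h1 : c'.1.symm z ∉ c.1.symm '' tsupport χ := fun h =>
        hzd ⟨hz, symm_image_subset hχ.subset h⟩
      have h2 := (c'.1.continuousAt_symm hz).preimage_mem_nhds (hZ.isOpen_compl.mem_nhds h1)
      filter_upwards [h2] with w hw
      simp only [hf]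
      split_ifs with hwd
      · have h3 : χ (chartTr c'.1 c.1 w) = 0 := image_eq_zero_of_notMem_tsupport fun h =>
          hw ⟨_, h, by rw [chartTr, c.1.left_inv hwd.2]⟩
        rw [h3, zero_mul]
      · rfl
  · rw [key c₁ h hh x hx.1, key c₂ h hh x hx.2]
  · have hyd : y ∈ chartDom c.1 c.1 := ⟨hy, c.1.map_target hy⟩
    have hχ1 : χ (chartTr c.1 c.1 y) = 1 := by
      rw [chartTr, c.1.right_inv hy]; exact hχe.eq_of_nhds
    simp only [hf, hyd, if_true, hχ1, one_mul]
    refine coef_ext (isSymm_tr _ _) hl y fun g hg => ?_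
    have T := transition_chart (h𝒜 c.2) (h𝒜 c.2)
    rw [T.applyCoef_tr hyd l fun α => (contDiff_pi.1 hg α).contDiffOn]
    have h1 : chartTr c.1 c.1 y = y := c.1.right_inv hy
    rw [h1]
    refine applyCoef_congr T.isOpen _ (fun w hw => ?_) hyd
    rw [Function.comp_apply, chartTr, c.1.right_inv hw.1]

lemma IsUTSAtlas.preservesUTS [T2Space M] {m : ℕ} (h𝒜 : IsUTSAtlas m r 𝒜) (c c' : 𝒜) :
    PreservesUTS m r (chartDom c.1 c'.1) (chartTr c.1 c'.1) (chartTr c'.1 c.1) := by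
  intro z hz l hl hlu
  obtain ⟨L, hL⟩ := exists_linPDO_coef_eq h𝒜.subset_maximalAtlas c'
    ((transition_chart (h𝒜.subset_maximalAtlas c.2) (h𝒜.subset_maximalAtlas c'.2)).maps hz).1 hl
  have h1 := L.coef_eq_trField h𝒜.subset_maximalAtlas c c' hz
  rw [trField, hL] at h1
  rw [← h1]
  have h2 := h𝒜.uts_iff L c c' (c.1.symm z) ⟨c.1.map_target hz.1, hz.2⟩
  rw [c.1.right_inv hz.1] at h2
  refine h2.2 ?_
  change UTS.IsUTS (L.coef c' (chartTr c.1 c'.1 z))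
  rwa [hL]

lemma LinPDO.isUTSField {m : ℕ} {L : LinPDO 𝒜 (m + 1) m r} (hL : L.IsUTS) (c : 𝒜) :
    IsUTSField c.1.target (L.coef c) :=
  ⟨L.smooth c, L.symm c, hL c⟩

lemma LinPDO.jet_eq_jetTr [T2Space M] (h𝒜 : 𝒜 ⊆ IsManifold.maximalAtlas (𝓡 n) ∞ M) {m : ℕ}
    (L : LinPDO 𝒜 (m + 1) m r) (c c' : 𝒜) (k : ℕ) {z : E n} (hz : z ∈ chartDom c.1 c'.1) :
    jet k (L.coef c) z
      = jetTr (chartTr c.1 c'.1) (chartTr c'.1 c.1) z (jet k (L.coef c') (chartTr c.1 c'.1 z)) := by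
  have T := transition_chart (h𝒜 c.2) (h𝒜 c'.2)
  rw [jet_eventuallyEq (Filter.eventuallyEq_of_mem (T.isOpen.mem_nhds hz)
    (L.coef_eq_trField h𝒜 c c')), T.jet_trField _ _ hz]
  exact SmoothCoef.mono (L.smooth c') Set.inter_subset_left

lemma isAlgebraicSubbundle_goodJets [T2Space M] {m : ℕ} (h𝒜 : IsUTSAtlas m r 𝒜) {t k K : ℕ}
    (h : k ≤ K) : IsAlgebraicSubbundle 𝒜 m r K (goodJets n m r t h) := by
  refine ⟨⟨{P | ∃ (d : MvPolynomial (JetIdx n (m + 1) m r k) ℝ)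
    (b : Fin m → Fin (m + 1) → Tup n t → (JetIdx n (m + 1) m r k → ℝ) → ℝ),
    IsAdjLeftInverse d b ∧ MvPolynomial.rename (fun x : JetIdx n (m + 1) m r k =>
      ((x.1, x.2.1, x.2.2.1, upT h x.2.2.2) : JetIdx n (m + 1) m r K)) d = P}, ?_⟩, ?_⟩
  · ext p
    constructor
    · rintro ⟨hp, d, b, hdb, hd⟩
      refine ⟨hp, _, ⟨d, b, hdb, rfl⟩, ?_⟩
      rw [MvPolynomial.eval_rename]
      exact hd
    · rintro ⟨hp, _, ⟨d, b, hdb, rfl⟩, hd⟩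
      refine ⟨hp, d, b, hdb, ?_⟩
      rw [MvPolynomial.eval_rename] at hd
      exact hd
  · have key : ∀ L : LinPDO 𝒜 (m + 1) m r, L.IsUTS → ∀ c c' : 𝒜,
        ∀ x ∈ c.1.source ∩ c'.1.source, jet K (L.coef c) (c.1 x) ∈ goodJets n m r t h →
          jet K (L.coef c') (c'.1 x) ∈ goodJets n m r t h := by
      intro L hL c c' x hx hj
      have T := transition_chart (h𝒜.subset_maximalAtlas c.2) (h𝒜.subset_maximalAtlas c'.2)
      have hz := mem_chartDom hx.1 hx.2
      have h1 := T.jet_mem_goodJets (h𝒜.preservesUTS c c') (t := t) (h := h)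
        ((LinPDO.isUTSField hL c').mono Set.inter_subset_left) hz
      rw [chartTr_apply hx.1] at h1
      refine h1 ?_
      rwa [← jet_eventuallyEq (Filter.eventuallyEq_of_mem (T.isOpen.mem_nhds hz)
        (L.coef_eq_trField h𝒜.subset_maximalAtlas c c'))]
    exact fun L hL c c' x hx => ⟨key L hL c c' x hx, key L hL c' c x hx.symm⟩

end Operators


/-! ### The local right inverse cut off by a function -/

lemma chainC_eq_zero {n j k : ℕ} {ν : E n → ℝ} {θ : E n → E n} {z : E n}
    (h : ν =ᶠ[nhds z] fun _ => 0) (β : Fin j → Fin n) (γ : Tup n k) : chainC ν θ β γ z = 0 := by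
  have h1 : (fun y => ν y * tens γ.2 (θ z) (θ y)) =ᶠ[nhds z] fun _ => 0 :=
    h.mono fun y hy => by simp only [hy, zero_mul]
  rw [chainC, (pd_eventuallyEq β h1).eq_of_nhds, pd_zero, mul_zero]

/-- The ideal spanned by all factors `d` is generated by finitely many of them, so at a jet where
these vanish all do. -/
lemma exists_finite_family {n m r t k K : ℕ} (h : k ≤ K) :
    ∃ (ι : Type) (_ : Fintype ι) (d : ι → MvPolynomial (JetIdx n (m + 1) m r k) ℝ)
      (b : ι → Fin m → Fin (m + 1) → Tup n t → (JetIdx n (m + 1) m r k → ℝ) → ℝ),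
      (∀ i, IsAdjLeftInverse (d i) (b i)) ∧ ∀ p ∈ goodJets n m r t h,
        ∃ i, MvPolynomial.eval (truncJ h p) (d i) ≠ 0 := by
  set 𝔡 : Set (MvPolynomial (JetIdx n (m + 1) m r k) ℝ) :=
    {d | ∃ b : Fin m → Fin (m + 1) → Tup n t → (JetIdx n (m + 1) m r k → ℝ) → ℝ,
      IsAdjLeftInverse d b} with h𝔡
  obtain ⟨F, hF, hFs⟩ := (Submodule.fg_span_iff_fg_span_finset_subset 𝔡).1
    (IsNoetherian.noetherian (Ideal.span 𝔡))
  choose b hb using fun i : F => hF i.2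
  refine ⟨F, inferInstance, fun i => i.1, b, hb, ?_⟩
  rintro p ⟨-, d, c, hdc, hd⟩
  by_contra! hall
  have h1 : Ideal.span (F : Set (MvPolynomial (JetIdx n (m + 1) m r k) ℝ))
      ≤ RingHom.ker (MvPolynomial.eval (truncJ h p)) :=
    Ideal.span_le.2 fun f hf => hall ⟨f, hf⟩
  have h2 : d ∈ Ideal.span 𝔡 := Ideal.subset_span ⟨c, hdc⟩
  exact hd (h1 (by rw [Ideal.span, ← hFs]; exact h2))

lemma contDiffOn_comp_fst {X₁ X₂ Y Z : Type*} [NormedAddCommGroup X₁] [NormedSpace ℝ X₁]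
    [NormedAddCommGroup X₂] [NormedSpace ℝ X₂] [NormedAddCommGroup Y] [NormedSpace ℝ Y]
    [NormedAddCommGroup Z] [NormedSpace ℝ Z] {f : X₂ → Y → Z} {U : Set X₂}
    (hf : ContDiffOn ℝ ∞ (fun x : X₂ × Y => f x.1 x.2) (U ×ˢ Set.univ)) {V : Set X₁} {θ : X₁ → X₂}
    (hθ : ContDiffOn ℝ ∞ θ V) (hm : Set.MapsTo θ V U) (S : Set Y) :
    ContDiffOn ℝ ∞ (fun x : X₁ × Y => f (θ x.1) x.2) (V ×ˢ S) :=
  hf.comp ((hθ.comp contDiffOn_fst fun _ hy => hy.1).prodMk contDiffOn_snd)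
    fun _ hy => ⟨hm hy.1, Set.mem_univ _⟩

section Pieces

variable {n m r s K : ℕ} {M : Type*} [TopologicalSpace M]

/-- The operator with coefficients `N` at the jets of `l`, applied in the chart `i` to `ρ g`. -/
noncomputable def pieceF (N : (JetIdx n (m + 1) m r K → ℝ) → Coef n m (m + 1) s) (ρ : M → ℝ)
    (i : OpenPartialHomeomorph M (E n)) (l : E n → Coef n (m + 1) m r) (g : M → Fin m → ℝ) :
    E n → Fin (m + 1) → ℝ :=
  fun y => applyCoef (N (jet K l y)) (fun z a => ρ (i.symm z) * g (i.symm z) a) y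

open Classical in
/-- The coefficients in the chart `c` of the operator `pieceF`. -/
noncomputable def pieceA (N : (JetIdx n (m + 1) m r K → ℝ) → Coef n m (m + 1) s) (ρ : M → ℝ)
    (c i : OpenPartialHomeomorph M (E n)) (x : E n × (JetIdx n (m + 1) m r K → ℝ)) :
    Coef n m (m + 1) s := fun α a γ =>
  if x.1 ∈ chartDom c i then ∑ β : Tup n s,
    N (jetTr (chartTr i c) (chartTr c i) (chartTr c i x.1) x.2) α a β *
      chainC (ρ ∘ i.symm) (chartTr i c) β.2 γ (chartTr c i x.1) else 0

variable {N : (JetIdx n (m + 1) m r K → ℝ) → Coef n m (m + 1) s} {ρ : M → ℝ}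
  {c i : OpenPartialHomeomorph M (E n)}

lemma eventually_eq_zero_of_notMem_tsupport {x : M} (hx : x ∉ tsupport ρ) :
    ∀ᶠ y in nhds x, ρ y = 0 := by
  filter_upwards [(isClosed_tsupport ρ).isOpen_compl.mem_nhds hx] with y hy
  exact image_eq_zero_of_notMem_tsupport hy

lemma pieceF_eq_zero (l : E n → Coef n (m + 1) m r) (g : M → Fin m → ℝ) {y : E n}
    (hy : y ∈ i.target) (hyρ : i.symm y ∉ tsupport ρ) : pieceF N ρ i l g y = 0 := by
  have h1 : (fun z a => ρ (i.symm z) * g (i.symm z) a) =ᶠ[nhds y] fun _ => (0 : Fin m → ℝ) := by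
    filter_upwards [(i.continuousAt_symm hy).eventually
      (eventually_eq_zero_of_notMem_tsupport hyρ)] with z hz
    funext a
    rw [hz, zero_mul, Pi.zero_apply]
  rw [pieceF, applyCoef_eventuallyEq _ h1, applyCoef_zero]

lemma extZ_pieceF_eq_zero (l : E n → Coef n (m + 1) m r) (g : M → Fin m → ℝ) {x : M}
    (hx : x ∉ tsupport ρ) : extZ i (pieceF N ρ i l g) x = 0 :=
  extZ_eq_zero (fun _ hy hyρ => pieceF_eq_zero l g hy hyρ) hx

variable [ChartedSpace (E n) M]

lemma pieceA_eq_zero (hc : c ∈ IsManifold.maximalAtlas (𝓡 n) ∞ M)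
    (hi : i ∈ IsManifold.maximalAtlas (𝓡 n) ∞ M) {x : E n × (JetIdx n (m + 1) m r K → ℝ)}
    (hxρ : c.symm x.1 ∉ tsupport ρ) : pieceA N ρ c i x = 0 := by
  funext α a γ
  rw [pieceA]
  split_ifs with hd
  · have T := transition_chart hc hi
    have h1 : i.symm (chartTr c i x.1) = c.symm x.1 := i.left_inv hd.2
    have h2 : ρ ∘ i.symm =ᶠ[nhds (chartTr c i x.1)] fun _ => 0 :=
      (i.continuousAt_symm (T.maps hd).1).eventually
        (eventually_eq_zero_of_notMem_tsupport (by rwa [h1]))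
    exact Finset.sum_eq_zero fun β _ => by rw [chainC_eq_zero h2, mul_zero]
  · rfl

lemma smooth_mul_chart (hi : i ∈ IsManifold.maximalAtlas (𝓡 n) ∞ M)
    (hρ : ContMDiff (𝓡 n) 𝓘(ℝ, ℝ) ∞ ρ) {g : M → Fin m → ℝ}
    (hg : ContMDiff (𝓡 n) 𝓘(ℝ, Fin m → ℝ) ∞ g) (a : Fin m) :
    ContDiffOn ℝ ∞ (fun z => ρ (i.symm z) * g (i.symm z) a) i.target :=
  (smooth_chart hi hρ).mul (contDiffOn_apply (smooth_chart hi hg) a)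

lemma contMDiff_extZ_pieceF {S : Set (JetIdx n (m + 1) m r K → ℝ)} (hN : ContDiffOn ℝ ∞ N S)
    (hi : i ∈ IsManifold.maximalAtlas (𝓡 n) ∞ M) (hρ : ContMDiff (𝓡 n) 𝓘(ℝ, ℝ) ∞ ρ)
    (hρi : tsupport ρ ⊆ i.source) {l : E n → Coef n (m + 1) m r} (hl : SmoothCoef i.target l)
    (hj : ∀ y ∈ i.target, jet K l y ∈ S) {g : M → Fin m → ℝ}
    (hg : ContMDiff (𝓡 n) 𝓘(ℝ, Fin m → ℝ) ∞ g) :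
    ContMDiff (𝓡 n) 𝓘(ℝ, Fin (m + 1) → ℝ) ∞ (extZ i (pieceF N ρ i l g)) := by
  refine contMDiff_extZ hi ?_ (isClosed_tsupport ρ) hρi fun y hy hyρ => pieceF_eq_zero l g hy hyρ
  have h1 : ContDiffOn ℝ ∞ (fun y => N (jet K l y)) i.target :=
    hN.comp (smooth_jet i.open_target hl _) hj
  exact contDiffOn_pi.2 fun α => smooth_applyCoef (l := fun y => N (jet K l y)) i.open_target
    (fun a α β => contDiffOn_pi.1 (contDiffOn_pi.1 (contDiffOn_pi.1 h1 a) α) β)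
    (smooth_mul_chart hi hρ hg) α

/-- Inside the domain of `i`, invariance of `S` keeps the argument of `N` in the domain of
smoothness. Outside it, the point is off the support of `ρ` and the coefficients vanish nearby. -/
lemma contDiffOn_pieceA {S : Set (JetIdx n (m + 1) m r K → ℝ)} (hN : ContDiffOn ℝ ∞ N S)
    (hc : c ∈ IsManifold.maximalAtlas (𝓡 n) ∞ M) (hi : i ∈ IsManifold.maximalAtlas (𝓡 n) ∞ M)
    (hS : ∀ z ∈ chartDom i c, ∀ p ∈ S, jetTr (chartTr i c) (chartTr c i) z p ∈ S)
    (hρ : ContMDiff (𝓡 n) 𝓘(ℝ, ℝ) ∞ ρ) (hρi : tsupport ρ ⊆ i.source) :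
    ContDiffOn ℝ ∞ (pieceA N ρ c i) (c.target ×ˢ S) := by
  intro x hx
  have T := transition_chart hc hi
  have hcont : ContinuousAt (fun y : E n × (JetIdx n (m + 1) m r K → ℝ) => c.symm y.1) x :=
    (c.continuousAt_symm hx.1).comp continuousAt_fst
  by_cases hd : x.1 ∈ chartDom c i
  · have hnh : ∀ᶠ y : E n × (JetIdx n (m + 1) m r K → ℝ) in nhds x, y.1 ∈ chartDom c i :=
      continuousAt_fst.eventually (T.isOpen.mem_nhds hd)
    have h0 : ContDiffOn ℝ ∞ (fun y : E n × (JetIdx n (m + 1) m r K → ℝ) => chartTr c i y.1)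
        (chartDom c i ×ˢ S) := T.smooth.comp contDiffOn_fst fun y hy => hy.1
    have h1 : ContDiffOn ℝ ∞ (fun y : E n × (JetIdx n (m + 1) m r K → ℝ) =>
        jetTr (chartTr i c) (chartTr c i) (chartTr c i y.1) y.2) (chartDom c i ×ˢ S) :=
      contDiffOn_comp_fst (f := fun z p => jetTr (chartTr i c) (chartTr c i) z p)
        (T.symm.smooth_jetTr K) T.smooth T.maps S
    have h2 := hN.comp h1 fun y hy => hS _ (T.maps hy.1) _ hy.2
    have h3 : ContDiffOn ℝ ∞ (pieceA N ρ c i) (chartDom c i ×ˢ S) := by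
      refine contDiffOn_pi.2 fun α => contDiffOn_pi.2 fun a => contDiffOn_pi.2 fun γ => ?_
      have h4 : ContDiffOn ℝ ∞ (fun x : E n × (JetIdx n (m + 1) m r K → ℝ) =>
          ∑ β : Tup n s, N (jetTr (chartTr i c) (chartTr c i) (chartTr c i x.1) x.2) α a β *
            chainC (ρ ∘ i.symm) (chartTr i c) β.2 γ (chartTr c i x.1)) (chartDom c i ×ˢ S) := by
        refine ContDiffOn.sum fun β _ => ContDiffOn.mul ?_ ?_
        · exact contDiffOn_pi.1 (contDiffOn_pi.1 (contDiffOn_pi.1 h2 α) a) β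
        · exact ((exists_chainC T.isOpen' T.isOpen T.smooth' T.maps'
            ((smooth_chart hi hρ).mono Set.inter_subset_left)
            (Nat.le_of_lt_succ β.1.2) β.2).1 γ).comp h0 fun y hy => T.maps hy.1
      exact h4.congr fun y hy => if_pos hy.1
    refine (h3 x ⟨hd, hx.2⟩).mono_of_mem_nhdsWithin ?_
    filter_upwards [self_mem_nhdsWithin, Filter.Eventually.filter_mono nhdsWithin_le_nhds hnh]
      with y hy hy'
    exact ⟨hy', hy.2⟩
  · have h1 : c.symm x.1 ∉ tsupport ρ := fun h => hd ⟨hx.1, hρi h⟩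
    refine (contDiffWithinAt_const (c := (0 : Coef n m (m + 1) s))).congr_of_eventuallyEq ?_
      (pieceA_eq_zero hc hi h1)
    filter_upwards [Filter.Eventually.filter_mono nhdsWithin_le_nhds
      (hcont.eventually ((isClosed_tsupport ρ).isOpen_compl.mem_nhds h1))] with y hy'
    exact pieceA_eq_zero hc hi hy'

lemma extZ_pieceF_eq (hc : c ∈ IsManifold.maximalAtlas (𝓡 n) ∞ M)
    (hi : i ∈ IsManifold.maximalAtlas (𝓡 n) ∞ M) (hρ : ContMDiff (𝓡 n) 𝓘(ℝ, ℝ) ∞ ρ)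
    (hρi : tsupport ρ ⊆ i.source) {l l' : E n → Coef n (m + 1) m r}
    (hll' : ∀ z ∈ chartDom i c,
      jet K l z = jetTr (chartTr i c) (chartTr c i) z (jet K l' (chartTr i c z)))
    {g : M → Fin m → ℝ} (hg : ContMDiff (𝓡 n) 𝓘(ℝ, Fin m → ℝ) ∞ g) {x : M} (hx : x ∈ c.source) :
    extZ i (pieceF N ρ i l g) x
      = applyCoef (pieceA N ρ c i (c x, jet K l' (c x))) (g ∘ c.symm) (c x) := by
  by_cases hxi : x ∈ i.source
  · have T := transition_chart hc hi
    have hd := mem_chartDom hx hxi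
    have hd' := mem_chartDom hxi hx
    have h1 := hll' _ hd'
    rw [chartTr_apply hxi] at h1
    have h2 : ∀ a (β : Tup n s), pd β.2 (fun z => ρ (i.symm z) * g (i.symm z) a) (i x)
        = ∑ γ : Tup n s, chainC (ρ ∘ i.symm) (chartTr i c) β.2 γ (i x) *
          pd γ.2 (fun z => (g ∘ c.symm) z a) (c x) := by
      intro a β
      have h3 := (exists_chainC T.isOpen' T.isOpen T.smooth' T.maps'
        ((smooth_chart hi hρ).mono Set.inter_subset_left) (Nat.le_of_lt_succ β.1.2) β.2).2 _
        ((contDiffOn_apply (smooth_chart hc hg) a).mono Set.inter_subset_left) (i x) hd'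
      rw [chartTr_apply hxi] at h3
      rw [← h3]
      refine (pd_eventuallyEq β.2 (Filter.eventuallyEq_of_mem (T.isOpen'.mem_nhds hd')
        fun z hz => ?_)).eq_of_nhds
      simp only [Function.comp_apply]
      rw [chartTr, c.left_inv hz.2]
    have h4 : ∀ α a γ, pieceA N ρ c i (c x, jet K l' (c x)) α a γ = ∑ β : Tup n s,
        N (jet K l (i x)) α a β * chainC (ρ ∘ i.symm) (chartTr i c) β.2 γ (i x) :=
      fun α a γ => by
        rw [pieceA, if_pos hd]
        simp only [chartTr_apply hx, h1]
    rw [extZ_of_mem hxi, pieceF]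
    funext α
    simp only [applyCoef, h2, h4, Finset.mul_sum, Finset.sum_mul, ← mul_assoc]
    exact Finset.sum_congr rfl fun a _ => Finset.sum_comm
  · have h1 : x ∉ tsupport ρ := fun h => hxi (hρi h)
    rw [extZ_pieceF_eq_zero l g h1, pieceA_eq_zero hc hi (by rwa [c.left_inv hx])]
    funext α
    simp [applyCoef]

/-- The cutoff stands inside the right inverse, on `g`, so no derivative of it survives the
composition. -/
lemma LinPDO.applyCoef_extZ_pieceF {𝒜 : Set (OpenPartialHomeomorph M (E n))}
    (L : LinPDO 𝒜 (m + 1) m r) (c i : 𝒜) (hρi : tsupport ρ ⊆ i.1.source) {g : M → Fin m → ℝ}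
    (hs : ContMDiff (𝓡 n) 𝓘(ℝ, Fin (m + 1) → ℝ) ∞ (extZ i.1 (pieceF N ρ i.1 (L.coef i) g)))
    (hloc : ∀ y ∈ i.1.target, applyCoef (L.coef i y) (pieceF N ρ i.1 (L.coef i) g) y
      = fun a => ρ (i.1.symm y) * g (i.1.symm y) a) {x : M} (hx : x ∈ c.1.source) :
    applyCoef (L.coef c (c.1 x)) (extZ i.1 (pieceF N ρ i.1 (L.coef i) g) ∘ c.1.symm) (c.1 x)
      = ρ x • g x := by
  by_cases hxi : x ∈ i.1.source
  · have h1 : Set.EqOn (extZ i.1 (pieceF N ρ i.1 (L.coef i) g) ∘ i.1.symm)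
        (pieceF N ρ i.1 (L.coef i) g) i.1.target := fun y hy => extZ_symm hy
    rw [L.compat c i _ hs x ⟨hx, hxi⟩, applyCoef_congr i.1.open_target _ h1 (i.1.map_source hxi),
      hloc _ (i.1.map_source hxi), i.1.left_inv hxi]
    rfl
  · have h2 : x ∉ tsupport ρ := fun h => hxi (hρi h)
    have h3 : extZ i.1 (pieceF N ρ i.1 (L.coef i) g) ∘ c.1.symm =ᶠ[nhds (c.1 x)] fun _ => 0 := by
      have h4 := c.1.continuousAt_symm (c.1.map_source hx)
      rw [ContinuousAt, c.1.left_inv hx] at h4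
      filter_upwards [h4.eventually ((isClosed_tsupport ρ).isOpen_compl.mem_nhds h2)] with y hy
      exact extZ_pieceF_eq_zero _ _ hy
    rw [applyCoef_eventuallyEq _ h3, applyCoef_zero, image_eq_zero_of_notMem_tsupport h2,
      zero_smul]

end Pieces

/-! ### Gluing by a partition of unity -/

section Gluing

variable {n m r s : ℕ} {M : Type*} [TopologicalSpace M] [T2Space M] [SecondCountableTopology M]
  [ChartedSpace (E n) M] [IsManifold (𝓡 n) ∞ M] {𝒜 : Set (OpenPartialHomeomorph M (E n))}

/-- The operator is the locally finite sum over the charts of the local right inverses applied to `ρ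
i · g`; by linearity `L` maps it to `∑ ρ i · g = g`. -/
theorem exists_isUniversalRightInverse (h𝒜 : IsUTSAtlas m r 𝒜)
    {S : Set (JetIdx n (m + 1) m r (r + s) → ℝ)}
    (hS : ∀ c c' : 𝒜, ∀ z ∈ chartDom c.1 c'.1, ∀ p ∈ S,
      jetTr (chartTr c.1 c'.1) (chartTr c'.1 c.1) z p ∈ S)
    {N : (JetIdx n (m + 1) m r (r + s) → ℝ) → Coef n m (m + 1) s} (hN : ContDiffOn ℝ ∞ N S)
    (hloc : ∀ V l g, IsOpen V → IsUTSField V l → (∀ y ∈ V, jet (r + s) l y ∈ S) →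
      (∀ a, ContDiffOn ℝ ∞ (fun y => g y a) V) → ∀ y ∈ V,
        applyCoef (l y) (fun z => applyCoef (N (jet (r + s) l z)) g z) y = g y) :
    ∃ R, IsUniversalRightInverse 𝒜 m r s S R := by
  have := ChartedSpace.locallyCompactSpace (E n) M
  have hat := h𝒜.subset_maximalAtlas
  obtain ⟨ρ, hρ⟩ := SmoothPartitionOfUnity.exists_isSubordinate (𝓡 n) (s := (Set.univ : Set M))
    isClosed_univ (fun c : 𝒜 => c.1.source) (fun c => c.1.open_source)
    fun x _ => by
      obtain ⟨c, hc, hx⟩ := h𝒜.cover x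
      exact Set.mem_iUnion.2 ⟨⟨c, hc⟩, hx⟩
  have hJ : ∀ L : LinPDO 𝒜 (m + 1) m r, L.JetsIn (r + s) S → ∀ (i : 𝒜), ∀ y ∈ i.1.target,
      jet (r + s) (L.coef i) y ∈ S := fun L hL i y hy => by
    have := hL i (i.1.symm y) (i.1.map_target hy)
    rwa [i.1.right_inv hy] at this
  let P : 𝒜 → LinPDO 𝒜 (m + 1) m r → (M → Fin m → ℝ) → M → Fin (m + 1) → ℝ :=
    fun i L g => extZ i.1 (pieceF N (ρ i) i.1 (L.coef i) g)
  have hP0 : ∀ i L g x, x ∉ tsupport (ρ i) → P i L g x = 0 := fun i L g x hx =>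
    extZ_pieceF_eq_zero _ _ hx
  have hPs : ∀ i L g, L.JetsIn (r + s) S → ContMDiff (𝓡 n) 𝓘(ℝ, Fin m → ℝ) ∞ g →
      ContMDiff (𝓡 n) 𝓘(ℝ, Fin (m + 1) → ℝ) ∞ (P i L g) := fun i L g hLS hg =>
    contMDiff_extZ_pieceF hN (hat i.2) (ρ i).contMDiff (hρ i) (L.smooth i) (hJ L hLS i) hg
  have hfin : ∀ L g (x y : M), ρ.fintsupport y ⊆ ρ.fintsupport x →
      ∑ᶠ i, P i L g y = ∑ i ∈ ρ.fintsupport x, P i L g y := fun L g x y hy =>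
    finsum_eq_sum_of_support_subset _ fun i hi =>
      hy ((ρ.mem_fintsupport_iff y i).2 (by_contra fun h => hi (hP0 i L g y h)))
  refine ⟨fun L g x => ∑ᶠ i, P i L g x, fun c => ?_, fun L hL hLS g hg => ⟨?_, fun c x hx => ?_⟩⟩
  · have hAfin : ∀ x y : E n × (JetIdx n (m + 1) m r (r + s) → ℝ),
        ρ.fintsupport (c.1.symm y.1) ⊆ ρ.fintsupport (c.1.symm x.1) →
        ∑ᶠ i : 𝒜, pieceA N (ρ i) c.1 i.1 y
          = ∑ i ∈ ρ.fintsupport (c.1.symm x.1), pieceA N (ρ i) c.1 i.1 y := fun x y hsub =>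
      finsum_eq_sum_of_support_subset _ fun i hi => hsub
        ((ρ.mem_fintsupport_iff _ i).2 (by_contra fun h =>
          hi (pieceA_eq_zero (hat c.2) (hat i.2) h)))
    refine ⟨fun x => ∑ᶠ i : 𝒜, pieceA N (ρ i) c.1 i.1 x, fun x hx => ?_,
      fun L hL hLS g hg x hx => ?_⟩
    · have hcont : ContinuousAt (fun y : E n × (JetIdx n (m + 1) m r (r + s) → ℝ) =>
        c.1.symm y.1) x := (c.1.continuousAt_symm hx.1).comp continuousAt_fst
      refine (ContDiffWithinAt.sum (s := ρ.fintsupport (c.1.symm x.1)) fun i _ =>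
        contDiffOn_pieceA hN (hat c.2) (hat i.2) (hS i c) (ρ i).contMDiff (hρ i) x
          hx).congr_of_eventuallyEq ?_ (hAfin x x subset_rfl)
      filter_upwards [Filter.Eventually.filter_mono nhdsWithin_le_nhds
        (hcont.eventually (ρ.eventually_fintsupport_subset _))] with y hy'
      exact hAfin x y hy'
    · have key : ∀ i, P i L g x = applyCoef
          (pieceA N (ρ i) c.1 i.1 (c.1 x, jet (r + s) (L.coef c) (c.1 x))) (g ∘ c.1.symm) (c.1 x) :=
        fun i => extZ_pieceF_eq (hat c.2) (hat i.2) (ρ i).contMDiff (hρ i)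
          (fun z hz => L.jet_eq_jetTr hat i c _ hz) hg hx
      have h2 := hAfin (c.1 x, jet (r + s) (L.coef c) (c.1 x))
        (c.1 x, jet (r + s) (L.coef c) (c.1 x)) subset_rfl
      rw [c.1.left_inv hx] at h2
      change ∑ᶠ i, P i L g x = applyCoef
        (∑ᶠ i : 𝒜, pieceA N (ρ i) c.1 i.1 (c.1 x, jet (r + s) (L.coef c) (c.1 x))) _ _
      rw [hfin L g x x subset_rfl, h2]
      funext α
      simp only [key, applyCoef, Finset.sum_apply, Finset.sum_mul]
      rw [Finset.sum_comm]
      exact Finset.sum_congr rfl fun a _ => Finset.sum_comm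
  · refine contMDiff_finsum (fun i => hPs i L g hLS hg) ?_
    refine ρ.locallyFinite.closure.subset fun i x hx => ?_
    exact by_contra fun h => hx (hP0 i L g x h)
  · have h1 : (fun x => ∑ᶠ i, P i L g x) ∘ c.1.symm =ᶠ[nhds (c.1 x)]
        fun y α => ∑ i ∈ ρ.fintsupport x, (P i L g ∘ c.1.symm) y α := by
      have h2 := c.1.continuousAt_symm (c.1.map_source hx)
      rw [ContinuousAt, c.1.left_inv hx] at h2
      filter_upwards [h2.eventually (ρ.eventually_fintsupport_subset x)] with y hy
      funext α
      rw [Function.comp_apply, hfin L g x _ hy, Finset.sum_apply]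
      rfl
    have key : ∀ i, applyCoef (L.coef c (c.1 x)) (P i L g ∘ c.1.symm) (c.1 x) = ρ i x • g x :=
      fun i => L.applyCoef_extZ_pieceF c i (hρ i) (hPs i L g hLS hg)
        (hloc i.1.target (L.coef i) _ i.1.open_target (LinPDO.isUTSField hL i) (hJ L hLS i)
          (smooth_mul_chart (hat i.2) (ρ i).contMDiff hg)) hx
    funext a
    rw [applyCoef_eventuallyEq _ h1, applyCoef_sum (ρ.fintsupport x) c.1.open_target _
      (fun i _ => contDiffOn_apply (smooth_chart (hat c.2) (hPs i L g hLS hg)))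
      (c.1.map_source hx)]
    simp only [key, Pi.smul_apply, smul_eq_mul]
    rw [← Finset.sum_mul, ρ.sum_finsupport' x (Set.mem_univ x) (ρ.finsupport_subset_fintsupport x),
      one_mul]

theorem exists_isUniversalRightInverse_goodJets (h𝒜 : IsUTSAtlas m r 𝒜) {k t : ℕ}
    (hK : k + t ≤ r + s) (ht : t ≤ s) :
    ∃ R, IsUniversalRightInverse 𝒜 m r s
      (goodJets n m r t ((Nat.le_add_right k t).trans hK)) R := by
  obtain ⟨ι, _, d, b, hdb, hfam⟩ := exists_finite_family (n := n) (m := m) (r := r) (t := t)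
    ((Nat.le_add_right k t).trans hK)
  obtain ⟨N, hN, hloc⟩ := exists_local_rightInverse hK ht hdb
  have hN' : ContDiffOn ℝ ∞ N (goodJets n m r t ((Nat.le_add_right k t).trans hK)) :=
    hN.mono hfam
  have hS : ∀ c c' : 𝒜, ∀ z ∈ chartDom c.1 c'.1,
      ∀ p ∈ goodJets n m r t ((Nat.le_add_right k t).trans hK),
        jetTr (chartTr c.1 c'.1) (chartTr c'.1 c.1) z p
          ∈ goodJets n m r t ((Nat.le_add_right k t).trans hK) := fun c c' z hz p hp =>
    (transition_chart (h𝒜.subset_maximalAtlas c.2)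
      (h𝒜.subset_maximalAtlas c'.2)).jetTr_mem_goodJets (h𝒜.preservesUTS c c')
      (h𝒜.preservesUTS c' c) hp hz
  have hloc' : ∀ V l g, IsOpen V → IsUTSField V l →
      (∀ y ∈ V, jet (r + s) l y ∈ goodJets n m r t ((Nat.le_add_right k t).trans hK)) →
      (∀ a, ContDiffOn ℝ ∞ (fun y => g y a) V) → ∀ y ∈ V,
        applyCoef (l y) (fun z => applyCoef (N (jet (r + s) l z)) g z) y = g y :=
    fun V l g hV hl hj hg y hy =>
      hloc V l g hV hl (fun y hy => by
        obtain ⟨i, hi⟩ := hfam _ (hj y hy)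
        rw [truncJ_jet] at hi
        exact ⟨i, hi⟩) hg y hy
  exact exists_isUniversalRightInverse h𝒜 hS hN' hloc'

end Gluing


/-! ### Independent components of upper totally symmetric coefficients -/

section Classes

variable (n m r : ℕ)

/-- Two components are identified if they agree for all upper totally symmetric coefficients. -/
def componentSetoid : Setoid (Fin m × Fin (m + 1) × Tup n r) where
  r x y := ∀ l : Coef n (m + 1) m r, IsSymm l → IsUTS l → l x.1 x.2.1 x.2.2 = l y.1 y.2.1 y.2.2
  iseqv := ⟨fun _ _ _ _ => rfl, fun h l hs hu => (h l hs hu).symm,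
    fun h h' l hs hu => (h l hs hu).trans (h' l hs hu)⟩

/-- The independent components of upper totally symmetric coefficients. -/
def UClass : Type := Quotient (componentSetoid n m r)

instance : Finite (UClass n m r) := inferInstanceAs (Finite (Quotient (componentSetoid n m r)))

variable {n m r}

/-- The independent component to which a component is equal. -/
def uclass (a : Fin m) (α : Fin (m + 1)) (β : Tup n r) : UClass n m r :=
  Quotient.mk (componentSetoid n m r) (a, α, β)

/-- The independent components of an array of coefficients. -/
noncomputable def comp (l : Coef n (m + 1) m r) (c : UClass n m r) : ℝ :=
  l (Quotient.out c).1 (Quotient.out c).2.1 (Quotient.out c).2.2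

lemma comp_uclass {l : Coef n (m + 1) m r} (hs : IsSymm l) (hu : IsUTS l) (a : Fin m)
    (α : Fin (m + 1)) (β : Tup n r) : comp l (uclass a α β) = l a α β :=
  Quotient.mk_out (s := componentSetoid n m r) (a, α, β) l hs hu

lemma uclass_out (c : UClass n m r) :
    uclass (Quotient.out c).1 (Quotient.out c).2.1 (Quotient.out c).2.2 = c := Quotient.out_eq c

lemma isSymm_of_uclass (x : UClass n m r → ℝ) : IsSymm fun a α β => x (uclass a α β) :=
  fun _ _ _ _ _ => congrArg x (Quotient.sound fun _ hs _ => hs _ _ _ _ _)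

lemma isUTS_of_uclass (x : UClass n m r → ℝ) : IsUTS fun a α β => x (uclass a α β) :=
  fun _ _ _ _ _ π h => congrArg x (Quotient.sound fun _ _ hu => hu _ _ _ _ _ π h)

lemma apply_eq_of_uclass_eq {a a' : Fin m} {α α' : Fin (m + 1)} {β β' : Tup n r}
    (h : uclass a α β = uclass a' α' β') {l : Coef n (m + 1) m r} (hs : IsSymm l) (hu : IsUTS l) :
    l a α β = l a' α' β' := by
  rw [← comp_uclass hs hu, h, comp_uclass hs hu]

lemma eq_nilTup_iff {β : Tup n r} : β = nilTup n r ↔ β.1 = 0 := by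
  refine ⟨fun h => by rw [h]; rfl, fun h => ?_⟩
  obtain ⟨j, β⟩ := β
  obtain rfl : j = 0 := h
  exact congrArg (Sigma.mk 0) (funext fun i => i.elim0)

/-- For `r ≥ 1` the symmetry conditions do not touch components of order zero, so the array with a
single such component equal to `1` is admissible and separates it from all others. -/
lemma uclass_nilTup_injective (hr : 1 ≤ r) {a a' : Fin m} {α α' : Fin (m + 1)} {β : Tup n r}
    (h : uclass a α (nilTup n r) = uclass a' α' β) : a = a' ∧ α = α' ∧ β = nilTup n r := by
  classical
  set l : Coef n (m + 1) m r := fun a₁ α₁ β₁ =>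
    if a₁ = a ∧ α₁ = α ∧ β₁ = nilTup n r then 1 else 0 with hl
  have hs : IsSymm l := fun a₁ α₁ j β₁ π => by simp only [hl, eq_nilTup_iff]
  have hu : IsUTS l := fun a₁ α₁ α₂ β₁ β₂ π _ => by
    have : Fin.last r ≠ 0 := fun h => by
      have := congrArg Fin.val h
      simp only [Fin.val_last, Fin.val_zero] at this
      omega
    simp only [hl, eq_nilTup_iff, this, and_false]
  have h1 := apply_eq_of_uclass_eq h hs hu
  simp only [hl, and_self, if_true] at h1
  by_contra hne
  rw [if_neg fun h => hne ⟨h.1.symm, h.2.1.symm, h.2.2⟩] at h1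
  exact one_ne_zero h1

/-- The weight of an independent component: the sum of the indices if it is of highest order. -/
noncomputable def uweight (c : UClass n m r) : ℕ :=
  if (Quotient.out c).2.2.1 = Fin.last r then
    ((Quotient.out c).1 : ℕ) + (Quotient.out c).2.1 + ∑ i, ((Quotient.out c).2.2.2 i : ℕ) else 0

/-- The index sum, as an array, is itself upper totally symmetric, so it does not depend on the
representative. -/
lemma uweight_uclass (a : Fin m) (α : Fin (m + 1)) (β : Fin r → Fin n) :
    uweight (uclass a α ⟨Fin.last r, β⟩) = a + α + ∑ i, (β i : ℕ) := by
  classical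
  set l : Coef n (m + 1) m r := fun a α β =>
    ((if β.1 = Fin.last r then (a : ℕ) + α + ∑ i, (β.2 i : ℕ) else 0 : ℕ) : ℝ) with hl
  have hs : IsSymm l := fun a₁ α₁ j β₁ π => by
    simp only [hl, Function.comp_apply, Equiv.sum_comp π fun i => (β₁ i : ℕ)]
  have hu : IsUTS l := fun a₁ α₁ α₂ β₁ β₂ π h => by
    have h1 := Equiv.sum_comp π (Fin.cons (α₁ : ℕ) (fun i => (β₁ i : ℕ)) : Fin (r + 1) → ℕ)
    have h2 : ∑ i, (Fin.cons (α₂ : ℕ) (fun i => (β₂ i : ℕ)) : Fin (r + 1) → ℕ) i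
        = ∑ i, (Fin.cons (α₁ : ℕ) (fun i => (β₁ i : ℕ)) : Fin (r + 1) → ℕ) i := by
      rw [h, ← h1]; rfl
    simp only [Fin.sum_univ_succ, Fin.cons_zero, Fin.cons_succ] at h2
    simp only [hl, if_true, Nat.cast_inj, add_assoc]
    exact congrArg _ h2
  have h1 := comp_uclass hs hu a α ⟨Fin.last r, β⟩
  simp only [comp, hl, Nat.cast_inj, if_true] at h1
  exact h1

end Classes

/-! ### From differential polynomials to fibre coordinates -/

section ToJet

open MvPolynomial

variable {n m r : ℕ}

open Classical in
/-- A tuple listing the elements of a multiset of at most `k` elements. -/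
noncomputable def tupOf (k : ℕ) (w : Multiset (Fin n)) : Tup n k :=
  if h : Multiset.card w ≤ k then
    ⟨⟨Multiset.card w, Nat.lt_succ_of_le h⟩, fun i => w.toList.get (i.cast (by simp))⟩
  else nilTup n k

lemma ofFn_tupOf {k : ℕ} {w : Multiset (Fin n)} (h : Multiset.card w ≤ k) :
    List.ofFn (tupOf k w).2 = w.toList := by
  rw [tupOf, dif_pos h]
  refine List.ext_get (by simp) fun i h1 h2 => by simp

lemma upT_tupOf {k K : ℕ} (hk : k ≤ K) {w : Multiset (Fin n)} (h : Multiset.card w ≤ k) :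
    upT hk (tupOf k w) = tupOf K w := by
  rw [tupOf, dif_pos h, tupOf, dif_pos (h.trans hk)]
  rfl

/-- The fibre coordinate of the bundle of `k`-jets representing an independent variable. -/
noncomputable def jetVar (k : ℕ) (v : UClass n m r × Multiset (Fin n)) : JetIdx n (m + 1) m r k :=
  ((Quotient.out v.1).1, (Quotient.out v.1).2.1, (Quotient.out v.1).2.2, tupOf k v.2)

lemma eval_rename_eq_of_mem_supported {σ τ τ' : Type} {s : Set σ} {P : MvPolynomial σ ℝ}
    (hP : P ∈ supported ℝ s) {f : σ → τ} {f' : σ → τ'} {x : τ → ℝ} {x' : τ' → ℝ}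
    (h : ∀ v ∈ s, x (f v) = x' (f' v)) : eval x (rename f P) = eval x' (rename f' P) := by
  obtain ⟨Q, rfl⟩ := exists_rename_eq_of_mem_supported (f := (Subtype.val : s → σ))
    (by rwa [Subtype.range_coe])
  simp only [eval_rename]
  exact congrArg (fun g => eval g Q) (funext fun v => h v v.2)

lemma eval_jet_rename {V : Set (E n)} {l : E n → Coef n (m + 1) m r} (hV : IsOpen V)
    (hl : IsUTSField V l) {k : ℕ} {P : JetRing (UClass n m r) n}
    (hP : P ∈ supported ℝ (lowVars (UClass n m r) n k)) {y : E n} (hy : y ∈ V) :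
    eval (jet k l y) (rename (jetVar k) P) = ev (fun c z => comp (l z) c) y P := by
  have h := eval_rename_eq_of_mem_supported hP (f := jetVar k) (f' := id) (x := jet k l y)
    (x' := fun v => pdl v.2.toList (fun z => comp (l z) v.1) y) fun v hv => by
      simp only [id, ← ofFn_tupOf hv]
      exact (pd_eq_pdl hV (hl.smooth _ _ _) _ hy)
  rw [h, rename_id_apply]
  rfl

lemma ev_inc {C : Type} (u : C → E n → ℝ) (φ : Fin m → E n → ℝ) (y : E n) (P : JetRing C n) :
    ev (Sum.elim u φ) y (inc P) = ev u y P := by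
  rw [inc, ev, aeval_rename]
  rfl

lemma ev_jdl_adjE {V : Set (E n)} {l : E n → Coef n (m + 1) m r} (hV : IsOpen V)
    (hl : IsUTSField V l) {φ : Fin m → E n → ℝ} (hφ : ∀ b, ContDiffOn ℝ ∞ (φ b) V)
    (w : List (Fin n)) (α : Fin (m + 1)) :
    Set.EqOn (fun y => ev (Sum.elim (fun c z => comp (l z) c) φ) y (jdl w (adjE uclass α)))
      (pdl w (adj l φ α)) V := by
  set U : UClass n m r ⊕ Fin m → E n → ℝ := Sum.elim (fun c z => comp (l z) c) φ with hU
  have hUs : ∀ a, ContDiffOn ℝ ∞ (U a) V := by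
    rintro (c | b)
    · exact hl.smooth _ _ _
    · exact hφ b
  refine (pdl_ev hV hUs w _).symm.trans (pdl_congr hV w fun y hy => ?_)
  simp only [adjE, map_sum, map_smul, smul_eq_mul, adj]
  refine Finset.sum_congr rfl fun b _ => Finset.sum_congr rfl fun β _ => ?_
  rw [pd_eq_pdl hV ((hl.smooth _ _ _).mul (hφ b)) _ hy]
  refine congrArg _ ((pdl_ev hV hUs _ _ hy).symm.trans (pdl_congr hV _ (fun z hz => ?_) hy))
  simp only [map_mul, ev_X, Multiset.toList_zero]
  change comp (l z) (uclass b α β) * φ b z = _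
  rw [comp_uclass (hl.symm z hz) (hl.uts z hz)]

/-- Evaluation of the formal identity at the derivatives of coefficients and functions. The words of
length at most `t` correspond bijectively to the tuples `Tup n t`. -/
lemma isAdjLeftInverse_of_conseq {k t : ℕ} {d : JetRing (UClass n m r) n}
    (hd : d ∈ supported ℝ (lowVars (UClass n m r) n k))
    {w : Fin m → (Fin (m + 1) × List (Fin n)) →₀ JetRing (UClass n m r) n}
    (hw : ∀ a, inc d * X (Sum.inr a, 0) = (w a).sum fun x p => inc p * jdl x.2 (adjE uclass x.1))
    (hk : ∀ a x, w a x ∈ supported ℝ (lowVars (UClass n m r) n k))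
    (ht : ∀ a, ∀ x ∈ (w a).support, x.2.length ≤ t) :
    IsAdjLeftInverse (t := t) (rename (jetVar k) d : MvPolynomial (JetIdx n (m + 1) m r k) ℝ)
      fun a α β q => eval q (rename (jetVar k) (w a (α, List.ofFn β.2))) := by
  classical
  refine ⟨fun a α β => smooth_eval_jet _, fun V l φ hV hl hφ y hy a => ?_⟩
  set u : UClass n m r → E n → ℝ := fun c z => comp (l z) c with hu
  have h1 := congrArg (ev (Sum.elim u φ) y) (hw a)
  simp only [map_mul, ev_inc, ev_X, Multiset.toList_zero, Finsupp.sum, map_sum] at h1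
  rw [eval_jet_rename hV hl hd hy]
  refine Eq.trans ?_ h1.symm
  have hinj : Function.Injective fun x : Fin (m + 1) × Tup n t => (x.1, List.ofFn x.2.2) := by
    rintro ⟨α, ⟨j, β⟩⟩ ⟨α', ⟨j', β'⟩⟩ h
    obtain ⟨rfl, h2⟩ := Prod.mk.inj h
    have h3 := List.ofFn_inj'.1 h2
    have h4 : j = j' := Fin.ext (Sigma.mk.inj_iff.1 h3).1
    subst h4
    exact congrArg (fun β => (α, (⟨j, β⟩ : Tup n t))) (eq_of_heq (Sigma.mk.inj_iff.1 h3).2)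
  have h2 : (w a).support ⊆ Finset.univ.image
      fun x : Fin (m + 1) × Tup n t => (x.1, List.ofFn x.2.2) := by
    rintro ⟨α, L⟩ hx
    refine Finset.mem_image.2 ⟨(α, ⟨⟨L.length, Nat.lt_succ_of_le (ht a _ hx)⟩, L.get⟩),
      Finset.mem_univ _, ?_⟩
    simp
  rw [Finset.sum_subset h2 fun x _ hx => by
    rw [Finsupp.notMem_support_iff.1 hx, map_zero, zero_mul],
    Finset.sum_image fun x _ y _ h => hinj h, Fintype.sum_prod_type]
  refine Finset.sum_congr rfl fun α _ => Finset.sum_congr rfl fun β _ => ?_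
  rw [eval_jet_rename hV hl (hk a _) hy, pd_eq_pdl hV (smooth_adj hV hl.smooth hφ α) _ hy]
  exact congrArg _ (ev_jdl_adjE hV hl hφ _ _ hy).symm

/-- At jets outside `goodJets`, all multipliers of low order vanish. -/
theorem exists_orders_goodJets (n m r t₀ : ℕ) : ∃ k t, t₀ ≤ k ∧ ∀ (K : ℕ) (h : k ≤ K),
    ∀ p ∈ utsJets n m r K, p ∉ goodJets n m r t h →
      ∀ d ∈ multIdeal (uclass : Fin m → Fin (m + 1) → Tup n r → UClass n m r),
        d ∈ supported ℝ (lowVars (UClass n m r) n t₀) → eval p (rename (jetVar K) d) = 0 := by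
  classical
  set J : Ideal (MvPolynomial (lowVars (UClass n m r) n t₀) ℝ) :=
    (multIdeal uclass).comap (rename Subtype.val) with hJ
  -- Finite generation bounds the orders `k` and `t` of all the left inverses needed; the generators
  -- vanish at a jet that is not good, and with them all multipliers of order at most `t₀`.
  obtain ⟨F, hF⟩ : J.FG := IsNoetherian.noetherian J
  have hFJ : ∀ f : F, ∀ a, ∃ w : (Fin (m + 1) × List (Fin n)) →₀ JetRing (UClass n m r) n,
      inc (rename Subtype.val f.1) * X (Sum.inr a, 0)
        = w.sum fun x p => inc p * jdl x.2 (adjE uclass x.1) := fun f a =>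
    exists_sum_of_mem_conseq ((hF ▸ Ideal.subset_span f.2 : f.1 ∈ J) a)
  choose w hw using hFJ
  choose lev hlev using fun p : JetRing (UClass n m r) n => exists_mem_supported_lowVars p
  set k := max t₀ (Finset.univ.sup fun x : F × Fin m =>
    (w x.1 x.2).support.sup fun y => lev (w x.1 x.2 y)) with hk
  set t := Finset.univ.sup fun x : F × Fin m =>
    (w x.1 x.2).support.sup fun y => y.2.length with ht
  have hF0 : ∀ f : F, rename Subtype.val f.1 ∈ supported ℝ (lowVars (UClass n m r) n t₀) :=
    fun f => by
      rw [supported_eq_range_rename]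
      exact ⟨_, rfl⟩
  refine ⟨k, t, le_max_left _ _, fun K h p hp hpn d hd hd0 => ?_⟩
  have hgen : ∀ f : F, eval p (rename (jetVar K) (rename Subtype.val f.1)) = 0 := by
    intro f
    by_contra hne
    refine hpn ⟨hp, _, _, isAdjLeftInverse_of_conseq (k := k) (t := t)
      (supported_mono' (le_max_left _ _) (hF0 f)) (hw f) (fun a x => ?_) (fun a x hx => ?_), ?_⟩
    · by_cases hx : x ∈ (w f a).support
      · refine supported_mono' (le_trans ?_ (le_max_right _ _)) (hlev _)
        exact le_trans (Finset.le_sup (f := fun y => lev (w f a y)) hx)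
          (Finset.le_sup (f := fun x : F × Fin m =>
            (w x.1 x.2).support.sup fun y => lev (w x.1 x.2 y)) (Finset.mem_univ (f, a)))
      · rw [Finsupp.notMem_support_iff.1 hx]
        exact zero_mem _
    · exact le_trans (Finset.le_sup (f := fun y : Fin (m + 1) × List (Fin n) => y.2.length) hx)
        (Finset.le_sup (f := fun x : F × Fin m =>
          (w x.1 x.2).support.sup fun y => y.2.length) (Finset.mem_univ (f, a)))
    · rwa [eval_rename_eq_of_mem_supported (hF0 f) (f' := jetVar K) (x' := p) fun v hv => ?_]
      rw [truncJ, jetVar, jetVar, upT_tupOf h (le_trans hv (le_max_left _ _))]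
  obtain ⟨g, rfl⟩ := exists_rename_eq_of_mem_supported
    (f := (Subtype.val : lowVars (UClass n m r) n t₀ → _)) (by rwa [Subtype.range_coe])
  have hle : J ≤ RingHom.ker (((aeval p : MvPolynomial _ ℝ →ₐ[ℝ] ℝ).comp
      ((rename (jetVar K)).comp (rename Subtype.val))) :
        MvPolynomial (lowVars (UClass n m r) n t₀) ℝ →ₐ[ℝ] ℝ) := by
    rw [← hF]
    exact Ideal.span_le.2 fun f hf => hgen ⟨f, hf⟩
  exact hle (show g ∈ J from hd)

end ToJet


/-! ### Dimension of the bad jets and maximality -/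

section Dimension

open MvPolynomial

variable {n m r K : ℕ}

lemma exists_perm_of_ofFn_perm {γ γ' : Tup n K} (h : (List.ofFn γ.2).Perm (List.ofFn γ'.2)) :
    ∃ π : Equiv.Perm (Fin (γ.1 : ℕ)), γ' = ⟨γ.1, γ.2 ∘ π⟩ := by
  classical
  obtain ⟨j, γ⟩ := γ
  obtain ⟨j', γ'⟩ := γ'
  obtain rfl : j = j' := Fin.ext (by simpa using h.length_eq)
  have h1 : ∃ π : Equiv.Perm (Fin (j : ℕ)), γ ∘ π = γ' := by
    have h2 := List.ofFn_injective ((((Equiv.Perm.ofFn_comp_perm (Tuple.sort γ) γ).trans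
      h).trans (Equiv.Perm.ofFn_comp_perm (Tuple.sort γ') γ').symm).eq_of_pairwise'
        (Tuple.monotone_sort γ).sortedLE_ofFn.pairwise
        (Tuple.monotone_sort γ').sortedLE_ofFn.pairwise)
    refine ⟨Tuple.sort γ * (Tuple.sort γ')⁻¹, ?_⟩
    rw [Equiv.Perm.coe_mul, ← Function.comp_assoc, h2, Function.comp_assoc, ← Equiv.Perm.coe_mul,
      mul_inv_cancel, Equiv.Perm.coe_one, Function.comp_id]
  obtain ⟨π, rfl⟩ := h1
  exact ⟨π, rfl⟩

/-- The independent variable represented by a fibre coordinate of the bundle of `K`-jets. -/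
def lowVarOf (x : JetIdx n (m + 1) m r K) : lowVars (UClass n m r) n K :=
  ⟨(uclass x.1 x.2.1 x.2.2.1, ↑(List.ofFn x.2.2.2.2)), by
    simpa [lowVars] using Nat.le_of_lt_succ x.2.2.2.1.2⟩

lemma lowVarOf_jetVar (v : lowVars (UClass n m r) n K) : lowVarOf (jetVar K v.1) = v := by
  refine Subtype.ext (Prod.ext (uclass_out _) ?_)
  change ((List.ofFn (tupOf K v.1.2).2 : List (Fin n)) : Multiset (Fin n)) = _
  rw [ofFn_tupOf v.2, Multiset.coe_toList]

lemma comp_lowVarOf_mem_utsJets (x : lowVars (UClass n m r) n K → ℝ) :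
    x ∘ lowVarOf ∈ utsJets n m r K := by
  refine ⟨fun a α β j γ π => congrArg x (Subtype.ext (Prod.ext rfl ?_)), fun γ => ?_⟩
  · exact Multiset.coe_eq_coe.2 (Equiv.Perm.ofFn_comp_perm π γ)
  · have hc : Multiset.card ((List.ofFn γ.2 : List (Fin n)) : Multiset (Fin n)) ≤ K := by
      simpa using Nat.le_of_lt_succ γ.1.2
    exact ⟨isSymm_of_uclass fun c => x ⟨(c, ↑(List.ofFn γ.2)), hc⟩,
      isUTS_of_uclass fun c => x ⟨(c, ↑(List.ofFn γ.2)), hc⟩⟩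

lemma apply_jetVar_lowVarOf {p : JetIdx n (m + 1) m r K → ℝ} (hp : p ∈ utsJets n m r K)
    (x : JetIdx n (m + 1) m r K) : p (jetVar K (lowVarOf x).1) = p x := by
  obtain ⟨a, α, β, γ⟩ := x
  have hc : Multiset.card ((List.ofFn γ.2 : List (Fin n)) : Multiset (Fin n)) ≤ K := by
    simpa using Nat.le_of_lt_succ γ.1.2
  obtain ⟨π, hπ⟩ := exists_perm_of_ofFn_perm (γ := γ)
    (γ' := tupOf K ↑(List.ofFn γ.2)) (by
      rw [ofFn_tupOf hc, ← Multiset.coe_eq_coe, Multiset.coe_toList])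
  have h1 := comp_uclass (hp.2 γ).1 (hp.2 γ).2 a α β
  rw [← h1]
  change p (_, _, _, tupOf K ↑(List.ofFn γ.2)) = _
  rw [hπ, hp.1]
  rfl

lemma ringKrullDim_quotient_le_comap {A B : Type*} [CommRing A] [CommRing B] (f : A →+* B)
    (I : Ideal B) (h : ∀ b, ∃ a, f a - b ∈ I) :
    ringKrullDim (B ⧸ I) ≤ ringKrullDim (A ⧸ I.comap f) := by
  refine ringKrullDim_le_of_surjective (Ideal.quotientMap I f le_rfl) fun q => ?_
  obtain ⟨b, rfl⟩ := Ideal.Quotient.mk_surjective q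
  obtain ⟨a, ha⟩ := h b
  exact ⟨Ideal.Quotient.mk _ a, by rwa [Ideal.quotientMap_mk, Ideal.Quotient.eq]⟩

/-- On `utsJets` every fibre coordinate equals the one that represents its independent variable, so
polynomials in the independent variables exhaust the functions on `Z`. -/
lemma algDim_le_of_subset {Z : Set (JetIdx n (m + 1) m r K → ℝ)} (hZ : Z ⊆ utsJets n m r K) :
    algDim Z ≤ ringKrullDim (MvPolynomial (lowVars (UClass n m r) n K) ℝ ⧸
      (vanishingIdeal ℝ Z).comap (rename fun v => jetVar K v.1).toRingHom) := by
  refine ringKrullDim_quotient_le_comap _ _ fun P => ⟨rename lowVarOf P, fun p hp => ?_⟩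
  change aeval p (rename _ (rename _ P) - P) = 0
  rw [map_sub, rename_rename, aeval_rename, sub_eq_zero]
  exact congrArg (fun x => aeval x P) (funext (apply_jetVar_lowVarOf (hZ hp)))

/-- Arbitrary values of the independent variables give a point of `utsJets`, so restriction to these
points is a surjection onto their polynomial ring. -/
lemma card_lowVars_le_algDim :
    (Nat.card (lowVars (UClass n m r) n K) : WithBot ℕ∞) ≤ algDim (utsJets n m r K) := by
  have h1 : ringKrullDim (MvPolynomial (lowVars (UClass n m r) n K) ℝ)
      = (Nat.card (lowVars (UClass n m r) n K) : WithBot ℕ∞) := by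
    rw [MvPolynomial.ringKrullDim_of_isNoetherianRing, ringKrullDim_eq_zero_of_field, zero_add]
  rw [← h1]
  refine ringKrullDim_le_of_surjective (Ideal.Quotient.lift _
    (rename (lowVarOf (n := n) (m := m) (r := r) (K := K))).toRingHom fun P hP => ?_) fun Q => ?_
  · refine MvPolynomial.funext fun x => ?_
    change eval x (rename lowVarOf P) = _
    rw [eval_rename, map_zero]
    exact mem_vanishingIdeal_iff.1 hP _ (comp_lowVarOf_mem_utsJets x)
  · refine ⟨Ideal.Quotient.mk _ (rename (fun v => jetVar K v.1) Q), ?_⟩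
    rw [Ideal.Quotient.lift_mk]
    change rename lowVarOf (rename _ Q) = Q
    rw [rename_rename, show lowVarOf ∘ (fun v : lowVars (UClass n m r) n K => jetVar K v.1) = id
      from funext lowVarOf_jetVar, rename_id_apply]

lemma add_lt_of_add_succ_le {a b : WithBot ℕ∞} {N : ℕ} (h : a + (n + 1 : ℕ) ≤ N)
    (hN : (N : WithBot ℕ∞) ≤ b) : a + n < b := by
  refine lt_of_lt_of_le ?_ hN
  induction a with
  -- The case of an empty complement, whose dimension is `⊥`.
  | bot => rw [WithBot.bot_add]; exact WithBot.bot_lt_coe (N : ℕ∞)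
  | coe a =>
    have h1 : a + (n + 1 : ℕ) ≤ N := by exact_mod_cast h
    induction a using ENat.recTopCoe with
    | top => simp at h1
    | coe a =>
      have h2 : a + (n + 1) ≤ N := by exact_mod_cast h1
      have h3 : a + n < N := by omega
      exact_mod_cast h3

/-- The multipliers of order at most `t₀` vanish on the complement of the good jets, hence on that
of any larger `S`, and `exists_level_dim` applies to its vanishing ideal. -/
theorem exists_orders_algDim_lt (n m r : ℕ) (hm : 1 ≤ m) (hr : 1 ≤ r) : ∃ k t, ∀ (K : ℕ)
    (h : k ≤ K) (S : Set (JetIdx n (m + 1) m r K → ℝ)), goodJets n m r t h ⊆ S →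
      algDim (utsJets n m r K \ S) + (n : WithBot ℕ∞) < algDim (utsJets n m r K) := by
  obtain ⟨t₀, ht₀⟩ := exists_level_dim (cls := (uclass : Fin m → Fin (m + 1) → Tup n r → _)) hm hr
    (fun a α a' α' β => uclass_nilTup_injective hr) uweight uweight_uclass
  obtain ⟨k, t, hk, hkt⟩ := exists_orders_goodJets n m r t₀
  refine ⟨k, t, fun K h S hS => ?_⟩
  refine add_lt_of_add_succ_le (le_trans (add_le_add_left
    (algDim_le_of_subset Set.sdiff_subset) _) (ht₀ (lowVars (UClass n m r) n K) Subtype.val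
      Subtype.val_injective ?_ _ fun f hf hf' => ?_)) card_lowVars_le_algDim
  · rw [Subtype.range_coe]
    exact lowVars_mono (hk.trans h)
  · rw [Ideal.mem_comap, mem_vanishingIdeal_iff]
    rintro p ⟨hp, hpS⟩
    have h1 := hkt K h p hp (fun hg => hpS (hS hg)) _ hf hf'
    rwa [rename_rename] at h1

lemma IsZariskiOpenIn.eq_of_vanishingIdeal_le {ι : Type} {S T X : Set (ι → ℝ)}
    (hT : IsZariskiOpenIn T X) (hST : S ⊆ T)
    (h : vanishingIdeal ℝ (X \ T) ≤ vanishingIdeal ℝ (X \ S)) : T = S := by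
  obtain ⟨I, rfl⟩ := hT
  refine Set.Subset.antisymm ?_ hST
  rintro p ⟨hp, P, hP, hne⟩
  by_contra hpS
  refine hne (mem_vanishingIdeal_iff.1 (h (mem_vanishingIdeal_iff.2 ?_)) p ⟨hp, hpS⟩)
  rintro q ⟨hq, hqT⟩
  by_contra hq0
  exact hqT ⟨hq, P, hP, hq0⟩

/-- By the ascending chain condition some candidate above `G` has a maximal vanishing ideal of its
complement, and a Zariski open set is determined by this ideal. -/
lemma exists_maximal_isZariskiOpenIn {ι : Type} [Finite ι] {X G : Set (ι → ℝ)}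
    {p : Set (ι → ℝ) → Prop} (hp : ∀ T, p T → IsZariskiOpenIn T X) (hG : p G) :
    ∃ S, G ⊆ S ∧ Maximal p S := by
  obtain ⟨_, ⟨S, ⟨hS, hGS⟩, rfl⟩, hmax⟩ := WellFounded.has_min
    (wellFounded_gt (α := Ideal (MvPolynomial ι ℝ)))
    ((fun T => vanishingIdeal ℝ (X \ T)) '' {T | p T ∧ G ⊆ T}) ⟨_, G, ⟨hG, subset_rfl⟩, rfl⟩
  refine ⟨S, hGS, hS, fun T hT hST => ?_⟩
  have h1 : vanishingIdeal ℝ (X \ S) ≤ vanishingIdeal ℝ (X \ T) :=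
    vanishingIdeal_anti_mono (Set.sdiff_subset_sdiff_right hST)
  have h2 : vanishingIdeal ℝ (X \ T) ≤ vanishingIdeal ℝ (X \ S) := by
    by_contra hne
    exact hmax _ ⟨T, ⟨hT, hGS.trans hST⟩, rfl⟩ (lt_of_le_not_ge h1 hne)
  exact ((hp T hT).eq_of_vanishingIdeal_le hST h2).le

end Dimension

end UTS

theorem mainTheorem7 (n m r : ℕ) (hm : 1 ≤ m) (hr : 1 ≤ r) :
    ∃ sbar : ℕ,
      (n : ℝ) / ((1 + 1 / (m : ℝ)) ^ (1 / (r : ℝ)) - 1) ≤ (sbar : ℝ) ∧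
      ∀ s : ℕ, sbar ≤ s →
        ∀ (M : Type*) [TopologicalSpace M] [T2Space M] [SecondCountableTopology M]
          [ChartedSpace (UTS.E n) M] [IsManifold (𝓡 n) ∞ M]
          (𝒜 : Set (OpenPartialHomeomorph M (UTS.E n))), UTS.IsUTSAtlas m r 𝒜 →
        ∃ S : Set (UTS.JetIdx n (m + 1) m r (r + s) → ℝ),
          Maximal (fun T => UTS.IsAlgebraicSubbundle 𝒜 m r (r + s) T ∧
            ∃ R, UTS.IsUniversalRightInverse 𝒜 m r s T R) S ∧
          UTS.algDim (UTS.utsJets n m r (r + s) \ S) + (n : WithBot ℕ∞)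
            < UTS.algDim (UTS.utsJets n m r (r + s)) := by
  obtain ⟨k, t, hkt⟩ := UTS.exists_orders_algDim_lt n m r hm hr
  -- The construction needs only `k + t ≤ s`; the other term enforces the required lower bound for
  -- `sbar`.
  refine ⟨max (k + t) ⌈(n : ℝ) / ((1 + 1 / (m : ℝ)) ^ (1 / (r : ℝ)) - 1)⌉₊,
    (Nat.le_ceil _).trans (by exact_mod_cast le_max_right _ _), ?_⟩
  intro s hs M _ _ _ _ _ 𝒜 h𝒜
  have hs' : k + t ≤ s := (le_max_left _ _).trans hs
  have hK : k + t ≤ r + s := hs'.trans (Nat.le_add_left s r)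
  obtain ⟨S, hGS, hS⟩ := UTS.exists_maximal_isZariskiOpenIn
    (p := fun T => UTS.IsAlgebraicSubbundle 𝒜 m r (r + s) T ∧
      ∃ R, UTS.IsUniversalRightInverse 𝒜 m r s T R)
    (fun T hT => hT.1.1) ⟨UTS.isAlgebraicSubbundle_goodJets h𝒜 _,
      UTS.exists_isUniversalRightInverse_goodJets h𝒜 hK ((Nat.le_add_left t k).trans hs')⟩
  exact ⟨S, hS, hkt _ _ S hGS⟩
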